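/- **Theorem (Deterministic Local Alignment Hardness).** All algorithms are deterministic algorithms on a word RAM with words of $O(\log n)$ bits, where $n$ is the size parameter of the instance. *3SUM over $\{1,\dots,U\}$:* given a set $A\subseteq\{1,\dots,U\}$ of size $n$, decide whether there are $a,b,c\in A$ with $a+b=c$. *Deterministic 3SUM hypothesis:* for every $\epsilon>0$ there is a constant $c$ such that no deterministic algorithm solves 3SUM over $\{1,\dots,n^c\}$ in time $O(n^{2-\epsilon})$. *Local Alignment:* given two strings $X,Y\in\Sigma^n$ over a finite alphabet $\Sigma$ and a scoring function $s:\Sigma\times\Sigma\to\mathbb Z$ (given as a table), compute substrings $X'$ of $X$ and $Y'$ of $Y$ of equal length (represented by their starting positions and their common length; the empty substring is allowed) that maximize $\sum_{i=1}^{|X'|}s(X'[i],Y'[i])$. Let $0<\delta<1$ and assume the deterministic 3SUM hypothesis. Then there are constants $C$ and $k$ such that, for all integers $\kappa\ge 1$ and all $\epsilon>0$, no deterministic algorithm solves Local Alignment on two strings of length $n$ over an alphabet of size at most $C\,n^{1-\delta}(\log n)^{k}$ (that is, of size $\widetilde O(n^{1-\delta})$), with all scores in $\{-n^\kappa,\dots,n^\kappa\}$,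 in time $O(n^{2-\delta-\epsilon})$. -/

import Mathlib

/-! ## Deterministic word RAM

The words are integers of bounded absolute value; the memory consists of variables (registers) and
of integer-indexed arrays, a given program mentioning only finitely many of them. Programs are
structured (sequencing, branching, loops). Every elementary operation costs one step. -/

namespace WordRAM

/-- The binary operations on words. Comparisons return `1` (true) or `0` (false). -/
inductive Op
  | add | sub | mul | div | mod | lt | eq | and | or | xor | shl | shr

def Op.eval : Op → ℤ → ℤ → ℤ
  | .add, a, b => a + b
  | .sub, a, b => a - b
  | .mul, a, b => a * b
  | .div, a, b => a / b
  | .mod, a, b => a % b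
  | .lt, a, b => if a < b then 1 else 0
  | .eq, a, b => if a = b then 1 else 0
  | .and, a, b => Int.land a b
  | .or, a, b => Int.lor a b
  | .xor, a, b => Int.xor a b
  | .shl, a, b => a * 2 ^ b.toNat
  | .shr, a, b => a / 2 ^ b.toNat

/-- The content of the memory: `var x` is the value of the variable number `x`, and `arr A i` is
the entry of the array number `A` at the address `i`. -/
structure State where
  var : ℕ → ℤ
  arr : ℕ → ℤ → ℤ

def State.setVar (s : State) (x : ℕ) (v : ℤ) : State :=
  { s with var := Function.update s.var x v }

def State.setArr (s : State) (A : ℕ) (i v : ℤ) : State :=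
  { s with arr := Function.update s.arr A (Function.update (s.arr A) i v) }

inductive Expr
  | lit (z : ℤ)
  | var (x : ℕ)
  | get (A : ℕ) (i : Expr)
  | bin (o : Op) (a b : Expr)

namespace Expr

def eval (s : State) : Expr → ℤ
  | lit z => z
  | var x => s.var x
  | get A i => s.arr A (i.eval s)
  | bin o a b => o.eval (a.eval s) (b.eval s)

/-- The number of elementary operations in the evaluation of an expression. -/
def cost : Expr → ℕ
  | lit _ => 1
  | var _ => 1
  | get _ i => i.cost + 1
  | bin _ a b => a.cost + b.cost + 1

/-- All values that occur in the evaluation of the expression (addresses and intermediate results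
included) have absolute value at most `W`. -/
def Fits (W : ℕ) (s : State) : Expr → Prop
  | lit z => |z| ≤ W
  | var x => |s.var x| ≤ W
  | get A i => i.Fits W s ∧ |s.arr A (i.eval s)| ≤ W
  | bin o a b => a.Fits W s ∧ b.Fits W s ∧ |o.eval (a.eval s) (b.eval s)| ≤ W

end Expr

/-- Programs: do nothing; `x := e`; `A[i] := e`; sequencing; `if e ≠ 0 then p else q`;
`while e ≠ 0 do p`. -/
inductive Program
  | skip
  | assign (x : ℕ) (e : Expr)
  | store (A : ℕ) (i e : Expr)
  | seq (p q : Program)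
  | cond (e : Expr) (p q : Program)
  | loop (e : Expr) (p : Program)

/-- `Run W p s t s'`: on a machine whose words are the integers of absolute value at most `W`, the
program `p`, started in the state `s`, halts after `t` steps in the state `s'`. A computation in
which a value does not fit into a word has no result. -/
inductive Run (W : ℕ) : Program → State → ℕ → State → Prop
  | skip (s : State) : Run W .skip s 1 s
  | assign (x : ℕ) (e : Expr) (s : State) (he : e.Fits W s) :
      Run W (.assign x e) s (e.cost + 1) (s.setVar x (e.eval s))
  | store (A : ℕ) (i e : Expr) (s : State) (hi : i.Fits W s) (he : e.Fits W s) :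
      Run W (.store A i e) s (i.cost + e.cost + 1) (s.setArr A (i.eval s) (e.eval s))
  | seq {p q : Program} {s s₁ s₂ : State} {t₁ t₂ : ℕ} (hp : Run W p s t₁ s₁)
      (hq : Run W q s₁ t₂ s₂) : Run W (.seq p q) s (t₁ + t₂) s₂
  | cond_true {e : Expr} {p q : Program} {s s₁ : State} {t : ℕ} (he : e.Fits W s)
      (h : e.eval s ≠ 0) (hp : Run W p s t s₁) : Run W (.cond e p q) s (e.cost + 1 + t) s₁
  | cond_false {e : Expr} {p q : Program} {s s₁ : State} {t : ℕ} (he : e.Fits W s)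
      (h : e.eval s = 0) (hq : Run W q s t s₁) : Run W (.cond e p q) s (e.cost + 1 + t) s₁
  | loop_true {e : Expr} {p : Program} {s s₁ s₂ : State} {t₁ t₂ : ℕ} (he : e.Fits W s)
      (h : e.eval s ≠ 0) (hp : Run W p s t₁ s₁) (hl : Run W (.loop e p) s₁ t₂ s₂) :
      Run W (.loop e p) s (e.cost + 1 + t₁ + t₂) s₂
  | loop_false {e : Expr} {p : Program} {s : State} (he : e.Fits W s) (h : e.eval s = 0) :
      Run W (.loop e p) s (e.cost + 1) s

/-- The machine is deterministic. -/
theorem Run.deterministic {W : ℕ} {p : Program} {s s₁ : State} {t₁ : ℕ} (h₁ : Run W p s t₁ s₁) :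
    ∀ {t₂ : ℕ} {s₂ : State}, Run W p s t₂ s₂ → t₁ = t₂ ∧ s₁ = s₂ := by
  induction h₁ with
  | skip s => intro _ _ h; cases h; exact ⟨rfl, rfl⟩
  | assign x e s he => intro _ _ h; cases h; exact ⟨rfl, rfl⟩
  | store A i e s hi he => intro _ _ h; cases h; exact ⟨rfl, rfl⟩
  | seq hp hq ihp ihq =>
    intro _ _ h
    cases h with
    | seq hp' hq' =>
      obtain ⟨rfl, rfl⟩ := ihp hp'
      obtain ⟨rfl, rfl⟩ := ihq hq'
      exact ⟨rfl, rfl⟩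
  | cond_true he h0 hp ih =>
    intro _ _ h
    cases h with
    | cond_true _ _ hp' => obtain ⟨rfl, rfl⟩ := ih hp'; exact ⟨rfl, rfl⟩
    | cond_false _ h0' _ => exact absurd h0' h0
  | cond_false he h0 hp ih =>
    intro _ _ h
    cases h with
    | cond_false _ _ hp' => obtain ⟨rfl, rfl⟩ := ih hp'; exact ⟨rfl, rfl⟩
    | cond_true _ h0' _ => exact absurd h0 h0'
  | loop_true he h0 hp hl ihp ihl =>
    intro _ _ h
    cases h with
    | loop_true _ _ hp' hl' =>
      obtain ⟨rfl, rfl⟩ := ihp hp'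
      obtain ⟨rfl, rfl⟩ := ihl hl'
      exact ⟨rfl, rfl⟩
    | loop_false _ h0' => exact absurd h0' h0
  | loop_false he h0 =>
    intro _ _ h
    cases h with
    | loop_true _ h0' _ _ => exact absurd h0 h0'
    | loop_false _ _ => exact ⟨rfl, rfl⟩

/-- A computational problem: its instances, their size parameter `n`, the initial memory content
that presents an instance to the machine, and the final memory contents that count as a correct
answer to an instance. -/
structure Problem where
  Instance : Type
  size : Instance → ℕ
  input : Instance → State
  Correct : Instance → State → Prop

/-- The problem is solved by a deterministic algorithm in time `O(T n)` on a word RAM with words of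
`O(log n)` bits, that is, with words of absolute value at most `(n + 2) ^ K` for a constant `K`. -/
def Problem.SolvableInTime (P : Problem) (T : ℕ → ℝ) : Prop :=
  ∃ (p : Program) (K : ℕ) (τ : ℕ → ℕ),
    (fun n => (τ n : ℝ)) =O[Filter.atTop] T ∧
    ∀ I : P.Instance, ∃ (t : ℕ) (s : State),
      Run ((P.size I + 2) ^ K) p (P.input I) t s ∧ t ≤ τ (P.size I) ∧ P.Correct I s

/-- The array with the entries `f 0, …, f (n - 1)` at the addresses `0, …, n - 1`, and `0` at all
other addresses. -/
def arrayOf {n : ℕ} (f : Fin n → ℤ) : ℤ → ℤ :=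
  fun z => if h : 0 ≤ z ∧ z.toNat < n then f ⟨z.toNat, h.2⟩ else 0

end WordRAM

/-! ## 3SUM -/

/-- An instance of 3SUM over the universe `{1, …, n ^ c}`: a set of size `n`, given by a listing of
its elements in any order. -/
structure ThreeSumInstance (c : ℕ) where
  n : ℕ
  elem : Fin n → ℕ
  injective : Function.Injective elem
  mem_universe : ∀ i, elem i ∈ Finset.Icc 1 (n ^ c)

def ThreeSumInstance.HasSolution {c : ℕ} (I : ThreeSumInstance c) : Prop :=
  ∃ x ∈ Set.range I.elem, ∃ y ∈ Set.range I.elem, ∃ z ∈ Set.range I.elem, x + y = z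

open Classical in
/-- Input: variable `0` holds `n`, array `0` holds the elements. Output: variable `0` holds `1` if
there is a solution, and `0` otherwise. -/
noncomputable def threeSum (c : ℕ) : WordRAM.Problem where
  Instance := ThreeSumInstance c
  size I := I.n
  input I :=
    { var := fun x => if x = 0 then (I.n : ℤ) else 0
      arr := fun A => if A = 0 then WordRAM.arrayOf (fun i => (I.elem i : ℤ)) else fun _ => 0 }
  Correct I s := s.var 0 = if I.HasSolution then 1 else 0

/-- For every `ε > 0` there is a constant `c` such that no deterministic algorithm solves 3SUM over
`{1, …, n ^ c}` in time `O(n ^ (2 - ε))`. -/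
def DeterministicThreeSumHypothesis : Prop :=
  ∀ ε : ℝ, 0 < ε → ∃ c : ℕ, ¬ (threeSum c).SolvableInTime (fun n => (n : ℝ) ^ (2 - ε))

/-! ## Local Alignment -/

/-- An instance of Local Alignment: two strings `X`, `Y` of length `n` over the alphabet
`{0, …, m - 1}`, and a scoring function. -/
structure LocalAlignmentInstance where
  n : ℕ
  m : ℕ
  X : Fin n → Fin m
  Y : Fin n → Fin m
  score : Fin m → Fin m → ℤ

namespace LocalAlignmentInstance

/-- The total score of the substrings of length `l` that start at position `i` of `X` and at
position `j` of `Y`. -/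
def value (I : LocalAlignmentInstance) (i j l : ℕ) (hi : i + l ≤ I.n) (hj : j + l ≤ I.n) : ℤ :=
  ∑ r : Fin l, I.score (I.X ⟨i + r, by omega⟩) (I.Y ⟨j + r, by omega⟩)

/-- The substrings of length `l` at position `i` of `X` and at position `j` of `Y` have the largest
total score among all pairs of substrings of equal length. -/
def IsOptimal (I : LocalAlignmentInstance) (i j l : ℕ) : Prop :=
  ∃ (hi : i + l ≤ I.n) (hj : j + l ≤ I.n),
    ∀ (i' j' l' : ℕ) (hi' : i' + l' ≤ I.n) (hj' : j' + l' ≤ I.n),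
      I.value i' j' l' hi' hj' ≤ I.value i j l hi hj

end LocalAlignmentInstance

/-- Local Alignment on two strings of length `n`, over an alphabet of size at most `σ n`, with
scores in `{-n ^ κ, …, n ^ κ}`.

Input: variable `0` holds `n`, variable `1` holds the alphabet size `m`, the arrays `0` and `1` hold
the strings `X` and `Y`, and array `2` holds `score a b` at the address `a * m + b`.
Output: the variables `0`, `1`, `2` hold the starting positions and the common length of optimal
substrings. -/
def localAlignment (σ : ℕ → ℝ) (κ : ℕ) : WordRAM.Problem where
  Instance := { I : LocalAlignmentInstance //
    (I.m : ℝ) ≤ σ I.n ∧ ∀ a b, |I.score a b| ≤ (I.n : ℤ) ^ κ }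
  size I := I.1.n
  input I :=
    { var := fun x => if x = 0 then (I.1.n : ℤ) else if x = 1 then (I.1.m : ℤ) else 0
      arr := fun A =>
        if A = 0 then WordRAM.arrayOf (fun i => ((I.1.X i : ℕ) : ℤ))
        else if A = 1 then WordRAM.arrayOf (fun i => ((I.1.Y i : ℕ) : ℤ))
        else if A = 2 then
          WordRAM.arrayOf (fun r : Fin (I.1.m * I.1.m) => I.1.score r.divNat r.modNat)
        else fun _ => 0 }
  Correct I s := ∃ i j l : ℕ,
    s.var 0 = i ∧ s.var 1 = j ∧ s.var 2 = l ∧ I.1.IsOptimal i j l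

/-! Let `g` be the integral `b`-th root of the number `n` of elements, for a large constant `b`: it
dominates every logarithm of interest and is still only a tiny power of `n`. Suppose `F` assigns one
candidate sum to each residue class modulo `q`. Whether `x + y = F ((x + y) % q)` holds for some two
elements is a single Local Alignment question. Each number becomes a block of `g` letters, the
letter at position `i` recording `x % q`, `i` and `x % (i + 1)`. Two letters at the same position `i
≠ 0` determine the class of `x + y` modulo `q` and modulo `i + 1`, so a score table can test whether
`i + 1` divides `x + y - F ((x + y) % q)`: success scores 1, everything else minus the string length
(`score_letter`). Position 0 never matches and acts as a separator, and one mismatch makes a total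
negative. Since lcm(1, …, g) exceeds all differences that occur, two blocks that agree at every
other position give an exact equality (`eq_zero_of_forall_dvd`). Hence an optimal alignment points
to a matching pair whenever one exists (`solution_of_isOptimal`).

All elements have to be tried as sums, and no randomness is available. A round searches exhaustively
for the modulus `q ≤ Q = g ^ a` that leaves the fewest candidates beyond the first `K = g ^ k` of
each residue class. Then `K` passes each extract one candidate per class and call the aligner. Two
distinct numbers below `U` collide modulo at most log `U` primes, so averaging over the primes up to
`Q` yields a modulus that leaves at most half of the candidates (`exists_overflow_le`). Thus a round
halves the list (`wp_round`), and `g` rounds empty it because `n < 2 ^ g` (`wp_rounds`).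

The cost is about `g ^ (k + 1)` calls on strings of length `n * g` over at most `g ^ (a + 2)`
letters. With `a` close to `b (1 - δ)` and `a + k = b + 3`, the alphabet is small enough, the
capacity `K` suffices, and the total is `O(g ^ (2 b - 1))`, which is `O(n ^ (2 - 1 / b))`
(`exists_exponents`, `mainTime_le`). The saving `1 / b` does not depend on the exponent of the
universe, so the 3SUM hypothesis is violated (`threeSum_solvable`).

The rest is the machine model. `Wp` is a total-correctness logic with time and word bounds.
`Run.shift` runs the assumed aligner inside a zone of memory. The aligner expects zeroed memory and
a used zone would be too expensive to clear, so every call gets a fresh zone; the addresses stay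
polynomial in `n`. -/

/-! ## Reasoning about word RAM programs -/

namespace WordRAM

namespace State

theorem setVar_var (s : State) (x : ℕ) (v : ℤ) (y : ℕ) :
    (s.setVar x v).var y = if y = x then v else s.var y :=
  Function.update_apply _ _ _ _

@[simp] theorem setVar_arr (s : State) (x : ℕ) (v : ℤ) : (s.setVar x v).arr = s.arr := rfl

@[simp] theorem setArr_var (s : State) (A : ℕ) (i v : ℤ) : (s.setArr A i v).var = s.var := rfl

theorem setArr_arr (s : State) (A : ℕ) (i v : ℤ) (A' : ℕ) (j : ℤ) :
    (s.setArr A i v).arr A' j = if A' = A ∧ j = i then v else s.arr A' j := by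
  unfold setArr
  by_cases h : A' = A
  · subst h
    by_cases h' : j = i
    · subst h'; simp
    · simp [h']
  · simp [h]

/-- All memory contents have absolute value at most `B`. -/
def BoundedBy (B : ℕ) (s : State) : Prop :=
  (∀ x, |s.var x| ≤ B) ∧ ∀ A i, |s.arr A i| ≤ B

theorem BoundedBy.setVar {B : ℕ} {s : State} (h : s.BoundedBy B) {x : ℕ} {v : ℤ} (hv : |v| ≤ B) :
    (s.setVar x v).BoundedBy B := by
  refine ⟨fun y => ?_, fun A i => h.2 A i⟩
  rw [setVar_var]
  split_ifs
  · exact hv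
  · exact h.1 y

theorem BoundedBy.setArr {B : ℕ} {s : State} (h : s.BoundedBy B) {A : ℕ} {i v : ℤ}
    (hv : |v| ≤ B) : (s.setArr A i v).BoundedBy B := by
  refine ⟨fun y => h.1 y, fun A' j => ?_⟩
  rw [setArr_arr]
  split_ifs
  · exact hv
  · exact h.2 A' j

end State

/-- The operations that do not act on the bits of their arguments. -/
def Op.isArith : Op → Bool
  | .add | .sub | .mul | .div | .mod | .lt | .eq => true
  | _ => false

/-! ### Size bounds for the values of expressions -/

namespace Expr

/-- Only arithmetical operations and literals of absolute value at most `2` occur. -/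
def isPlain : Expr → Bool
  | lit z => z.natAbs ≤ 2
  | var _ => true
  | get _ i => i.isPlain
  | bin o a b => o.isArith && a.isPlain && b.isPlain

/-- A plain expression over memory contents of size at most `B` has size at most `B ^ deg`. -/
def deg : Expr → ℕ
  | lit _ => 1
  | var _ => 1
  | get _ i => i.deg
  | bin .mul a b => a.deg + b.deg
  | bin _ a b => max a.deg b.deg + 1

theorem one_le_deg : ∀ e : Expr, 1 ≤ e.deg
  | lit _ => le_rfl
  | var _ => le_rfl
  | get _ i => i.one_le_deg
  | bin o a b => by
    have := a.one_le_deg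
    cases o <;> simp only [deg] <;> omega

theorem deg_bin_left (o : Op) (a b : Expr) : a.deg ≤ (bin o a b).deg := by
  cases o <;> simp only [deg] <;> omega

theorem deg_bin_right (o : Op) (a b : Expr) : b.deg ≤ (bin o a b).deg := by
  cases o <;> simp only [deg] <;> omega

theorem abs_emod_le (a b : ℤ) : |a % b| ≤ max |a| |b| := by
  rcases eq_or_ne b 0 with rfl | hb
  · simp
  · rw [abs_of_nonneg (Int.emod_nonneg a hb)]
    exact (Int.emod_lt_abs a hb).le.trans (le_max_right _ _)

/-- Degrees add under multiplication. A sum at most doubles the larger bound, and `2 ≤ B` lets one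
more factor `B` absorb the doubling. -/
theorem abs_eval_le {B : ℕ} (hB : 2 ≤ B) {s : State} (hs : s.BoundedBy B) :
    ∀ e : Expr, e.isPlain → |e.eval s| ≤ (B : ℤ) ^ e.deg
  | lit z, h => by
    simp only [isPlain, decide_eq_true_eq] at h
    simp only [eval, deg, pow_one]
    rw [abs_le]
    omega
  | var x, _ => by simpa [eval, deg] using hs.1 x
  | get A i, _ => by
    have h1 : (1 : ℤ) ≤ B := by omega
    calc |(get A i).eval s| ≤ (B : ℤ) ^ 1 := by simpa [eval] using hs.2 A _
      _ ≤ (B : ℤ) ^ (get A i).deg := pow_le_pow_right₀ h1 (one_le_deg _)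
  | bin o a b, h => by
    simp only [isPlain, Bool.and_eq_true] at h
    obtain ⟨⟨ho, ha⟩, hb⟩ := h
    have ia := a.abs_eval_le hB hs ha
    have ib := b.abs_eval_le hB hs hb
    have h1 : (1 : ℤ) ≤ B := by omega
    have h2 : (2 : ℤ) ≤ B := by omega
    have ja := ia.trans (pow_le_pow_right₀ h1 (le_max_left a.deg b.deg))
    have jb := ib.trans (pow_le_pow_right₀ h1 (le_max_right a.deg b.deg))
    have hM : (1 : ℤ) ≤ (B : ℤ) ^ max a.deg b.deg := one_le_pow₀ h1
    have hS : 2 * (B : ℤ) ^ max a.deg b.deg ≤ (B : ℤ) ^ (max a.deg b.deg + 1) := by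
      rw [pow_succ, mul_comm]; gcongr
    simp only [eval]
    cases o <;> simp only [Op.isArith, Bool.false_eq_true] at ho <;> simp only [Op.eval, deg]
    · exact (abs_add_le _ _).trans (by linarith)
    · exact (abs_sub _ _).trans (by linarith)
    · rw [abs_mul, pow_add]; gcongr
    · have : |a.eval s / b.eval s| ≤ |a.eval s| := Int.abs_ediv_le_abs _ _
      linarith
    · have := (abs_emod_le (a.eval s) (b.eval s)).trans (max_le ja jb)
      linarith
    · (split_ifs <;> simp); linarith
    · (split_ifs <;> simp); linarith

/-- Turns the absence of word overflow into a syntactic condition, uniform over all bounded states.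
-/
theorem fits_of_isPlain {B : ℕ} (hB : 2 ≤ B) {s : State} (hs : s.BoundedBy B) {W : ℕ} :
    ∀ e : Expr, e.isPlain → B ^ e.deg ≤ W → e.Fits W s
  | lit z, h, hW => by
    have := abs_eval_le hB hs (lit z) h
    exact this.trans (by exact_mod_cast hW)
  | var x, h, hW => (abs_eval_le hB hs (var x) h).trans (by exact_mod_cast hW)
  | get A i, h, hW =>
    ⟨i.fits_of_isPlain hB hs h hW, (abs_eval_le hB hs (get A i) h).trans (by exact_mod_cast hW)⟩
  | bin o a b, h, hW => by
    have h1 : 1 ≤ B := by omega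
    have h' := h
    simp only [isPlain, Bool.and_eq_true] at h'
    exact ⟨a.fits_of_isPlain hB hs h'.1.2
        ((Nat.pow_le_pow_right h1 (deg_bin_left o a b)).trans hW),
      b.fits_of_isPlain hB hs h'.2 ((Nat.pow_le_pow_right h1 (deg_bin_right o a b)).trans hW),
      (abs_eval_le hB hs (bin o a b) h).trans (by exact_mod_cast hW)⟩

theorem Fits.abs_eval_le {W : ℕ} {s : State} : ∀ {e : Expr}, e.Fits W s → |e.eval s| ≤ W
  | lit _, h => h
  | var _, h => h
  | get _ _, h => h.2
  | bin _ _ _, h => h.2.2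

theorem Fits.mono {W W' : ℕ} (hW : W ≤ W') {s : State} : ∀ {e : Expr}, e.Fits W s → e.Fits W' s
  | lit _, h => le_trans h (by exact_mod_cast hW)
  | var _, h => le_trans h (by exact_mod_cast hW)
  | get _ _, h => ⟨Fits.mono hW h.1, h.2.trans (by exact_mod_cast hW)⟩
  | bin _ _ _, h => ⟨Fits.mono hW h.1, Fits.mono hW h.2.1, h.2.2.trans (by exact_mod_cast hW)⟩

/-- The expression `e ^ k`. -/
def pow (e : Expr) : ℕ → Expr
  | 0 => lit 1
  | k + 1 => bin .mul (pow e k) e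

theorem eval_pow (s : State) (e : Expr) : ∀ k, (e.pow k).eval s = e.eval s ^ k
  | 0 => by simp [pow, eval]
  | k + 1 => by simp [pow, eval, Op.eval, eval_pow s e k, pow_succ]

theorem isPlain_pow {e : Expr} (h : e.isPlain) : ∀ k, (e.pow k).isPlain
  | 0 => rfl
  | k + 1 => by simp [pow, isPlain, Op.isArith, isPlain_pow h k, h]

theorem deg_pow (e : Expr) : ∀ k, (e.pow k).deg = k * e.deg + 1
  | 0 => by simp [pow, deg]
  | k + 1 => by simp only [pow, deg, deg_pow e k]; ring

end Expr

/-- Needed because the aligner comes with its own word size, which is enlarged to the size `W₀` of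
its memory zone. -/
theorem Run.mono {W W' : ℕ} (hW : W ≤ W') {p : Program} {s s' : State} {t : ℕ}
    (h : Run W p s t s') : Run W' p s t s' := by
  induction h with
  | skip s => exact .skip s
  | assign x e s he => exact .assign x e s (he.mono hW)
  | store A i e s hi he => exact .store A i e s (hi.mono hW) (he.mono hW)
  | seq _ _ ih₁ ih₂ => exact .seq ih₁ ih₂
  | cond_true he h0 _ ih => exact .cond_true (he.mono hW) h0 ih
  | cond_false he h0 _ ih => exact .cond_false (he.mono hW) h0 ih
  | loop_true he h0 _ _ ih₁ ih₂ => exact .loop_true (he.mono hW) h0 ih₁ ih₂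
  | loop_false he h0 => exact .loop_false (he.mono hW) h0

/-! ### Which variables and arrays a program can change -/

namespace Program

/-- The program contains an assignment to the variable. -/
def AssignsVar : Program → ℕ → Prop
  | skip, _ => False
  | assign x _, y => y = x
  | store _ _ _, _ => False
  | seq p q, y => p.AssignsVar y ∨ q.AssignsVar y
  | cond _ p q, y => p.AssignsVar y ∨ q.AssignsVar y
  | loop _ p, y => p.AssignsVar y

/-- The program contains an assignment to entries of the array. -/
def WritesArr : Program → ℕ → Prop
  | skip, _ => False
  | assign _ _, _ => False
  | store A _ _, A' => A' = A
  | seq p q, A => p.WritesArr A ∨ q.WritesArr A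
  | cond _ p q, A => p.WritesArr A ∨ q.WritesArr A
  | loop _ p, A => p.WritesArr A

/-- `for i = 0, …, y - 1 do body`, where `y` is a variable. -/
def forLoop (i y : ℕ) (body : Program) : Program :=
  seq (assign i (.lit 0))
    (loop (.bin .lt (.var i) (.var y)) (seq body (assign i (.bin .add (.var i) (.lit 1)))))

end Program

theorem Run.frame {W : ℕ} {p : Program} {s s' : State} {t : ℕ} (h : Run W p s t s') :
    (∀ x, ¬ p.AssignsVar x → s'.var x = s.var x) ∧
      ∀ A, ¬ p.WritesArr A → s'.arr A = s.arr A := by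
  induction h with
  | skip s => exact ⟨fun _ _ => rfl, fun _ _ => rfl⟩
  | assign x e s he =>
    exact ⟨fun y hy => (State.setVar_var ..).trans (if_neg hy), fun _ _ => rfl⟩
  | store A i e s hi he =>
    refine ⟨fun _ _ => rfl, fun A' hA => ?_⟩
    funext j
    rw [State.setArr_arr, if_neg fun h => hA h.1]
  | seq _ _ ih₁ ih₂ =>
    refine ⟨fun x hx => ?_, fun A hA => ?_⟩
    · rw [Program.AssignsVar, not_or] at hx
      rw [ih₂.1 x hx.2, ih₁.1 x hx.1]
    · rw [Program.WritesArr, not_or] at hA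
      rw [ih₂.2 A hA.2, ih₁.2 A hA.1]
  | cond_true _ _ _ ih =>
    refine ⟨fun x hx => ?_, fun A hA => ?_⟩
    · rw [Program.AssignsVar, not_or] at hx
      exact ih.1 x hx.1
    · rw [Program.WritesArr, not_or] at hA
      exact ih.2 A hA.1
  | cond_false _ _ _ ih =>
    refine ⟨fun x hx => ?_, fun A hA => ?_⟩
    · rw [Program.AssignsVar, not_or] at hx
      exact ih.1 x hx.2
    · rw [Program.WritesArr, not_or] at hA
      exact ih.2 A hA.2
  | loop_true _ _ _ _ ih₁ ih₂ =>
    exact ⟨fun x hx => by rw [ih₂.1 x hx, ih₁.1 x hx], fun A hA => by rw [ih₂.2 A hA, ih₁.2 A hA]⟩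
  | loop_false _ _ => exact ⟨fun _ _ => rfl, fun _ _ => rfl⟩

/-- The memory contents are bounded by `B`, and words can hold the values of plain expressions of
degree at most `24`. -/
structure Roomy (W B : ℕ) : Prop where
  two_le : 2 ≤ B
  pow_le : B ^ 24 ≤ W

/-- The hypothesis on `e` is a Boolean computation, so that for every concrete expression below it
is discharged by `rfl`. -/
theorem Roomy.fits {W B : ℕ} (h : Roomy W B) {s : State} (hs : s.BoundedBy B) {e : Expr}
    (he : (e.isPlain && decide (e.deg ≤ 24)) = true) : e.Fits W s := by
  simp only [Bool.and_eq_true, decide_eq_true_eq] at he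
  exact e.fits_of_isPlain h.two_le hs he.1
    ((Nat.pow_le_pow_right (by have := h.two_le; omega) he.2).trans h.pow_le)

/-- Started in `s`, the program halts after at most `T` steps in a state that is bounded by `B` and
satisfies `Q`. -/
def Wp (W B : ℕ) (p : Program) (T : ℕ) (Q : State → Prop) (s : State) : Prop :=
  ∃ t s', Run W p s t s' ∧ t ≤ T ∧ s'.BoundedBy B ∧ Q s'

/-! ### Proof rules for timed total correctness -/

namespace Wp

variable {W B : ℕ}

theorem weaken {p : Program} {T T' : ℕ} {Q Q' : State → Prop} {s : State} (h : Wp W B p T Q s)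
    (hT : T ≤ T') (hQ : ∀ s', s'.BoundedBy B → Q s' → Q' s') : Wp W B p T' Q' s := by
  obtain ⟨t, s', h1, h2, h3, h4⟩ := h
  exact ⟨t, s', h1, h2.trans hT, h3, hQ s' h3 h4⟩

theorem frame {p : Program} {T : ℕ} {Q : State → Prop} {s : State} (h : Wp W B p T Q s) :
    Wp W B p T (fun s' => Q s' ∧ (∀ x, ¬ p.AssignsVar x → s'.var x = s.var x) ∧
      ∀ A, ¬ p.WritesArr A → s'.arr A = s.arr A) s := by
  obtain ⟨t, s', h1, h2, h3, h4⟩ := h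
  exact ⟨t, s', h1, h2, h3, h4, h1.frame⟩

theorem skip {Q : State → Prop} {s : State} {T : ℕ} (hs : s.BoundedBy B) (hT : 1 ≤ T) (hQ : Q s) :
    Wp W B .skip T Q s :=
  ⟨1, s, .skip s, hT, hs, hQ⟩

theorem assign {x : ℕ} {e : Expr} {T : ℕ} {Q : State → Prop} {s : State} (hs : s.BoundedBy B)
    (he : e.Fits W s) (hT : e.cost + 1 ≤ T) (hb : |e.eval s| ≤ B) (hQ : Q (s.setVar x (e.eval s))) :
    Wp W B (.assign x e) T Q s :=
  ⟨_, _, .assign x e s he, hT, hs.setVar hb, hQ⟩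

theorem store {A : ℕ} {i e : Expr} {T : ℕ} {Q : State → Prop} {s : State} (hs : s.BoundedBy B)
    (hi : i.Fits W s) (he : e.Fits W s) (hT : i.cost + e.cost + 1 ≤ T) (hb : |e.eval s| ≤ B)
    (hQ : Q (s.setArr A (i.eval s) (e.eval s))) : Wp W B (.store A i e) T Q s :=
  ⟨_, _, .store A i e s hi he, hT, hs.setArr hb, hQ⟩

theorem seq {p q : Program} {T₁ T₂ T : ℕ} {Q₁ Q : State → Prop} {s : State}
    (hp : Wp W B p T₁ Q₁ s) (hq : ∀ s', s'.BoundedBy B → Q₁ s' → Wp W B q T₂ Q s')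
    (hT : T₁ + T₂ ≤ T) : Wp W B (.seq p q) T Q s := by
  obtain ⟨t, s', h1, h2, h3, h4⟩ := hp
  obtain ⟨t', s'', h1', h2', h3', h4'⟩ := hq s' h3 h4
  exact ⟨_, _, .seq h1 h1', by omega, h3', h4'⟩

theorem assign_seq {x : ℕ} {e : Expr} {q : Program} {T₂ T : ℕ} {Q : State → Prop} {s : State}
    (hs : s.BoundedBy B) (he : e.Fits W s) (v : ℤ) (hv : e.eval s = v) (hb : |v| ≤ B)
    (hq : (s.setVar x v).BoundedBy B → Wp W B q T₂ Q (s.setVar x v))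
    (hT : e.cost + 1 + T₂ ≤ T) : Wp W B (.seq (.assign x e) q) T Q s := by
  subst hv
  refine seq (assign hs he le_rfl hb rfl) ?_ hT
  rintro _ _ rfl
  exact hq (hs.setVar hb)

theorem store_seq {A : ℕ} {i e : Expr} {q : Program} {T₂ T : ℕ} {Q : State → Prop} {s : State}
    (hs : s.BoundedBy B) (hi : i.Fits W s) (he : e.Fits W s) (a v : ℤ) (ha : i.eval s = a)
    (hv : e.eval s = v) (hb : |v| ≤ B)
    (hq : (s.setArr A a v).BoundedBy B → Wp W B q T₂ Q (s.setArr A a v))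
    (hT : i.cost + e.cost + 1 + T₂ ≤ T) : Wp W B (.seq (.store A i e) q) T Q s := by
  subst ha hv
  refine seq (store hs hi he le_rfl hb rfl) ?_ hT
  rintro _ _ rfl
  exact hq (hs.setArr hb)

theorem cond {e : Expr} {p q : Program} {T₁ T : ℕ} {Q : State → Prop} {s : State}
    (he : e.Fits W s) (hp : e.eval s ≠ 0 → Wp W B p T₁ Q s) (hq : e.eval s = 0 → Wp W B q T₁ Q s)
    (hT : e.cost + 1 + T₁ ≤ T) : Wp W B (.cond e p q) T Q s := by
  by_cases h : e.eval s = 0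
  · obtain ⟨t, s', h1, h2, h3, h4⟩ := hq h
    exact ⟨_, _, .cond_false he h h1, by omega, h3, h4⟩
  · obtain ⟨t, s', h1, h2, h3, h4⟩ := hp h
    exact ⟨_, _, .cond_true he h h1, by omega, h3, h4⟩

/-- The frame conditions are carried along with `Inv`, so that invariants only mention what the body
changes. The body has to establish `Inv (k + 1)` for the state after the increment of the counter.
-/
theorem forLoop {i y N T : ℕ} {body : Program} {s : State} (hWB : Roomy W B) (hs : s.BoundedBy B)
    (Inv : ℕ → State → Prop) (hN : s.var y = N) (hiy : y ≠ i) (hi : ¬ body.AssignsVar i)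
    (hy : ¬ body.AssignsVar y) (h0 : Inv 0 (s.setVar i 0))
    (hstep : ∀ k < N, ∀ s', s'.BoundedBy B → s'.var i = (k : ℤ) →
      (∀ x, x ≠ i → ¬ body.AssignsVar x → s'.var x = s.var x) →
      (∀ A, ¬ body.WritesArr A → s'.arr A = s.arr A) → Inv k s' →
      Wp W B body T (fun s'' => Inv (k + 1) (s''.setVar i (k + 1 : ℕ))) s') :
    Wp W B (.forLoop i y body) ((N + 1) * (T + 8)) (fun s' => Inv N s' ∧ s'.var i = (N : ℤ) ∧
      (∀ x, x ≠ i → ¬ body.AssignsVar x → s'.var x = s.var x) ∧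
      ∀ A, ¬ body.WritesArr A → s'.arr A = s.arr A) s := by
  have hNB : (N : ℤ) ≤ B := by
    have := hs.1 y
    rwa [hN, Nat.abs_cast] at this
  -- Induction on the number `r` of remaining iterations, since a run of the loop unfolds from the
  -- front.
  have key : ∀ r k, k + r = N → ∀ s', s'.BoundedBy B → s'.var i = (k : ℤ) →
      (∀ x, x ≠ i → ¬ body.AssignsVar x → s'.var x = s.var x) →
      (∀ A, ¬ body.WritesArr A → s'.arr A = s.arr A) → Inv k s' →
      Wp W B (.loop (.bin .lt (.var i) (.var y))
        (.seq body (.assign i (.bin .add (.var i) (.lit 1))))) (r * (T + 8) + 4)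
        (fun s' => Inv N s' ∧ s'.var i = (N : ℤ) ∧
          (∀ x, x ≠ i → ¬ body.AssignsVar x → s'.var x = s.var x) ∧
          ∀ A, ¬ body.WritesArr A → s'.arr A = s.arr A) s' := by
    intro r
    induction r with
    | zero =>
      intro k hk s' hs' hi' hv ha hInv
      obtain rfl : k = N := by omega
      refine ⟨_, _, .loop_false (hWB.fits hs' rfl) ?_, ?_, hs', hInv, hi', hv, ha⟩
      · simp [Expr.eval, Op.eval, hi', hv y hiy hy, hN]
      · simp [Expr.cost]
    | succ r ih =>
      intro k hk s' hs' hi' hv ha hInv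
      obtain ⟨t, s₁, h1, h2, h3, h4⟩ := hstep k (by omega) s' hs' hi' hv ha hInv
      have hi₁ : s₁.var i = k := by rw [h1.frame.1 i hi, hi']
      have hval : (Expr.bin .add (.var i) (.lit 1)).eval s₁ = (k + 1 : ℕ) := by
        simp [Expr.eval, Op.eval, hi₁]
      have hb : |((k + 1 : ℕ) : ℤ)| ≤ B := by rw [Nat.abs_cast]; omega
      obtain ⟨t', s₂, h1', h2', h3', h4'⟩ := ih (k + 1) (by omega) (s₁.setVar i (k + 1 : ℕ))
        (h3.setVar hb) (by simp [State.setVar_var])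
        (fun x hx hx' => by rw [State.setVar_var, if_neg hx, h1.frame.1 x hx', hv x hx hx'])
        (fun A hA => by rw [State.setVar_arr, h1.frame.2 A hA, ha A hA]) h4
      refine ⟨_, s₂, .loop_true (hWB.fits hs' rfl) ?_ (.seq h1 (.assign _ _ _ (hWB.fits h3 rfl)))
        (by rw [hval]; exact h1'), ?_, h3', h4'⟩
      · have : (k : ℤ) < N := by omega
        simp [Expr.eval, Op.eval, hi', hv y hiy hy, hN, this]
      · simp only [Expr.cost]
        rw [Nat.succ_mul]
        omega
  refine seq (T₁ := 2) (assign hs (hWB.fits hs rfl) le_rfl (by simp [Expr.eval]) rfl) ?_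
    (T₂ := N * (T + 8) + 4) (by rw [Nat.succ_mul]; omega)
  rintro s' hs' rfl
  refine key N 0 (by omega) _ hs' ?_ ?_ ?_ ?_
  · simp [State.setVar_var, Expr.eval]
  · intro x hx _; simp [State.setVar_var, hx]
  · intro A _; rfl
  · exact h0

/-- Filling a segment of an array. -/
theorem fill {i y A N : ℕ} {addr e : Expr} {s : State} (hWB : Roomy W B) (hs : s.BoundedBy B)
    (off : ℤ) (f : ℤ → ℤ) (hN : s.var y = N) (hiy : y ≠ i)
    (hf : ∀ k : ℕ, k < N → |f k| ≤ B)
    (haddr : (addr.isPlain && decide (addr.deg ≤ 24)) = true)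
    (he : (e.isPlain && decide (e.deg ≤ 24)) = true)
    (heval : ∀ k < N, ∀ s' : State, s'.var i = (k : ℤ) → (∀ x, x ≠ i → s'.var x = s.var x) →
      (∀ A', A' ≠ A → s'.arr A' = s.arr A') → addr.eval s' = off + k ∧ e.eval s' = f k) :
    Wp W B (.forLoop i y (.store A addr e)) ((N + 1) * (addr.cost + e.cost + 9))
      (fun s' => (∀ z, s'.arr A z = if off ≤ z ∧ z < off + N then f (z - off) else s.arr A z) ∧
        (∀ x, x ≠ i → s'.var x = s.var x) ∧ ∀ A', A' ≠ A → s'.arr A' = s.arr A') s := by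
  have := forLoop (i := i) (y := y) (N := N) (T := addr.cost + e.cost + 1)
    (body := .store A addr e) hWB hs
    (fun k s' => ∀ z, s'.arr A z = if off ≤ z ∧ z < off + k then f (z - off) else s.arr A z)
    hN hiy (by simp [Program.AssignsVar]) (by simp [Program.AssignsVar]) ?_ ?_
  · refine this.weaken le_rfl ?_
    rintro s' _ ⟨h1, h2, h3, h4⟩
    exact ⟨h1, fun x hx => h3 x hx (by simp [Program.AssignsVar]),
      fun A' hA => h4 A' (by simpa [Program.WritesArr] using hA)⟩
  · intro z
    rw [if_neg (by push_cast; omega)]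
    rfl
  · intro k hk s' hs' hi hv ha hInv
    obtain ⟨h1, h2⟩ := heval k hk s' hi (fun x hx => hv x hx (by simp [Program.AssignsVar]))
      (fun A' hA => ha A' (by simpa [Program.WritesArr] using hA))
    refine store hs' (hWB.fits hs' haddr) (hWB.fits hs' he) le_rfl (h2 ▸ hf k hk) ?_
    intro z
    rw [State.setVar_arr, State.setArr_arr, h1, h2]
    by_cases hz : z = off + k
    · subst hz
      rw [if_pos ⟨rfl, rfl⟩, if_pos (by push_cast; omega)]
      congr 1; ring
    · rw [if_neg (fun h => hz h.2), hInv z]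
      congr 1
      push_cast
      simp only [eq_iff_iff]
      omega

end Wp

end WordRAM

/-! ## Running a program as a subroutine

The variables of the subroutine are kept in array `7`, and its array number `A` in the array number
`A + 8`; all addresses are shifted by the content of the variable `7`. -/

namespace WordRAM

namespace Expr

def maxVar : Expr → ℕ
  | lit _ => 0
  | var x => x
  | get _ i => i.maxVar
  | bin _ a b => max a.maxVar b.maxVar

def shift : Expr → Expr
  | lit z => lit z
  | var x => get 7 (bin .add (var 7) (lit x))
  | get A i => get (A + 8) (bin .add (var 7) i.shift)
  | bin o a b => bin o a.shift b.shift

/-- The worst case is a variable: one step becomes an array access at a computed address, which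
takes four. -/
theorem cost_shift_le : ∀ e : Expr, e.shift.cost ≤ 4 * e.cost
  | lit z => by simp [shift, cost]
  | var x => by simp [shift, cost]
  | get A i => by
    have := i.cost_shift_le
    simp only [shift, cost]; omega
  | bin o a b => by
    have := a.cost_shift_le
    have := b.cost_shift_le
    simp only [shift, cost]; omega

end Expr

namespace Program

def maxVar : Program → ℕ
  | skip => 0
  | assign x e => max x e.maxVar
  | store _ i e => max i.maxVar e.maxVar
  | seq p q => max p.maxVar q.maxVar
  | cond e p q => max e.maxVar (max p.maxVar q.maxVar)
  | loop e p => max e.maxVar p.maxVar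

def shift : Program → Program
  | skip => skip
  | assign x e => store 7 (.bin .add (.var 7) (.lit x)) e.shift
  | store A i e => store (A + 8) (.bin .add (.var 7) i.shift) e.shift
  | seq p q => seq p.shift q.shift
  | cond e p q => cond e.shift p.shift q.shift
  | loop e p => loop e.shift p.shift

theorem not_assignsVar_shift (p : Program) (x : ℕ) : ¬ p.shift.AssignsVar x := by
  induction p with
  | skip | assign | store => simp [shift, AssignsVar]
  | seq _ _ ih₁ ih₂ | cond _ _ _ ih₁ ih₂ => simp [shift, AssignsVar, ih₁, ih₂]
  | loop _ _ ih => simp [shift, AssignsVar, ih]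

/-- Together with `not_assignsVar_shift` this protects the data of the caller, all of which lives in
variables and in arrays below 7. -/
theorem WritesArr.seven_le_of_shift {p : Program} {A : ℕ} (h : p.shift.WritesArr A) : 7 ≤ A := by
  induction p with
  | skip => exact h.elim
  | assign x e => exact (show A = 7 from h).ge
  | store A' i e => exact (show A = A' + 8 from h) ▸ by omega
  | seq _ _ ih₁ ih₂ | cond _ _ _ ih₁ ih₂ => exact h.elim ih₁ ih₂
  | loop _ _ ih => exact ih h

end Program

/-- The state `s` represents the state `σ` of a subroutine with words of absolute value at most `W`
and variables with numbers at most `v`. -/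
structure Represents (W v : ℕ) (σ s : State) : Prop where
  var : ∀ x : ℕ, x ≤ v → s.arr 7 (s.var 7 + x) = σ.var x
  arr : ∀ (A : ℕ) (i : ℤ), |i| ≤ W → s.arr (A + 8) (s.var 7 + i) = σ.arr A i

namespace Expr

variable {W₀ W B v : ℕ} {σ s : State}

theorem eval_shift (h : Represents W₀ v σ s) :
    ∀ e : Expr, e.Fits W₀ σ → e.maxVar ≤ v → e.shift.eval s = e.eval σ
  | lit z, _, _ => rfl
  | var x, _, hv => h.var x hv
  | get A i, hf, hv => by
    have := i.eval_shift h hf.1 hv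
    simp only [shift, eval, Op.eval, this]
    exact h.arr A _ hf.1.abs_eval_le
  | bin o a b, hf, hv => by
    simp only [shift, eval, a.eval_shift h hf.1 ((le_max_left _ _).trans hv),
      b.eval_shift h hf.2.1 ((le_max_right _ _).trans hv)]

theorem fits_address (hs : s.BoundedBy B) (hB : 2 * B ≤ W) {e : Expr} (he : e.Fits W s)
    (hb : |e.eval s| ≤ B) : (bin .add (var 7) e).Fits W s := by
  have h7 := hs.1 7
  refine ⟨?_, he, ?_⟩
  · exact h7.trans (by omega)
  · refine (abs_add_le _ _).trans ?_
    simp only [eval]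
    omega

theorem fits_shift (h : Represents W₀ v σ s) (hs : s.BoundedBy B) (hW₀ : W₀ ≤ B) (hvW : v ≤ W₀)
    (hB : 2 * B ≤ W) : ∀ e : Expr, e.Fits W₀ σ → e.maxVar ≤ v → e.shift.Fits W s
  | lit z, hf, _ => le_trans hf (by omega)
  | var x, _, hv => by
    have hx : |(x : ℤ)| ≤ B := by rw [Nat.abs_cast]; simp only [maxVar] at hv; omega
    exact ⟨fits_address hs hB (e := lit x) (hx.trans (by omega)) hx, (hs.2 _ _).trans (by omega)⟩
  | get A i, hf, hv => by
    have hi := i.eval_shift h hf.1 hv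
    have hi' := hf.1.abs_eval_le
    exact ⟨fits_address hs hB (i.fits_shift h hs hW₀ hvW hB hf.1 hv) (by rw [hi]; omega),
      (hs.2 _ _).trans (by omega)⟩
  | bin o a b, hf, hv => by
    have ha := (le_max_left _ _).trans hv
    have hb := (le_max_right _ _).trans hv
    refine ⟨a.fits_shift h hs hW₀ hvW hB hf.1 ha, b.fits_shift h hs hW₀ hvW hB hf.2.1 hb, ?_⟩
    rw [a.eval_shift h hf.1 ha, b.eval_shift h hf.2.1 hb]
    exact hf.2.2.trans (by omega)

end Expr

/-- Step-by-step simulation. The addresses of the subroutine are themselves words, hence within `W₀`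
of the base, and `v ≤ W₀` puts the slots of the variables there too. So nothing above the zone
changes, which keeps the later zones empty. The condition `2 * B ≤ W` leaves room for base plus
address. -/
theorem Run.shift {W₀ W B v : ℕ} (hW₀ : W₀ ≤ B) (hvW : v ≤ W₀) (hB : 2 * B ≤ W) {p : Program}
    {σ σ' : State} {t : ℕ} (h : Run W₀ p σ t σ') :
    p.maxVar ≤ v → ∀ s : State, Represents W₀ v σ s → s.BoundedBy B →
      ∃ t' s', Run W p.shift s t' s' ∧ t' ≤ 4 * t ∧ s'.BoundedBy B ∧ s'.var = s.var ∧
        Represents W₀ v σ' s' ∧ ∀ A z, s.var 7 + W₀ < z → s'.arr A z = s.arr A z := by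
  have hW : (W₀ : ℤ) ≤ B := by exact_mod_cast hW₀
  induction h with
  | skip σ =>
    intro _ s hr hs
    exact ⟨1, s, .skip s, by omega, hs, rfl, hr, fun _ _ _ => rfl⟩
  | assign x e σ he =>
    intro hv s hr hs
    have hx : x ≤ v := (le_max_left _ _).trans hv
    have hev : e.maxVar ≤ v := (le_max_right _ _).trans hv
    have hxB : |(x : ℤ)| ≤ B := by rw [Nat.abs_cast]; omega
    have hval := e.eval_shift hr he hev
    have haddr : (Expr.bin .add (.var 7) (.lit x)).eval s = s.var 7 + x := rfl
    refine ⟨_, _, .store _ _ _ _ (Expr.fits_address hs hB (e := .lit x) (hxB.trans (by omega)) hxB)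
      (e.fits_shift hr hs hW₀ hvW hB he hev), ?_, hs.setArr ?_, rfl, ⟨?_, ?_⟩, ?_⟩
    · have := e.cost_shift_le
      simp only [Expr.cost]; omega
    · rw [hval]; exact he.abs_eval_le.trans hW
    · intro y hy
      rw [State.setArr_arr, haddr, hval, State.setVar_var, State.setArr_var, hr.var y hy]
      simp
    · intro A i hi
      rw [State.setArr_arr, if_neg (by omega)]
      exact hr.arr A i hi
    · intro A z hz
      rw [State.setArr_arr, if_neg (by rw [haddr]; omega)]
  | store A i e σ hi he =>
    intro hv s hr hs
    have hiv : i.maxVar ≤ v := (le_max_left _ _).trans hv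
    have hev : e.maxVar ≤ v := (le_max_right _ _).trans hv
    have hval := e.eval_shift hr he hev
    have hival := i.eval_shift hr hi hiv
    have hib := hi.abs_eval_le
    have haddr : (Expr.bin .add (.var 7) i.shift).eval s = s.var 7 + i.eval σ := by
      simp only [Expr.eval, Op.eval, hival]
    refine ⟨_, _, .store _ _ _ _ (Expr.fits_address hs hB
      (i.fits_shift hr hs hW₀ hvW hB hi hiv) (by rw [hival]; omega))
      (e.fits_shift hr hs hW₀ hvW hB he hev), ?_, hs.setArr ?_, rfl, ⟨?_, ?_⟩, ?_⟩
    · have := e.cost_shift_le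
      have := i.cost_shift_le
      simp only [Expr.cost]; omega
    · rw [hval]; exact he.abs_eval_le.trans hW
    · intro y hy
      rw [State.setArr_arr, if_neg (by omega)]
      exact hr.var y hy
    · intro A' j hj
      rw [State.setArr_arr, haddr, hval, State.setArr_arr, State.setArr_var, hr.arr A' j hj]
      simp
    · intro A' z hz
      rw [State.setArr_arr, if_neg]
      rw [haddr]
      have := le_abs_self (i.eval σ)
      omega
  | seq _ _ ih₁ ih₂ =>
    intro hv s hr hs
    obtain ⟨t₁, s₁, h1, h2, h3, h4, h5, h6⟩ := ih₁ ((le_max_left _ _).trans hv) s hr hs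
    obtain ⟨t₂, s₂, k1, k2, k3, k4, k5, k6⟩ := ih₂ ((le_max_right _ _).trans hv) s₁ h5 h3
    exact ⟨_, s₂, .seq h1 k1, by omega, k3, k4.trans h4, k5,
      fun A z hz => by rw [k6 A z (by rwa [h4]), h6 A z hz]⟩
  | @cond_true e p q _ _ _ he h0 _ ih =>
    intro hv s hr hs
    have hev : e.maxVar ≤ v := (le_max_left _ _).trans hv
    obtain ⟨t₁, s₁, h1, h2, h3, h4, h5, h6⟩ :=
      ih ((le_max_left _ _).trans ((le_max_right _ _).trans hv)) s hr hs
    refine ⟨_, s₁, .cond_true (e.fits_shift hr hs hW₀ hvW hB he hev)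
      (by rwa [e.eval_shift hr he hev]) h1, ?_, h3, h4, h5, h6⟩
    have := e.cost_shift_le
    omega
  | @cond_false e p q _ _ _ he h0 _ ih =>
    intro hv s hr hs
    have hev : e.maxVar ≤ v := (le_max_left _ _).trans hv
    obtain ⟨t₁, s₁, h1, h2, h3, h4, h5, h6⟩ :=
      ih ((le_max_right _ _).trans ((le_max_right _ _).trans hv)) s hr hs
    refine ⟨_, s₁, .cond_false (e.fits_shift hr hs hW₀ hvW hB he hev)
      (by rwa [e.eval_shift hr he hev]) h1, ?_, h3, h4, h5, h6⟩
    have := e.cost_shift_le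
    omega
  | @loop_true e p _ _ _ _ _ he h0 _ _ ih₁ ih₂ =>
    intro hv s hr hs
    have hev : e.maxVar ≤ v := (le_max_left _ _).trans hv
    obtain ⟨t₁, s₁, h1, h2, h3, h4, h5, h6⟩ := ih₁ ((le_max_right _ _).trans hv) s hr hs
    obtain ⟨t₂, s₂, k1, k2, k3, k4, k5, k6⟩ := ih₂ hv s₁ h5 h3
    refine ⟨_, s₂, .loop_true (e.fits_shift hr hs hW₀ hvW hB he hev)
      (by rwa [e.eval_shift hr he hev]) h1 k1, ?_, k3, k4.trans h4, k5,
      fun A z hz => by rw [k6 A z (by rwa [h4]), h6 A z hz]⟩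
    have := e.cost_shift_le
    omega
  | @loop_false e p _ he h0 =>
    intro hv s hr hs
    have hev : e.maxVar ≤ v := (le_max_left _ _).trans hv
    refine ⟨_, s, .loop_false (e.fits_shift hr hs hW₀ hvW hB he hev)
      (by rwa [e.eval_shift hr he hev]), ?_, hs, rfl, hr, fun _ _ _ => rfl⟩
    have := e.cost_shift_le
    omega

end WordRAM

/-! ## Distributing numbers into residue classes -/

/-- The number of members of the list in a residue class. -/
def load (q : ℕ) (l : List ℕ) (r : ℕ) : ℕ :=
  l.countP fun x => x % q = r

/-- The number of members of the list that remain if `K` members are removed from each residue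
class modulo `q`. -/
def overflow (K q : ℕ) (l : List ℕ) : ℕ :=
  ∑ r ∈ Finset.range q, (load q l r - K)

theorem load_append_singleton (q : ℕ) (l : List ℕ) (x r : ℕ) :
    load q (l ++ [x]) r = load q l r + if x % q = r then 1 else 0 := by
  simp [load, List.countP_append, List.countP_singleton]

/-- A new member overflows exactly when its class is already full; `countLoads` computes the
overflow by this recursion. -/
theorem overflow_append_singleton (K : ℕ) {q : ℕ} (hq : 0 < q) (l : List ℕ) (x : ℕ) :
    overflow K q (l ++ [x]) = overflow K q l + if K ≤ load q l (x % q) then 1 else 0 := by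
  have hx : x % q ∈ Finset.range q := Finset.mem_range.2 (Nat.mod_lt _ hq)
  unfold overflow
  rw [← Finset.add_sum_erase _ _ hx, ← Finset.add_sum_erase _ _ hx]
  have : ∀ r ∈ (Finset.range q).erase (x % q), load q (l ++ [x]) r - K = load q l r - K := by
    intro r hr
    rw [load_append_singleton, if_neg (Finset.ne_of_mem_erase hr).symm, add_zero]
  rw [Finset.sum_congr rfl this, load_append_singleton, if_pos rfl]
  split_ifs <;> omega

@[simp] theorem overflow_nil (K q : ℕ) : overflow K q [] = 0 := by
  simp [overflow, load]

theorem overflow_zero {q : ℕ} (hq : 0 < q) (l : List ℕ) : overflow 0 q l = l.length := by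
  induction l using List.reverseRecOn with
  | nil => simp
  | append_singleton l x ih => rw [overflow_append_singleton 0 hq, ih]; simp

theorem overflow_le_length (K : ℕ) {q : ℕ} (hq : 0 < q) (l : List ℕ) :
    overflow K q l ≤ l.length := by
  rw [← overflow_zero hq]
  exact Finset.sum_le_sum fun r _ => by omega

/-- `F` picks a member of the list in each residue class modulo `q` that has one (and is `0` in the
other classes), and `rest` is the list of the other members. -/
structure IsPass (q : ℕ) (l rest : List ℕ) (F : ℕ → ℕ) : Prop where
  eq_zero_or_mem : ∀ r, F r = 0 ∨ F r ∈ l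
  sublist : rest.Sublist l
  cover : ∀ x ∈ l, x ∈ rest ∨ F (x % q) = x
  load_eq : ∀ r, load q rest r = load q l r - 1
  eq_zero_iff : ∀ r, F r = 0 ↔ load q l r = 0

namespace IsPass

variable {q : ℕ} {l rest : List ℕ} {F : ℕ → ℕ}

theorem nil (q : ℕ) : IsPass q [] [] fun _ => 0 :=
  ⟨by simp, by simp, by simp, by simp [load], by simp [load]⟩

/-- The value 0 of `F` marks a class without a pick, which is unambiguous only for positive members;
hence `hx`. -/
theorem pick (h : IsPass q l rest F) {x : ℕ} (hx : 0 < x) (h0 : F (x % q) = 0) :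
    IsPass q (l ++ [x]) rest (Function.update F (x % q) x) := by
  have hl := (h.eq_zero_iff _).1 h0
  refine ⟨fun r => ?_, h.sublist.trans (List.sublist_append_left _ _), fun y hy => ?_,
    fun r => ?_, fun r => ?_⟩
  · by_cases hr : r = x % q
    · subst hr; simp
    · rw [Function.update_of_ne hr]
      exact (h.eq_zero_or_mem r).imp_right fun h => by simp [h]
  · rcases List.mem_append.1 hy with hy | hy
    · rcases h.cover y hy with h' | h'
      · exact .inl h'
      · by_cases hr : y % q = x % q
        · rw [hr, h0] at h'
          subst h'
          exfalso
          have : load q l (x % q) ≠ 0 := by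
            rw [load, Ne, List.countP_eq_zero, ← hr]
            exact fun h => h 0 hy (by simp)
          exact this hl
        · right; rwa [Function.update_of_ne hr]
    · obtain rfl := List.mem_singleton.1 hy
      right; simp
  · rw [load_append_singleton, h.load_eq]
    split_ifs with hr
    · subst hr; omega
    · rfl
  · rw [load_append_singleton]
    by_cases hr : r = x % q
    · subst hr; simp; omega
    · rw [Function.update_of_ne hr, if_neg (Ne.symm hr), h.eq_zero_iff, add_zero]

theorem leave (h : IsPass q l rest F) {x : ℕ} (h0 : F (x % q) ≠ 0) :
    IsPass q (l ++ [x]) (rest ++ [x]) F := by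
  have hl : load q l (x % q) ≠ 0 := fun h' => h0 ((h.eq_zero_iff _).2 h')
  refine ⟨fun r => (h.eq_zero_or_mem r).imp_right fun h => by simp [h],
    h.sublist.append (List.Sublist.refl _), fun y hy => ?_, fun r => ?_, fun r => ?_⟩
  · rcases List.mem_append.1 hy with hy | hy
    · exact (h.cover y hy).imp_left fun h => by simp [h]
    · left; simp [hy]
  · rw [load_append_singleton, load_append_singleton, h.load_eq]
    split_ifs with hr
    · subst hr; omega
    · rfl
  · rw [load_append_singleton, h.eq_zero_iff]
    split_ifs with hr
    · subst hr; simpa using hl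
    · rfl

/-- Each pass uses up one unit of capacity, so after `K` passes the whole remaining list is the
original overflow for capacity `K`. -/
theorem overflow_eq (h : IsPass q l rest F) (K : ℕ) :
    overflow K q rest = overflow (K + 1) q l :=
  Finset.sum_congr rfl fun r _ => by rw [h.load_eq]; omega

end IsPass

/-! ## A modulus with few collisions -/

/-- The product of the distinct prime divisors divides `d`, and each factor is at least 2. -/
theorem card_prime_dvd_le_log {s : Finset ℕ} (hs : ∀ p ∈ s, p.Prime) {d : ℕ} (hd : d ≠ 0) :
    (s.filter (· ∣ d)).card ≤ Nat.log 2 d := by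
  refine Nat.le_log_of_pow_le one_lt_two ?_
  have h1 : ∏ p ∈ s.filter (· ∣ d), p ∣ d :=
    Finset.prod_primes_dvd d (fun p hp => (hs p (Finset.mem_filter.1 hp).1).prime)
      fun p hp => (Finset.mem_filter.1 hp).2
  calc 2 ^ (s.filter (· ∣ d)).card = ∏ p ∈ s.filter (· ∣ d), 2 := by simp
    _ ≤ ∏ p ∈ s.filter (· ∣ d), p :=
      Finset.prod_le_prod' fun p hp => (hs p (Finset.mem_filter.1 hp).1).two_le
    _ ≤ d := Nat.le_of_dvd (Nat.pos_of_ne_zero hd) h1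

theorem load_eq_card (q : ℕ) {l : List ℕ} (hl : l.Nodup) (r : ℕ) :
    load q l r = (l.toFinset.filter fun x => x % q = r).card := by
  rw [load, List.countP_eq_length_filter, ← List.toFinset_card_of_nodup (hl.filter _),
    List.toFinset_filter]
  simp

/-- Class by class: `c` members form `c (c - 1)` ordered colliding pairs, and for `c > K` this is at
least `K (c - K)`. -/
theorem mul_overflow_le_collisions (K : ℕ) {q : ℕ} (hq : 0 < q) {l : List ℕ} (hl : l.Nodup) :
    K * overflow K q l ≤ (l.toFinset.offDiag.filter fun p => p.1 % q = p.2 % q).card := by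
  rw [Finset.card_eq_sum_card_fiberwise (f := fun p => p.1 % q) (t := Finset.range q)
    (fun p _ => by simpa using Nat.mod_lt _ hq), overflow, Finset.mul_sum]
  refine Finset.sum_le_sum fun r _ => ?_
  have : (l.toFinset.offDiag.filter fun p => p.1 % q = p.2 % q).filter (fun p => p.1 % q = r) =
      (l.toFinset.filter fun x => x % q = r).offDiag := by
    ext ⟨x, y⟩
    simp only [Finset.mem_filter, Finset.mem_offDiag]
    constructor
    · rintro ⟨⟨⟨hx, hy, hxy⟩, h1⟩, h2⟩
      exact ⟨⟨hx, h2⟩, ⟨hy, h1 ▸ h2⟩, hxy⟩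
    · rintro ⟨⟨hx, h1⟩, ⟨hy, h2⟩, hxy⟩
      exact ⟨⟨⟨hx, hy, hxy⟩, h1.trans h2.symm⟩, h1⟩
  rw [this, Finset.offDiag_card, ← load_eq_card q hl]
  rcases Nat.lt_or_ge K (load q l r) with h | h
  · obtain ⟨d, hd⟩ := Nat.exists_eq_add_of_lt h
    rw [hd]
    have e1 : K + d + 1 - K = d + 1 := by omega
    rw [e1, ← Nat.mul_sub_one, Nat.add_sub_cancel, mul_comm]
    gcongr <;> omega
  · rw [Nat.sub_eq_zero_of_le h]; simp

/-- Some modulus halves the list. -/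
theorem exists_overflow_le {K Q U : ℕ} {l : List ℕ} (hl : l.Nodup) (hU : ∀ x ∈ l, x ≤ U)
    (hK : 2 * l.length * Nat.log 2 U ≤ K * Nat.primeCounting Q) (hK0 : 0 < K)
    (hQ2 : 2 ≤ Q) :
    ∃ q, 0 < q ∧ q ≤ Q ∧ 2 * overflow K q l ≤ l.length := by
  -- Average over the primes up to `Q`. If all of them failed, each would produce more than `K |l| /
  -- 2` collisions. But each of the fewer than `|l| ^ 2` ordered pairs (for nonempty `l`) collides
  -- only modulo prime divisors of its difference, at most log `U` many. By `hK` the two counts are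
  -- incompatible.
  by_contra! hcon
  set P := Nat.primesLE Q with hP
  have hPp : ∀ p ∈ P, p.Prime := fun p hp => (Nat.mem_primesLE.1 hp).2
  have hPne : P.Nonempty := ⟨2, Nat.mem_primesLE.2 ⟨hQ2, Nat.prime_two⟩⟩
  have hlen : l.toFinset.card = l.length := List.toFinset_card_of_nodup hl
  have h1 : ∑ q ∈ P, K * l.length < ∑ q ∈ P, 2 * (K * overflow K q l) := by
    refine Finset.sum_lt_sum_of_nonempty hPne fun q hq => ?_
    have := hcon q (hPp q hq).pos (Nat.mem_primesLE.1 hq).1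
    calc K * l.length < K * (2 * overflow K q l) := by gcongr
      _ = 2 * (K * overflow K q l) := by ring
  have h2 : ∑ q ∈ P, K * overflow K q l ≤ l.length * l.length * Nat.log 2 U := by
    calc ∑ q ∈ P, K * overflow K q l
        ≤ ∑ q ∈ P, (l.toFinset.offDiag.filter fun p => p.1 % q = p.2 % q).card :=
          Finset.sum_le_sum fun q hq => mul_overflow_le_collisions K (hPp q hq).pos hl
      _ = ∑ p ∈ l.toFinset.offDiag, (P.filter fun q => p.1 % q = p.2 % q).card := by
          simp only [Finset.card_filter]
          exact Finset.sum_comm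
      _ ≤ ∑ p ∈ l.toFinset.offDiag, Nat.log 2 U := by
          refine Finset.sum_le_sum fun p hp => ?_
          obtain ⟨hx, hy, hxy⟩ := Finset.mem_offDiag.1 hp
          rw [List.mem_toFinset] at hx hy
          have hd : Nat.dist p.1 p.2 ≠ 0 := fun h => hxy (Nat.eq_of_dist_eq_zero h)
          have hdU : Nat.dist p.1 p.2 ≤ U := by
            have := hU _ hx
            have := hU _ hy
            unfold Nat.dist; omega
          refine (Finset.card_le_card ?_).trans
            ((card_prime_dvd_le_log hPp hd).trans (Nat.log_mono_right hdU))
          intro q hq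
          rw [Finset.mem_filter] at hq ⊢
          refine ⟨hq.1, ?_⟩
          have hm : p.1 ≡ p.2 [MOD q] := hq.2
          rcases le_total p.1 p.2 with h | h
          · rw [Nat.dist_eq_sub_of_le h]; exact (Nat.modEq_iff_dvd' h).1 hm
          · rw [Nat.dist_eq_sub_of_le_right h]; exact (Nat.modEq_iff_dvd' h).1 hm.symm
      _ ≤ l.length * l.length * Nat.log 2 U := by
          rw [Finset.sum_const, smul_eq_mul, Finset.offDiag_card, hlen]
          gcongr
          omega
  rw [← Finset.mul_sum, Finset.sum_const, smul_eq_mul, Nat.primesLE_card_eq_primeCounting] at h1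
  have h3 := Nat.mul_le_mul_left l.length hK
  rw [← Finset.mul_sum] at h1
  nlinarith

/-- A nonzero integer that is divisible by all of `1, …, L` is large. -/
theorem eq_zero_of_forall_dvd {L U : ℕ} (hU : (L + 1) * U < 2 ^ L) {x : ℤ} (hx : |x| ≤ U)
    (h : ∀ d : ℕ, 0 < d → d ≤ L → (d : ℤ) ∣ x) : x = 0 := by
  by_contra h0
  have h1 : Nat.lcmUpto L ∣ x.natAbs :=
    Finset.lcm_dvd fun d hd => Int.natCast_dvd.1 (h d (by simp at hd; omega) (by simp at hd; omega))
  have h2 := Nat.le_of_dvd (by omega) h1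
  -- The lower bound `2 ^ L ≤ (L + 1) * lcm(1, …, L)` is what makes blocks of length `L` certify an
  -- exact equality.
  have h3 := Chebyshev.two_pow_le_mul_lcmUpto L
  have h4 : x.natAbs ≤ U := by have := Int.natCast_natAbs x; omega
  have := Nat.mul_le_mul_left (L + 1) (h2.trans h4)
  exact absurd (h3.trans this) (not_le.2 hU)

/-- A weak lower bound for the number of primes. -/
theorem le_primeCounting_mul_log {Q : ℕ} (hQ : 4 ≤ Q) :
    (Q : ℝ) ≤ 8 * Nat.primeCounting Q * Real.log Q := by
  have h1 := (Chebyshev.psi_ge Q).trans (Chebyshev.psi_le_primeCounting_mul_log Q)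
  have hl2 := Real.log_two_gt_d9
  -- The tangent of the logarithm at 8: its slope 1/8 is small enough for the linear term to
  -- dominate from `Q = 4` on.
  have hl : Real.log (Q + 1) ≤ (Q + 1) / 8 - 1 + Real.log 8 := by
    have h8 : (0 : ℝ) < (Q + 1) / 8 := by positivity
    have := Real.log_le_sub_one_of_pos h8
    rw [Real.log_div (by positivity) (by norm_num)] at this
    linarith
  have hl8 : Real.log 8 = 3 * Real.log 2 := by
    rw [show (8 : ℝ) = 2 ^ 3 by norm_num, Real.log_pow]; norm_num
  have hl2' := Real.log_two_lt_d9
  have hQ' : (4 : ℝ) ≤ Q := by exact_mod_cast hQ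
  rw [hl8] at hl
  nlinarith

/-! ## The Local Alignment instance -/

namespace ThreeSumAlignment

/-- The letter at position `i` of the block of the number `x`. -/
def letter (q L x i : ℕ) : ℕ :=
  ((x % q) * L + i) * L + x % (i + 1)

/-- The score of two letters. The letters of `x` and `y` at the same position `i ≠ 0` match if
`x + y` is congruent to `F ((x + y) % q)` modulo `i + 1`. -/
def score (q L N : ℕ) (F : ℕ → ℕ) (a b : ℕ) : ℤ :=
  if a / L % L = b / L % L ∧ 0 < a / L % L ∧
      ((a % L + b % L : ℕ) - F ((a / (L * L) + b / (L * L)) % q) : ℤ) % (a / L % L + 1 : ℕ) = 0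
  then 1 else -N

section letter

variable {q L x i : ℕ}

theorem letter_lt (hq : 0 < q) (hi : i < L) : letter q L x i < q * (L * L) := by
  have h1 : x % q + 1 ≤ q := Nat.mod_lt x hq
  have h2 : x % (i + 1) < L := (Nat.mod_lt x (Nat.succ_pos i)).trans_le hi
  have h3 : letter q L x i < (x % q * L + i + 1) * L := by
    unfold letter; rw [Nat.succ_mul]; omega
  refine h3.trans_le ?_
  calc (x % q * L + i + 1) * L ≤ ((x % q + 1) * L) * L := by
        gcongr; rw [Nat.succ_mul]; omega
    _ ≤ q * (L * L) := by rw [mul_assoc]; gcongr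

theorem letter_mod (hi : i < L) : letter q L x i % L = x % (i + 1) := by
  have h2 : x % (i + 1) < L := (Nat.mod_lt x (Nat.succ_pos i)).trans_le hi
  rw [letter, Nat.mul_add_mod', Nat.mod_eq_of_lt h2]

theorem letter_div (hi : i < L) : letter q L x i / L = x % q * L + i := by
  have h2 : x % (i + 1) < L := (Nat.mod_lt x (Nat.succ_pos i)).trans_le hi
  rw [letter, add_comm, Nat.add_mul_div_right _ _ (by omega), Nat.div_eq_of_lt h2, zero_add]

theorem letter_div_mod (hi : i < L) : letter q L x i / L % L = i := by
  rw [letter_div hi, Nat.mul_add_mod', Nat.mod_eq_of_lt hi]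

theorem letter_div_div (hi : i < L) : letter q L x i / (L * L) = x % q := by
  rw [← Nat.div_div_eq_div_mul, letter_div hi, add_comm, Nat.add_mul_div_right _ _ (by omega),
    Nat.div_eq_of_lt hi, zero_add]

end letter

variable {q L N : ℕ} {F : ℕ → ℕ}

/-- Adding residues loses nothing: `x % q + y % q` has the class of `x + y` modulo `q`, and likewise
modulo `i + 1`. So the test on the full sums depends only on the two letters. -/
theorem score_letter {x y i j : ℕ} (hi : i < L) (hj : j < L) :
    score q L N F (letter q L x i) (letter q L y j) =
      if i = j ∧ 0 < i ∧ ((i + 1 : ℕ) : ℤ) ∣ (x + y : ℤ) - F ((x + y) % q) then 1 else -(N : ℤ) := by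
  unfold score
  rw [letter_div_mod hi, letter_div_mod hj, letter_div_div hi, letter_div_div hj, letter_mod hi,
    letter_mod hj, ← Nat.add_mod]
  congr 1
  simp only [eq_iff_iff]
  refine and_congr_right fun hij => and_congr_right fun _ => ?_
  subst hij
  rw [← Int.dvd_iff_emod_eq_zero]
  push_cast
  rw [← Int.dvd_iff_dvd_of_dvd_sub]
  have hx := Int.emod_add_mul_ediv (x : ℤ) (i + 1)
  have hy := Int.emod_add_mul_ediv (y : ℤ) (i + 1)
  refine ⟨(x : ℤ) / (i + 1) + y / (i + 1), ?_⟩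
  linear_combination -hx - hy

theorem score_le_one (a b : ℕ) : score q L N F a b ≤ 1 := by
  unfold score; split_ifs <;> omega

theorem abs_score_le (hN : 1 ≤ N) (a b : ℕ) : |score q L N F a b| ≤ N := by
  unfold score; split_ifs <;> simp; omega

/-- Both strings are the concatenation of the blocks of the numbers `elem 0, …, elem (n - 1)`. -/
def inst (n q L : ℕ) (hq : 0 < q) (hL : 0 < L) (F : ℕ → ℕ) (elem : ℕ → ℕ) :
    LocalAlignmentInstance where
  n := n * L
  m := q * (L * L)
  X t := ⟨letter q L (elem (t / L)) (t % L), letter_lt hq (Nat.mod_lt _ hL)⟩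
  Y t := ⟨letter q L (elem (t / L)) (t % L), letter_lt hq (Nat.mod_lt _ hL)⟩
  score a b := score q L (n * L) F a b

/-- The other terms contribute at most `l - 1 < N`, so they cannot compensate for a single mismatch.
-/
theorem sum_fin_le_of_exists {l : ℕ} {f : Fin l → ℤ} {N : ℕ} (h1 : ∀ r, f r ≤ 1) (hl : l ≤ N)
    {r : Fin l} (hr : f r = -N) : ∑ r, f r < 0 := by
  rw [← Finset.add_sum_erase _ _ (Finset.mem_univ r), hr]
  have h2 : ∑ x ∈ Finset.univ.erase r, f x ≤ ∑ x ∈ Finset.univ.erase r, 1 :=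
    Finset.sum_le_sum fun x _ => h1 x
  rw [Finset.sum_const, Finset.card_erase_of_mem (Finset.mem_univ r), Finset.card_univ,
    Fintype.card_fin, nsmul_eq_mul, mul_one] at h2
  have : 0 < l := r.pos
  push_cast [this] at h2
  omega

/-- An optimal alignment points to a solution if there is one. -/
theorem solution_of_isOptimal {n U : ℕ} {hq : 0 < q} {hL : 0 < L} {elem : ℕ → ℕ} (hL2 : 2 ≤ L)
    (hU : (L + 1) * U < 2 ^ L)
    (hF : ∀ x y, |((elem x + elem y : ℕ) : ℤ) - F ((elem x + elem y) % q)| ≤ U)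
    {a b : ℕ} (ha : a < n) (hb : b < n) (hab : elem a + elem b = F ((elem a + elem b) % q))
    {i j l : ℕ} (h : (inst n q L hq hL F elem).IsOptimal i j l) :
    i / L < n ∧ j / L < n ∧
      elem (i / L) + elem (j / L) = F ((elem (i / L) + elem (j / L)) % q) := by
  obtain ⟨hi, hj, hopt⟩ := h
  have hnL : (inst n q L hq hL F elem).n = n * L := rfl
  have hblock : ∀ {a}, a < n → a * L + L ≤ n * L := fun {a} h => by
    rw [← Nat.succ_mul]; exact Nat.mul_le_mul_right L h
  have hsc : ∀ i j : ℕ, score q L (n * L) F (letter q L (elem (i / L)) (i % L))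
      (letter q L (elem (j / L)) (j % L)) = if i % L = j % L ∧ 0 < i % L ∧
        ((i % L + 1 : ℕ) : ℤ) ∣ ((elem (i / L) : ℤ) + elem (j / L)) -
          F ((elem (i / L) + elem (j / L)) % q) then 1 else -((n * L : ℕ) : ℤ) := fun i j =>
    score_letter (Nat.mod_lt _ hL) (Nat.mod_lt _ hL)
  have hmod : ∀ a r, r < L → (a * L + r) % L = r := fun a r hr => by
    rw [Nat.mul_add_mod', Nat.mod_eq_of_lt hr]
  have hdiv : ∀ a r, r < L → (a * L + r) / L = a := fun a r hr => by
    rw [add_comm, Nat.add_mul_div_right _ _ hL, Nat.div_eq_of_lt hr, zero_add]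
  -- The matching blocks `a` and `b` without their separators at position 0: all `L - 1` letters
  -- match. So the optimum is at least `L - 1`, which is positive.
  have h1 : (inst n q L hq hL F elem).value (a * L + 1) (b * L + 1) (L - 1)
      (by have := hblock ha; omega) (by have := hblock hb; omega) = (L - 1 : ℕ) := by
    have : ∀ r : Fin (L - 1), score q L (n * L) F
        (letter q L (elem ((a * L + 1 + r) / L)) ((a * L + 1 + r) % L))
        (letter q L (elem ((b * L + 1 + r) / L)) ((b * L + 1 + r) % L)) = 1 := by
      intro r
      have hr : 1 + (r : ℕ) < L := by omega
      rw [hsc, add_assoc, add_assoc, hmod _ _ hr, hmod _ _ hr, hdiv _ _ hr, hdiv _ _ hr, ← hab]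
      exact if_pos ⟨rfl, by omega, by simp⟩
    unfold LocalAlignmentInstance.value
    exact (Finset.sum_congr rfl fun r _ => this r).trans (by simp)
  have h2 := h1 ▸ hopt (a * L + 1) (b * L + 1) (L - 1) (by have := hblock ha; omega)
    (by have := hblock hb; omega)
  have hmatch : ∀ r : Fin l, score q L (n * L) F
      (letter q L (elem ((i + r) / L)) ((i + r) % L))
      (letter q L (elem ((j + r) / L)) ((j + r) % L)) ≠ -((n * L : ℕ) : ℤ) := by
    intro r hr
    have := sum_fin_le_of_exists (f := fun r : Fin l => score q L (n * L) F
      (letter q L (elem ((i + r) / L)) ((i + r) % L))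
      (letter q L (elem ((j + r) / L)) ((j + r) % L))) (fun _ => score_le_one _ _)
      (by omega) hr
    exact absurd (h2.trans_lt this) (by omega)
  have hl : L - 1 ≤ l := by
    have : (inst n q L hq hL F elem).value i j l hi hj ≤ ∑ r : Fin l, 1 :=
      Finset.sum_le_sum fun r _ => score_le_one _ _
    simp at this
    omega
  have hm : ∀ r < l, (i + r) % L = (j + r) % L ∧ 0 < (i + r) % L ∧
      (((i + r) % L + 1 : ℕ) : ℤ) ∣ ((elem ((i + r) / L) : ℤ) + elem ((j + r) / L)) -
          F ((elem ((i + r) / L) + elem ((j + r) / L)) % q) := by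
    intro r hr
    by_contra hcon
    refine hmatch ⟨r, hr⟩ ?_
    rw [hsc]
    exact if_neg hcon
  -- An interval of at least `L - 1` positions without a separator starts right after one; from a
  -- later start it would reach the next separator.
  have hone : ∀ k, (∀ r < l, 0 < (k + r) % L) → k % L = 1 := by
    intro k hk
    have hkL := Nat.mod_lt k hL
    have hk0 := hk 0 (by omega)
    by_contra h1
    have := hk (L - k % L) (by simp at hk0; omega)
    have hd := Nat.div_add_mod k L
    have e : k + (L - k % L) = L * (k / L + 1) := by rw [mul_add]; omega
    rw [e, Nat.mul_mod_right] at this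
    omega
  have hi1 : i % L = 1 := hone i fun r hr => (hm r hr).2.1
  have hj1 : j % L = 1 := hone j fun r hr => (hm r hr).1 ▸ (hm r hr).2.1
  have hid := Nat.div_add_mod' i L
  have hjd := Nat.div_add_mod' j L
  rw [hi1] at hid
  rw [hj1] at hjd
  refine ⟨(Nat.div_lt_iff_lt_mul hL).2 (by omega), (Nat.div_lt_iff_lt_mul hL).2 (by omega), ?_⟩
  have hz := eq_zero_of_forall_dvd hU (hF (i / L) (j / L)) fun d hd hdL => ?_
  · omega
  · rcases Nat.lt_or_ge 1 d with h | h
    -- The modulus `d` is tested at position `d - 1` of the block, which is offset `d - 2` of an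
    -- alignment that starts at position 1.
    · have hdl : 1 + (d - 2) < L := by omega
      have := (hm (d - 2) (by omega)).2.2
      rw [← hid, ← hjd, add_assoc, add_assoc, hmod _ _ hdl, hdiv _ _ hdl, hdiv _ _ hdl] at this
      rw [show 1 + (d - 2) + 1 = d by omega] at this
      exact_mod_cast this
    · obtain rfl : d = 1 := by omega
      simp

end ThreeSumAlignment

/-! ## The reduction: choosing a modulus and distributing the list -/

namespace WordRAM

local infixl:65 " +ₑ " => Expr.bin Op.add
local infixl:65 " -ₑ " => Expr.bin Op.sub
local infixl:70 " *ₑ " => Expr.bin Op.mul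
local infixl:70 " /ₑ " => Expr.bin Op.div
local infixl:70 " %ₑ " => Expr.bin Op.mod
local infixl:50 " <ₑ " => Expr.bin Op.lt
local infixl:50 " =ₑ " => Expr.bin Op.eq

open Program (forLoop)

/-- Array `1` holds the list, and variable `8` its length. -/
structure HoldsList (l : List ℕ) (s : State) : Prop where
  length : s.var 8 = l.length
  entry : ∀ (j : ℕ) (h : j < l.length), s.arr 1 j = l[j]

theorem HoldsList.congr {l : List ℕ} {s s' : State} (h : HoldsList l s) (h8 : s'.var 8 = s.var 8)
    (h1 : s'.arr 1 = s.arr 1) : HoldsList l s' :=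
  ⟨h8.trans h.length, fun j hj => by rw [h1]; exact h.entry j hj⟩

theorem HoldsList.length_le {l : List ℕ} {s : State} (h : HoldsList l s) {B : ℕ}
    (hs : s.BoundedBy B) : (l.length : ℤ) ≤ B := by
  have := hs.1 8
  rwa [h.length, Nat.abs_cast] at this

theorem HoldsList.entry_le {l : List ℕ} {s : State} (h : HoldsList l s) {B : ℕ}
    (hs : s.BoundedBy B) {j : ℕ} (hj : j < l.length) : |(l[j] : ℤ)| ≤ B := by
  have := hs.2 1 j
  rwa [h.entry j hj] at this

/-- Computes the overflow of the list for the capacity in variable `4` and the modulus in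
variable `17`. -/
def countLoads : Program :=
  forLoop 14 8
    (.seq (.assign 18 (.get 1 (.var 14) %ₑ .var 17))
      (.seq (.cond (.get 2 (.var 18) <ₑ .var 4) .skip (.assign 15 (.var 15 +ₑ .lit 1)))
        (.store 2 (.var 18) (.get 2 (.var 18) +ₑ .lit 1))))

/-- Finds the modulus in `1, …, Q`, where `Q` is in variable `3`, with the smallest overflow. -/
def selectModulus : Program :=
  .seq (.assign 9 (.lit 1)) (.seq (.assign 10 (.var 8))
    (forLoop 12 3
      (.seq (.assign 17 (.var 12 +ₑ .lit 1))
        (.seq (forLoop 14 17 (.store 2 (.var 14) (.lit 0)))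
          (.seq (.assign 15 (.lit 0))
            (.seq countLoads
              (.cond (.var 15 <ₑ .var 10) (.seq (.assign 10 (.var 15)) (.assign 9 (.var 17)))
                .skip)))))))

/-- Moves one member of the list from each residue class modulo the content of variable `9` to
array `2`. -/
def passOnce : Program :=
  .seq (forLoop 14 9 (.store 2 (.var 14) (.lit 0)))
    (.seq (.assign 15 (.lit 0))
      (.seq (forLoop 14 8
        (.seq (.assign 17 (.get 1 (.var 14)))
          (.seq (.assign 18 (.var 17 %ₑ .var 9))
            (.cond (.get 2 (.var 18))
              (.seq (.store 1 (.var 15) (.var 17)) (.assign 15 (.var 15 +ₑ .lit 1)))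
              (.store 2 (.var 18) (.var 17))))))
        (.assign 8 (.var 15))))

variable {W B : ℕ}

theorem load_le_length (q : ℕ) (l : List ℕ) (r : ℕ) : load q l r ≤ l.length :=
  List.countP_le_length

/-- The invariant: array 2 holds the loads, and variable 15 the overflow, of the prefix read so far.
-/
theorem wp_countLoads (hWB : Roomy W B) {s : State} (hs : s.BoundedBy B) {l : List ℕ} {q K : ℕ}
    (hq : 0 < q) (hl : HoldsList l s) (hq' : s.var 17 = q) (hK : s.var 4 = K)
    (h0 : ∀ r : ℕ, r < q → s.arr 2 r = 0) (h15 : s.var 15 = 0) :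
    Wp W B countLoads ((l.length + 1) * 40)
      (fun s' => s'.var 15 = overflow K q l) s := by
  refine (Wp.forLoop (T := 32) hWB hs
    (fun j s' => (∀ r : ℕ, r < q → s'.arr 2 r = load q (l.take j) r) ∧
      s'.var 15 = overflow K q (l.take j)) hl.length (by decide)
      (by simp [Program.AssignsVar]) (by simp [Program.AssignsVar]) ?_ ?_).weaken le_rfl ?_
  · refine ⟨fun r hr => ?_, ?_⟩
    · simpa [load] using h0 r hr
    · simpa [State.setVar_var] using h15
  · rintro j hj s' hs' hi hv ha ⟨hc, ho⟩
    have v8 := hv 8 (by decide) (by simp [Program.AssignsVar])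
    have v17 := hv 17 (by decide) (by simp [Program.AssignsVar])
    have v4 := hv 4 (by decide) (by simp [Program.AssignsVar])
    have hl' : HoldsList l s' := hl.congr v8 (ha 1 (by simp [Program.WritesArr]))
    rw [hq'] at v17
    rw [hK] at v4
    have hlB := hl'.length_le hs'
    have hr : l[j] % q < q := Nat.mod_lt _ hq
    have hrB : |((l[j] % q : ℕ) : ℤ)| ≤ B := by
      have := hs'.1 17
      rw [v17, Nat.abs_cast] at this
      rw [Nat.abs_cast]; omega
    have htake : l.take (j + 1) = l.take j ++ [l[j]] := by simp
    have hload := load_le_length q (l.take j) (l[j] % q)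
    have hov := overflow_le_length K hq (l.take j)
    rw [List.length_take, min_eq_left hj.le] at hload hov
    refine Wp.assign_seq (T₂ := 26) hs' (hWB.fits hs' rfl) ((l[j] % q : ℕ) : ℤ) ?_ hrB
      (fun hs₁ => ?_) (by simp [Expr.cost])
    · simp [Expr.eval, Op.eval, hi, v17, hl'.entry j hj]
    refine Wp.seq (T₁ := 15) (T₂ := 10) (Q₁ := fun s₂ => s₂ =
      (s'.setVar 18 ((l[j] % q : ℕ) : ℤ)).setVar 15 (overflow K q (l.take (j + 1)))) ?_ ?_
      (by omega)
    · have hcond : (Expr.get 2 (.var 18) <ₑ .var 4).eval (s'.setVar 18 ((l[j] % q : ℕ) : ℤ)) =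
          if load q (l.take j) (l[j] % q) < K then 1 else 0 := by
        simp only [Expr.eval, Op.eval, State.setVar_var, State.setVar_arr, if_true, v4]
        rw [hc _ hr]
        simp
      have hov' : overflow K q (l.take (j + 1)) = overflow K q (l.take j) +
          if K ≤ load q (l.take j) (l[j] % q) then 1 else 0 := by
        rw [htake, overflow_append_singleton K hq]
      refine Wp.cond (T₁ := 5) (hWB.fits hs₁ rfl) (fun h => ?_) (fun h => ?_) (by simp [Expr.cost])
      · rw [hcond] at h
        have h' : load q (l.take j) (l[j] % q) < K := by by_contra h'; simp [h'] at h
        refine Wp.skip hs₁ (by omega) ?_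
        rw [hov', if_neg (by omega), add_zero, ← ho]
        unfold State.setVar
        simp
      · rw [hcond] at h
        have h' : K ≤ load q (l.take j) (l[j] % q) := by by_contra h'; simp at h; omega
        have hval : (Expr.var 15 +ₑ .lit 1).eval (s'.setVar 18 ((l[j] % q : ℕ) : ℤ)) =
            overflow K q (l.take (j + 1)) := by
          rw [hov', if_pos h']
          simp [Expr.eval, Op.eval, State.setVar_var, ho]
        refine Wp.assign hs₁ (hWB.fits hs₁ rfl) (by simp [Expr.cost]) ?_ ?_
        · rw [hval, Nat.abs_cast, hov', if_pos h']; omega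
        · rw [hval]
    · rintro _ hs₂ rfl
      have hval : (Expr.get 2 (.var 18) +ₑ .lit 1).eval ((s'.setVar 18 ((l[j] % q : ℕ) : ℤ)).setVar
          15 (overflow K q (l.take (j + 1)))) = (load q (l.take j) (l[j] % q) + 1 : ℕ) := by
        simp only [Expr.eval, Op.eval, State.setVar_var, State.setVar_arr]
        rw [if_neg (by decide), if_true, hc _ hr]
        simp
      refine Wp.store hs₂ (hWB.fits hs₂ rfl) (hWB.fits hs₂ rfl) (by simp [Expr.cost]) ?_ ?_
      · rw [hval, Nat.abs_cast]; omega
      · rw [hval]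
        refine ⟨fun r hrq => ?_, by simp [State.setVar_var]⟩
        rw [htake, load_append_singleton]
        simp only [State.setVar_arr, State.setArr_arr, Expr.eval, State.setVar_var]
        by_cases h : l[j] % q = r
        · subst h; simp
        · rw [if_neg h, if_neg (by simp; omega), hc r hrq, add_zero]
  · rintro s' _ ⟨⟨_, h⟩, _⟩
    rwa [List.take_length] at h

/-- Clearing a segment of array `2`. -/
theorem wp_clear (hWB : Roomy W B) {s : State} (hs : s.BoundedBy B) {y q : ℕ} (hy : y ≠ 14)
    (hq : s.var y = q) :
    Wp W B (forLoop 14 y (.store 2 (.var 14) (.lit 0))) ((q + 1) * 11) (fun s' =>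
      (∀ r : ℕ, r < q → s'.arr 2 r = 0) ∧ (∀ x, x ≠ 14 → s'.var x = s.var x) ∧
        ∀ A, A ≠ 2 → s'.arr A = s.arr A) s := by
  refine (Wp.fill hWB hs 0 (fun _ => 0) hq hy (fun _ _ => by simp) rfl rfl ?_).weaken
    (by simp [Expr.cost]) ?_
  · intro k _ s' hi _ _
    simp [Expr.eval, hi]
  · rintro s' _ ⟨h1, h2, h3⟩
    refine ⟨fun r hr => ?_, h2, h3⟩
    rw [h1, if_pos (by omega)]

/-- All moduli up to `Q` are tried, prime or not. A minimum over more moduli is only better, and no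
primality test is needed. -/
theorem wp_selectModulus (hWB : Roomy W B) {s : State} (hs : s.BoundedBy B) {l : List ℕ}
    {Q K : ℕ} (hQ : 0 < Q) (hl : HoldsList l s) (h3 : s.var 3 = Q) (h4 : s.var 4 = K) :
    Wp W B selectModulus ((Q + 1) * (Q + l.length + 2) * 60) (fun s' => ∃ q : ℕ, s'.var 9 = q ∧
      0 < q ∧ q ≤ Q ∧ ∀ q', 0 < q' → q' ≤ Q → overflow K q l ≤ overflow K q' l) s := by
  have hlB := hl.length_le hs
  have hB2 := hWB.two_le
  have hQB : (Q : ℤ) ≤ B := by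
    have := hs.1 3
    rwa [h3, Nat.abs_cast] at this
  refine Wp.assign_seq (T₂ := (Q + 1) * ((Q + l.length + 2) * 40 + 20) + 2) hs (hWB.fits hs rfl) 1
    rfl (by simp; omega) (fun hs₁ => ?_) (by simp [Expr.cost]; nlinarith)
  refine Wp.assign_seq (T₂ := (Q + 1) * ((Q + l.length + 2) * 40 + 20)) hs₁ (hWB.fits hs₁ rfl)
    l.length ?_ (by rwa [Nat.abs_cast]) (fun hs₂ => ?_) (by simp [Expr.cost]; omega)
  · simp [Expr.eval, State.setVar_var, hl.length]
  -- The record `o` is only an upper bound for the overflow of `q`, because it starts as the length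
  -- of the list, paired with the modulus 1.
  refine (Wp.forLoop (T := (Q + l.length + 2) * 40 + 12) hWB hs₂
    (fun k s' => ∃ q o : ℕ, s'.var 9 = q ∧ s'.var 10 = o ∧ 0 < q ∧ q ≤ Q ∧ overflow K q l ≤ o ∧
      o ≤ l.length ∧ ∀ q', 0 < q' → q' ≤ k → o ≤ overflow K q' l) (N := Q) ?_ (by decide)
      (by simp [Program.AssignsVar, forLoop, countLoads])
      (by simp [Program.AssignsVar, forLoop, countLoads]) ?_ ?_).weaken le_rfl ?_
  · simpa [State.setVar_var] using h3
  · refine ⟨1, l.length, by simp [State.setVar_var], by simp [State.setVar_var], one_pos, hQ,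
      overflow_le_length K one_pos l, le_rfl, fun q' h h' => ?_⟩
    omega
  · rintro k hk s' hs' hi hv ha ⟨q, o, h9, h10, hq, hqQ, hqo, hol, hmin⟩
    have v3 : s'.var 3 = Q := by
      rw [hv 3 (by decide) (by simp [Program.AssignsVar, forLoop, countLoads])]
      simpa [State.setVar_var] using h3
    have v4 : s'.var 4 = K := by
      rw [hv 4 (by decide) (by simp [Program.AssignsVar, forLoop, countLoads])]
      simpa [State.setVar_var] using h4
    have hl' : HoldsList l s' := hl.congr
      (by
        rw [hv 8 (by decide) (by simp [Program.AssignsVar, forLoop, countLoads])]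
        simp [State.setVar_var])
      (by rw [ha 1 (by simp [Program.WritesArr, forLoop, countLoads])]; simp)
    have hkB : |((k + 1 : ℕ) : ℤ)| ≤ B := by rw [Nat.abs_cast]; omega
    refine Wp.assign_seq (T₂ := (Q + l.length + 2) * 40 + 8) hs' (hWB.fits hs' rfl) (k + 1 : ℕ)
      (by simp [Expr.eval, Op.eval, hi]) hkB (fun hs₃ => ?_) (by simp [Expr.cost]; omega)
    refine Wp.seq (wp_clear hWB hs₃ (q := k + 1) (by decide) (by simp [State.setVar_var])) ?_
      (T₂ := (Q + l.length + 2) * 40 + 8 - (k + 1 + 1) * 11) (by omega)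
    rintro s₄ hs₄ ⟨hz, hv₄, ha₄⟩
    refine Wp.assign_seq (T₂ := (l.length + 1) * 40 + 9) hs₄ (hWB.fits hs₄ rfl) 0 rfl (by simp)
      (fun hs₅ => ?_) (by simp [Expr.cost]; omega)
    refine Wp.seq (T₂ := 9) (wp_countLoads (K := K) hWB hs₅ (Nat.succ_pos k) (l := l) ?_ ?_ ?_ ?_
      (by simp [State.setVar_var])).frame ?_ le_rfl
    · exact hl'.congr (by simp [State.setVar_var, hv₄])
        (by rw [State.setVar_arr, ha₄ 1 (by decide), State.setVar_arr])
    · simp [State.setVar_var, hv₄]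
    · simpa [State.setVar_var, hv₄] using v4
    · simpa using hz
    rintro s₆ hs₆ ⟨h15, hv₆, -⟩
    have w9 : s₆.var 9 = q := by
      rw [hv₆ 9 (by simp [Program.AssignsVar, forLoop, countLoads])]
      simpa [State.setVar_var, hv₄] using h9
    have w10 : s₆.var 10 = o := by
      rw [hv₆ 10 (by simp [Program.AssignsVar, forLoop, countLoads])]
      simpa [State.setVar_var, hv₄] using h10
    have w17 : s₆.var 17 = (k + 1 : ℕ) := by
      rw [hv₆ 17 (by simp [Program.AssignsVar, forLoop, countLoads])]
      simp [State.setVar_var, hv₄]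
    have hov := overflow_le_length K (Nat.succ_pos k) l
    have hcond : (Expr.var 15 <ₑ .var 10).eval s₆ =
        if overflow K (k + 1) l < o then 1 else 0 := by
      simp [Expr.eval, Op.eval, h15, w10]
    refine Wp.cond (T₁ := 5) (hWB.fits hs₆ rfl) (fun h => ?_) (fun h => ?_) (by simp [Expr.cost])
    · rw [hcond] at h
      have h' : overflow K (k + 1) l < o := by by_contra h'; simp [h'] at h
      refine Wp.assign_seq (T₂ := 3) hs₆ (hWB.fits hs₆ rfl) (overflow K (k + 1) l)
        (by simpa [Expr.eval] using h15) (by rw [Nat.abs_cast]; omega) (fun hs₇ => ?_)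
        (by simp [Expr.cost])
      refine Wp.assign hs₇ (hWB.fits hs₇ rfl) (by simp [Expr.cost]) (by exact hs₇.1 17) ?_
      refine ⟨k + 1, overflow K (k + 1) l, ?_, ?_, by omega, by omega, le_rfl, hov, ?_⟩
      · simp [State.setVar_var, Expr.eval, w17]
      · simp [State.setVar_var]
      · intro q' h1 h2
        rcases Nat.lt_or_ge k q' with h3 | h3
        · obtain rfl : q' = k + 1 := by omega
          exact le_rfl
        · exact h'.le.trans (hmin q' h1 h3)
    · rw [hcond] at h
      have h' : o ≤ overflow K (k + 1) l := by by_contra h'; simp at h; omega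
      refine Wp.skip hs₆ (by omega) ⟨q, o, ?_, ?_, hq, hqQ, hqo, hol, fun q' h1 h2 => ?_⟩
      · simpa [State.setVar_var] using w9
      · simpa [State.setVar_var] using w10
      · rcases Nat.lt_or_ge k q' with h3 | h3
        · obtain rfl : q' = k + 1 := by omega
          exact h'
        · exact hmin q' h1 h3
  · rintro s' _ ⟨⟨q, o, h9, _, hq, hqQ, hqo, _, hmin⟩, _⟩
    exact ⟨q, h9, hq, hqQ, fun q' h1 h2 => hqo.trans (hmin q' h1 h2)⟩

theorem wp_passOnce (hWB : Roomy W B) {s : State} (hs : s.BoundedBy B) {l : List ℕ}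
    {q : ℕ} (hq : 0 < q) (hl : HoldsList l s) (h9 : s.var 9 = q) (hpos : ∀ x ∈ l, 0 < x) :
    Wp W B passOnce ((q + l.length + 2) * 40) (fun s' => ∃ rest F, IsPass q l rest F ∧
      HoldsList rest s' ∧ ∀ r : ℕ, r < q → s'.arr 2 r = F r) s := by
  have hlB := hl.length_le hs
  refine Wp.seq (wp_clear hWB hs (by decide) h9) ?_ (T₂ := (l.length + 1) * 32 + 4) (by omega)
  rintro s₁ hs₁ ⟨hz, hv₁, ha₁⟩
  refine Wp.assign_seq (T₂ := (l.length + 1) * 32 + 2) hs₁ (hWB.fits hs₁ rfl) 0 rfl (by simp)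
    (fun hs₂ => ?_) (by simp [Expr.cost]; omega)
  refine Wp.seq (T₁ := (l.length + 1) * 32) (T₂ := 2) (Q₁ := fun s' => ∃ rest F,
    IsPass q l rest F ∧ s'.var 15 = rest.length ∧
    (∀ (j : ℕ) (h : j < rest.length), s'.arr 1 j = rest[j]) ∧
      ∀ r : ℕ, r < q → s'.arr 2 r = F r) ?_ ?_ le_rfl
  -- The list is compacted in place. The write index `rest.length` never overtakes the read index
  -- `k`, so the unread tail is intact.
  · refine (Wp.forLoop (T := 24) (N := l.length) hWB hs₂
      (fun k s' => ∃ rest F, IsPass q (l.take k) rest F ∧ s'.var 15 = rest.length ∧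
        (∀ (j : ℕ) (h : j < rest.length), s'.arr 1 j = rest[j]) ∧
        (∀ (j : ℕ) (h : j < l.length), k ≤ j → s'.arr 1 j = l[j]) ∧
        ∀ r : ℕ, r < q → s'.arr 2 r = F r) ?_ (by decide)
        (by simp [Program.AssignsVar]) (by simp [Program.AssignsVar]) ?_ ?_).weaken le_rfl ?_
    · simpa [State.setVar_var, hv₁] using hl.length
    · refine ⟨[], fun _ => 0, by simpa using IsPass.nil q, by simp [State.setVar_var], by simp,
        fun j h _ => ?_, fun r hr => by simpa using hz r hr⟩
      rw [State.setVar_arr, State.setVar_arr, ha₁ 1 (by decide), hl.entry j h]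
    · rintro k hk s' hs' hi hv ha ⟨rest, F, hp, h15, hrest, htail, hF⟩
      have v9 : s'.var 9 = q := by
        rw [hv 9 (by decide) (by simp [Program.AssignsVar])]
        simpa [State.setVar_var, hv₁] using h9
      have hxB : |(l[k] : ℤ)| ≤ B := hl.entry_le hs hk
      have hr : l[k] % q < q := Nat.mod_lt _ hq
      have hrB : |((l[k] % q : ℕ) : ℤ)| ≤ B := by
        have := hs'.1 9
        rw [v9, Nat.abs_cast] at this
        rw [Nat.abs_cast]; omega
      have htake : l.take (k + 1) = l.take k ++ [l[k]] := by simp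
      have hlen : rest.length ≤ k := by
        have := hp.sublist.length_le
        rwa [List.length_take, min_eq_left hk.le] at this
      refine Wp.assign_seq (T₂ := 20) hs' (hWB.fits hs' rfl) (l[k] : ℤ)
        (by simp [Expr.eval, hi, htail k hk le_rfl]) hxB (fun hs₃ => ?_) (by simp [Expr.cost])
      refine Wp.assign_seq (T₂ := 15) hs₃ (hWB.fits hs₃ rfl) ((l[k] % q : ℕ) : ℤ)
        (by simp [Expr.eval, Op.eval, State.setVar_var, v9]) hrB (fun hs₄ => ?_)
        (by simp [Expr.cost])
      have hcond : (Expr.get 2 (.var 18)).eval ((s'.setVar 17 (l[k] : ℤ)).setVar 18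
          ((l[k] % q : ℕ) : ℤ)) = F (l[k] % q) := by
        simp only [Expr.eval, State.setVar_var, State.setVar_arr, if_true]
        exact hF _ hr
      refine Wp.cond (T₁ := 9) (hWB.fits hs₄ rfl) (fun h => ?_) (fun h => ?_) (by simp [Expr.cost])
      · rw [hcond] at h
        refine Wp.store_seq (T₂ := 4) hs₄ (hWB.fits hs₄ rfl) (hWB.fits hs₄ rfl) rest.length (l[k])
          (by simpa [Expr.eval, State.setVar_var] using h15) (by simp [Expr.eval, State.setVar_var])
          hxB (fun hs₅ => ?_) (by simp [Expr.cost])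
        have hval : (Expr.var 15 +ₑ .lit 1).eval ((((s'.setVar 17 (l[k] : ℤ)).setVar 18
            ((l[k] % q : ℕ) : ℤ))).setArr 1 rest.length (l[k])) = (rest.length + 1 : ℕ) := by
          simp [Expr.eval, Op.eval, State.setVar_var, h15]
        refine Wp.assign hs₅ (hWB.fits hs₅ rfl) (by simp [Expr.cost])
          (by rw [hval, Nat.abs_cast]; omega) ?_
        rw [hval]
        refine ⟨rest ++ [l[k]], F, ?_, by simp [State.setVar_var], fun j hj => ?_,
          fun j hj hkj => ?_, fun r hr => ?_⟩
        · rw [htake]; exact hp.leave (by exact_mod_cast h)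
        · simp only [State.setVar_arr, State.setArr_arr]
          rw [List.length_append, List.length_singleton] at hj
          by_cases hjr : j = rest.length
          · subst hjr; simp
          · rw [if_neg (by simpa using hjr), hrest j (by omega), List.getElem_append_left]
        · simp only [State.setVar_arr, State.setArr_arr]
          rw [if_neg (by simp; omega), htail j hj (by omega)]
        · simp only [State.setVar_arr, State.setArr_arr]
          rw [if_neg (by simp), hF r hr]
      · rw [hcond] at h
        have haddr : (Expr.var 18).eval ((s'.setVar 17 (l[k] : ℤ)).setVar 18
          ((l[k] % q : ℕ) : ℤ)) = (l[k] % q : ℕ) := by simp [Expr.eval, State.setVar_var]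
        have hval : (Expr.var 17).eval ((s'.setVar 17 (l[k] : ℤ)).setVar 18
          ((l[k] % q : ℕ) : ℤ)) = l[k] := by simp [Expr.eval, State.setVar_var]
        refine Wp.store hs₄ (hWB.fits hs₄ rfl) (hWB.fits hs₄ rfl) (by simp [Expr.cost])
          (by rwa [hval]) ?_
        rw [haddr, hval]
        refine ⟨rest, Function.update F (l[k] % q) l[k], ?_, by simpa [State.setVar_var] using h15,
          fun j hj => ?_, fun j hj hkj => ?_, fun r hr => ?_⟩
        · rw [htake]
          exact hp.pick (hpos _ (List.getElem_mem hk)) (by exact_mod_cast h)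
        · simp only [State.setVar_arr, State.setArr_arr]
          rw [if_neg (by simp), hrest j hj]
        · simp only [State.setVar_arr, State.setArr_arr]
          rw [if_neg (by simp), htail j hj (by omega)]
        · simp only [State.setVar_arr, State.setArr_arr]
          by_cases hrk : r = l[k] % q
          · subst hrk; simp
          · rw [if_neg (by simp; omega), hF r hr, Function.update_of_ne hrk]
    · rintro s' _ ⟨⟨rest, F, hp, h15, hrest, _, hF⟩, _⟩
      rw [List.take_length] at hp
      exact ⟨rest, F, hp, h15, hrest, hF⟩
  · rintro s' hs' ⟨rest, F, hp, h15, hrest, hF⟩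
    refine Wp.assign hs' (hWB.fits hs' rfl) (by simp [Expr.cost]) (hs'.1 15) ⟨rest, F, hp, ⟨?_, ?_⟩,
      ?_⟩
    · simpa [State.setVar_var, Expr.eval] using h15
    · exact hrest
    · exact hF

end WordRAM

/-! ## The reduction: calling the algorithm for Local Alignment -/

namespace WordRAM

local infixl:65 " +ₑ " => Expr.bin Op.add
local infixl:65 " -ₑ " => Expr.bin Op.sub
local infixl:70 " *ₑ " => Expr.bin Op.mul
local infixl:70 " /ₑ " => Expr.bin Op.div
local infixl:70 " %ₑ " => Expr.bin Op.mod
local infixl:50 " <ₑ " => Expr.bin Op.lt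
local infixl:50 " =ₑ " => Expr.bin Op.eq

open Program (forLoop)
open ThreeSumAlignment

variable {W B : ℕ}

/-- The initial memory content that presents an instance of Local Alignment. -/
def alignmentInput (I : LocalAlignmentInstance) : State where
  var := fun x => if x = 0 then (I.n : ℤ) else if x = 1 then (I.m : ℤ) else 0
  arr := fun A =>
    if A = 0 then arrayOf (fun i => ((I.X i : ℕ) : ℤ))
    else if A = 1 then arrayOf (fun i => ((I.Y i : ℕ) : ℤ))
    else if A = 2 then arrayOf (fun r : Fin (I.m * I.m) => I.score r.divNat r.modNat)
    else fun _ => 0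

/-- The fixed memory content during the reduction. -/
structure Setup (n g Q K S : ℕ) (elem : ℕ → ℕ) (s : State) : Prop where
  v0 : s.var 0 = n
  v2 : s.var 2 = g
  v3 : s.var 3 = Q
  v4 : s.var 4 = K
  v5 : s.var 5 = (n * g : ℕ)
  v6 : s.var 6 = S
  a0 : ∀ i : ℕ, s.arr 0 i = elem i

theorem Setup.congr {n g Q K S : ℕ} {elem : ℕ → ℕ} {s s' : State} (h : Setup n g Q K S elem s)
    (hv : ∀ x, x = 0 ∨ (2 ≤ x ∧ x ≤ 6) → s'.var x = s.var x) (ha : s'.arr 0 = s.arr 0) :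
    Setup n g Q K S elem s' :=
  ⟨(hv 0 (by omega)).trans h.v0, (hv 2 (by omega)).trans h.v2, (hv 3 (by omega)).trans h.v3,
    (hv 4 (by omega)).trans h.v4, (hv 5 (by omega)).trans h.v5, (hv 6 (by omega)).trans h.v6,
    fun i => by rw [ha, h.a0]⟩

/-- The zone of memory that the next call of the subroutine uses, and everything above, is empty. -/
def Fresh (W₀ : ℕ) (s : State) : Prop :=
  ∀ A, 7 ≤ A → ∀ z, s.var 7 - W₀ ≤ z → s.arr A z = 0

/-- The letter at the position in variable `14` of the string. -/
def letterExpr : Expr :=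
  ((.get 0 (.var 14 /ₑ .var 2) %ₑ .var 9) *ₑ .var 2 +ₑ (.var 14 %ₑ .var 2)) *ₑ .var 2 +ₑ
    (.get 0 (.var 14 /ₑ .var 2) %ₑ ((.var 14 %ₑ .var 2) +ₑ .lit 1))

/-- The position in its block that is encoded by a letter. -/
def posExpr (e : Expr) : Expr := e /ₑ .var 2 %ₑ .var 2

/-- The residue class that is encoded by a letter. -/
def classExpr (e : Expr) : Expr := e /ₑ (.var 2 *ₑ .var 2)

/-- The entry of the score table at the address in variable `14`. -/
def scoreExpr : Expr :=
  ((posExpr (.var 14 /ₑ .var 16) =ₑ posExpr (.var 14 %ₑ .var 16)) *ₑ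
    (.lit 0 <ₑ posExpr (.var 14 /ₑ .var 16)) *ₑ
    ((((.var 14 /ₑ .var 16) %ₑ .var 2 +ₑ (.var 14 %ₑ .var 16) %ₑ .var 2) -ₑ
      .get 2 ((classExpr (.var 14 /ₑ .var 16) +ₑ classExpr (.var 14 %ₑ .var 16)) %ₑ .var 9)) %ₑ
        (posExpr (.var 14 /ₑ .var 16) +ₑ .lit 1) =ₑ .lit 0)) *ₑ (.var 5 +ₑ .lit 1) -ₑ .var 5

/-- Is the sum of the numbers in variables `18` and `19` the chosen number in its class? -/
def checkExpr : Expr :=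
  (.lit 0 <ₑ .var 18) *ₑ (.lit 0 <ₑ .var 19) *ₑ
    (.var 18 +ₑ .var 19 =ₑ .get 2 ((.var 18 +ₑ .var 19) %ₑ .var 9))

/-- Writes the instance of Local Alignment. -/
def writeInstance : Program :=
  .seq (.assign 16 (.var 9 *ₑ (.var 2 *ₑ .var 2)))
    (.seq (.assign 17 (.var 16 *ₑ .var 16))
      (.seq (.store 7 (.var 7) (.var 5))
        (.seq (.store 7 (.var 7 +ₑ .lit 1) (.var 16))
          (.seq (forLoop 14 5 (.store 8 (.var 7 +ₑ .var 14) letterExpr))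
            (.seq (forLoop 14 5 (.store 9 (.var 7 +ₑ .var 14) letterExpr))
              (forLoop 14 17 (.store 10 (.var 7 +ₑ .var 14) scoreExpr)))))))

/-- Checks the answer to the instance and moves on to a fresh zone of memory. -/
def readAnswer : Program :=
  .seq (.assign 18 (.get 0 (.get 7 (.var 7) /ₑ .var 2)))
    (.seq (.assign 19 (.get 0 (.get 7 (.var 7 +ₑ .lit 1) /ₑ .var 2)))
      (.seq (.cond checkExpr (.assign 1 (.lit 1)) .skip)
        (.assign 7 (.var 7 +ₑ .var 6))))

theorem eval_letterExpr {s : State} {g q : ℕ} {elem : ℕ → ℕ} (h2 : s.var 2 = g) (h9 : s.var 9 = q)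
    (h0 : ∀ i : ℕ, s.arr 0 i = elem i) {k : ℕ} (hk : s.var 14 = k) :
    letterExpr.eval s = letter q g (elem (k / g)) (k % g) := by
  have := h0 (k / g)
  rw [Int.natCast_div] at this
  simp [letterExpr, Expr.eval, Op.eval, h2, h9, hk, letter, this]

theorem eval_posExpr {s : State} {g a : ℕ} (h2 : s.var 2 = g) {e : Expr} (he : e.eval s = a) :
    (posExpr e).eval s = (a / g % g : ℕ) := by
  simp [posExpr, Expr.eval, Op.eval, h2, he]

theorem eval_classExpr {s : State} {g a : ℕ} (h2 : s.var 2 = g) {e : Expr} (he : e.eval s = a) :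
    (classExpr e).eval s = (a / (g * g) : ℕ) := by
  simp [classExpr, Expr.eval, Op.eval, h2, he]

/-- The expression avoids branching: the product of the three indicators, times `N + 1`, minus `N`,
is 1 or `-N`. -/
theorem eval_scoreExpr {s : State} {g q N m : ℕ} {F : ℕ → ℕ} (hq : 0 < q) (h2 : s.var 2 = g)
    (h9 : s.var 9 = q) (h5 : s.var 5 = N) (h16 : s.var 16 = m)
    (hF : ∀ r : ℕ, r < q → s.arr 2 r = F r) {k : ℕ} (hk : s.var 14 = k) :
    scoreExpr.eval s = score q g N F (k / m) (k % m) := by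
  have ea : (Expr.var 14 /ₑ .var 16).eval s = (k / m : ℕ) := by
    simp [Expr.eval, Op.eval, h16, hk]
  have eb : (Expr.var 14 %ₑ .var 16).eval s = (k % m : ℕ) := by
    simp [Expr.eval, Op.eval, h16, hk]
  have hFr := hF ((k / m / (g * g) + k % m / (g * g)) % q) (Nat.mod_lt _ hq)
  have pa := eval_posExpr h2 ea
  have pb := eval_posExpr h2 eb
  have ca := eval_classExpr h2 ea
  have cb := eval_classExpr h2 eb
  simp only [scoreExpr, Expr.eval, Op.eval, pa, pb, ca, cb, h2, h9, h5, h16, hk]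
  rw [Int.natCast_mod] at hFr
  rw [← Nat.cast_add, hFr]
  unfold score
  simp only [Nat.cast_inj, Nat.cast_pos]
  push_cast
  split_ifs <;> first | ring1 | (exfalso; tauto)

/-- The written instance is presented to the subroutine. -/
theorem wp_writeInstance (hWB : Roomy W B) {s : State} (hs : s.BoundedBy B)
    {n g q Q K S W₀ v : ℕ} {elem F : ℕ → ℕ} (hq : 0 < q) (hg : 0 < g)
    (hset : Setup n g Q K S elem s) (h9 : s.var 9 = q) (hfresh : Fresh W₀ s)
    (hF : ∀ r : ℕ, r < q → s.arr 2 r = F r) (hvW : v ≤ W₀)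
    (hmW : (q * (g * g)) * (q * (g * g)) ≤ W₀) (hNW : n * g ≤ W₀) (hWB' : W₀ ≤ B) :
    Wp W B writeInstance ((n * g + (q * (g * g)) * (q * (g * g)) + 1) * 300)
      (fun s' => Represents W₀ v (alignmentInput (inst n q g hq hg F elem)) s' ∧
        s'.var 7 = s.var 7 ∧
        ∀ A, 7 ≤ A → ∀ z, s.var 7 + W₀ < z → s'.arr A z = 0) s := by
  obtain ⟨m, hm⟩ : ∃ m, m = q * (g * g) := ⟨_, rfl⟩
  have hm0 : 0 < m := by rw [hm]; positivity
  have hmm : m ≤ m * m := Nat.le_mul_self m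
  rw [← hm] at hmW
  rw [← hm]
  obtain ⟨N, hN⟩ : ∃ N, N = n * g := ⟨_, rfl⟩
  have h5 := hset.v5
  have h2 := hset.v2
  rw [← hN] at hNW h5
  rw [← hN]
  have hltm : ∀ k x, letter q g x (k % g) < m := fun k x => by
    rw [hm]; exact letter_lt hq (Nat.mod_lt _ hg)
  refine Wp.assign_seq (T₂ := (N + m * m + 1) * 300 - 6) hs (hWB.fits hs rfl) m
    (by simp [Expr.eval, Op.eval, h9, h2, hm]) (by rw [Nat.abs_cast]; omega) (fun hs₁ => ?_)
    (by simp [Expr.cost]; omega)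
  refine Wp.assign_seq (T₂ := (N + m * m + 1) * 300 - 10) hs₁ (hWB.fits hs₁ rfl) (m * m : ℕ)
    (by simp [Expr.eval, Op.eval, State.setVar_var]) (by rw [Nat.abs_cast]; omega) (fun hs₂ => ?_)
    (by simp [Expr.cost]; omega)
  refine Wp.store_seq (T₂ := (N + m * m + 1) * 300 - 13) hs₂ (hWB.fits hs₂ rfl) (hWB.fits hs₂ rfl)
    (s.var 7) N (by simp [Expr.eval, State.setVar_var]) (by simp [Expr.eval, State.setVar_var, h5])
    (by rw [Nat.abs_cast]; omega) (fun hs₃ => ?_) (by simp [Expr.cost]; omega)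
  refine Wp.store_seq (T₂ := (N + m * m + 1) * 300 - 18) hs₃ (hWB.fits hs₃ rfl) (hWB.fits hs₃ rfl)
    (s.var 7 + 1) m (by simp [Expr.eval, Op.eval, State.setVar_var])
    (by simp [Expr.eval, State.setVar_var])
    (by rw [Nat.abs_cast]; omega) (fun hs₄ => ?_) (by simp [Expr.cost]; omega)
  generalize hs₄e : ((((s.setVar 16 m).setVar 17 (m * m : ℕ)).setArr 7 (s.var 7) N).setArr 7
    (s.var 7 + 1) m) = s₄ at hs₄
  have w : ∀ x, x ≠ 16 → x ≠ 17 → s₄.var x = s.var x := fun x h h' => by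
    rw [← hs₄e]; simp [State.setVar_var, h, h']
  have w16 : s₄.var 16 = m := by rw [← hs₄e]; simp [State.setVar_var]
  have w17 : s₄.var 17 = (m * m : ℕ) := by rw [← hs₄e]; simp [State.setVar_var]
  have b : ∀ A, A ≠ 7 → s₄.arr A = s.arr A := fun A h => by
    rw [← hs₄e]; funext z; simp [State.setArr_arr, h]
  have b7 : ∀ z, s₄.arr 7 z = if z = s.var 7 + 1 then (m : ℤ) else if z = s.var 7 then (N : ℤ)
      else s.arr 7 z := fun z => by
    rw [← hs₄e]; simp [State.setArr_arr]
  have hl : ∀ k x, |(letter q g x (k % g) : ℤ)| ≤ B := fun k x => by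
    rw [Nat.abs_cast]; have := hltm k x; omega
  refine Wp.seq (T₂ := N * 75 + m * m * 150 + 200) (Wp.fill hWB hs₄ (s.var 7)
    (fun z => letter q g (elem (z.toNat / g)) (z.toNat % g)) (N := N) ?_ (by decide)
    (fun k _ => hl _ _) rfl rfl ?_) ?_ ?_
  · rw [w 5 (by decide) (by decide), h5]
  · intro k _ s' hi hv' ha'
    refine ⟨?_, ?_⟩
    · simp [Expr.eval, Op.eval, hi, hv' 7 (by decide), w 7 (by decide) (by decide)]
    · rw [eval_letterExpr (g := g) (q := q) (elem := elem) (k := k) _ _ _ hi]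
      · simp
      · rw [hv' 2 (by decide), w 2 (by decide) (by decide), h2]
      · rw [hv' 9 (by decide), w 9 (by decide) (by decide), h9]
      · intro i; rw [ha' 0 (by decide), b 0 (by decide), hset.a0]
  swap
  · simp [letterExpr, Expr.cost]; omega
  rintro s₅ hs₅ ⟨c8, hv₅, ha₅⟩
  refine Wp.seq (T₂ := m * m * 150 + 150) (Wp.fill hWB hs₅ (s.var 7)
    (fun z => letter q g (elem (z.toNat / g)) (z.toNat % g)) (N := N) ?_ (by decide)
    (fun k _ => hl _ _) rfl rfl ?_) ?_ ?_
  · rw [hv₅ 5 (by decide), w 5 (by decide) (by decide), h5]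
  · intro k _ s' hi hv' ha'
    refine ⟨?_, ?_⟩
    · simp [Expr.eval, Op.eval, hi, hv' 7 (by decide), hv₅ 7 (by decide),
        w 7 (by decide) (by decide)]
    · rw [eval_letterExpr (g := g) (q := q) (elem := elem) (k := k) _ _ _ hi]
      · simp
      · rw [hv' 2 (by decide), hv₅ 2 (by decide), w 2 (by decide) (by decide), h2]
      · rw [hv' 9 (by decide), hv₅ 9 (by decide), w 9 (by decide) (by decide), h9]
      · intro i; rw [ha' 0 (by decide), ha₅ 0 (by decide), b 0 (by decide), hset.a0]
  swap
  · simp [letterExpr, Expr.cost]; omega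
  rintro s₆ hs₆ ⟨c9, hv₆, ha₆⟩
  refine (Wp.fill hWB hs₆ (s.var 7)
    (fun z => score q g N F (z.toNat / m) (z.toNat % m)) (N := m * m) ?_ (by decide)
    (fun k _ => ?_) rfl rfl ?_).weaken ?_ ?_
  · rw [hv₆ 17 (by decide), hv₅ 17 (by decide), w17]
  -- For `N = 0` a matching score 1 is not bounded by `N`, so this case uses `2 ≤ B`.
  · rcases Nat.eq_zero_or_pos N with h0 | h0
    · have := hWB.two_le
      unfold score
      split_ifs
      · rw [abs_one]; omega
      · simp [h0]
    · exact (abs_score_le h0 _ _).trans (by omega)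
  · intro k _ s' hi hv' ha'
    refine ⟨?_, ?_⟩
    · simp [Expr.eval, Op.eval, hi, hv' 7 (by decide), hv₅ 7 (by decide), hv₆ 7 (by decide),
        w 7 (by decide) (by decide)]
    · rw [eval_scoreExpr (g := g) (q := q) (N := N) (m := m) (F := F) (k := k) hq _ _ _ _ _ hi]
      · simp
      · rw [hv' 2 (by decide), hv₆ 2 (by decide), hv₅ 2 (by decide),
          w 2 (by decide) (by decide), h2]
      · rw [hv' 9 (by decide), hv₆ 9 (by decide), hv₅ 9 (by decide),
          w 9 (by decide) (by decide), h9]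
      · rw [hv' 5 (by decide), hv₆ 5 (by decide), hv₅ 5 (by decide),
          w 5 (by decide) (by decide), h5]
      · rw [hv' 16 (by decide), hv₆ 16 (by decide), hv₅ 16 (by decide), w16]
      · intro r hr
        rw [ha' 2 (by decide), ha₆ 2 (by decide), ha₅ 2 (by decide), b 2 (by decide), hF r hr]
  · simp [scoreExpr, posExpr, classExpr, Expr.cost]; omega
  rintro s₇ hs₇ ⟨c10, hv₇, ha₇⟩
  have e7 : s₇.var 7 = s.var 7 := by
    rw [hv₇ 7 (by decide), hv₆ 7 (by decide), hv₅ 7 (by decide), w 7 (by decide) (by decide)]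
  have a7 : s₇.arr 7 = s₄.arr 7 := by rw [ha₇ 7 (by decide), ha₆ 7 (by decide), ha₅ 7 (by decide)]
  have a8 : s₇.arr 8 = s₅.arr 8 := by rw [ha₇ 8 (by decide), ha₆ 8 (by decide)]
  have a9 : s₇.arr 9 = s₆.arr 9 := by rw [ha₇ 9 (by decide)]
  have a11 : ∀ A, 11 ≤ A → s₇.arr A = s.arr A := fun A hA => by
    rw [ha₇ A (by omega), ha₆ A (by omega), ha₅ A (by omega), b A (by omega)]
  have fr : ∀ A, 7 ≤ A → ∀ z, s.var 7 - W₀ ≤ z → s.arr A z = 0 := hfresh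
  refine ⟨⟨fun x hx => ?_, fun A i hi => ?_⟩, e7, fun A hA z hz => ?_⟩
  · rw [e7, a7, b7, fr 7 le_rfl _ (by omega)]
    simp only [alignmentInput, inst]
    by_cases h0 : x = 0
    · subst h0; simp [hN]
    · by_cases h1 : x = 1
      · subst h1; simp [hm]
      · rw [if_neg (by omega), if_neg (by omega), if_neg h0, if_neg h1]
  · rw [abs_le] at hi
    rw [e7]
    simp only [alignmentInput, inst]
    by_cases h0 : A = 0
    · subst h0
      rw [if_pos rfl, a8, c8, b 8 (by decide), fr 8 (by decide) _ (by omega), arrayOf, ← hN]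
      by_cases hiN : 0 ≤ i ∧ i.toNat < N
      · rw [dif_pos hiN, if_pos (by omega)]; simp
      · rw [dif_neg hiN, if_neg (by omega)]
    · by_cases h1 : A = 1
      · subst h1
        rw [if_neg (by decide), if_pos rfl, a9, c9, ha₅ 9 (by decide), b 9 (by decide),
          fr 9 (by decide) _ (by omega), arrayOf, ← hN]
        by_cases hiN : 0 ≤ i ∧ i.toNat < N
        · rw [dif_pos hiN, if_pos (by omega)]; simp
        · rw [dif_neg hiN, if_neg (by omega)]
      · by_cases h2 : A = 2
        · subst h2
          rw [if_neg (by decide), if_neg (by decide), if_pos rfl, c10, ha₆ 10 (by decide),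
            ha₅ 10 (by decide), b 10 (by decide), fr 10 (by decide) _ (by omega), arrayOf, ← hN,
            ← hm]
          by_cases hiN : 0 ≤ i ∧ i.toNat < m * m
          · rw [dif_pos hiN, if_pos (by omega)]; simp
          · rw [dif_neg hiN, if_neg (by omega)]
        · rw [if_neg h0, if_neg h1, if_neg h2, a11 (A + 8) (by omega),
            fr (A + 8) (by omega) _ (by omega)]
  · have hz' : s.arr A z = 0 := fr A hA z (by omega)
    by_cases h7 : A = 7
    · subst h7
      rw [a7, b7, if_neg (by omega), if_neg (by omega), hz']
    · by_cases h8 : A = 8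
      · subst h8
        rw [a8, c8, if_neg (by omega), b 8 (by decide), hz']
      · by_cases h9 : A = 9
        · subst h9
          rw [a9, c9, if_neg (by omega), ha₅ 9 (by decide), b 9 (by decide), hz']
        · by_cases h10 : A = 10
          · subst h10
            rw [c10, if_neg (by omega), ha₆ 10 (by decide), ha₅ 10 (by decide), b 10 (by decide),
              hz']
          · rw [a11 A (by omega), hz']

end WordRAM

/-! ### One call of the aligner: write the instance, run, check the answer -/

namespace WordRAM

local infixl:65 " +ₑ " => Expr.bin Op.add

open Program (forLoop)
open ThreeSumAlignment

variable {W B : ℕ}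

/-- The program solves the instances of Local Alignment that come from the list of numbers `elem`
and the moduli up to `Q`. -/
structure Answers (W₀ v τ : ℕ) (p : Program) (n g Q : ℕ) (elem : ℕ → ℕ) : Prop where
  one_le : 1 ≤ v
  le_word : v ≤ W₀
  maxVar_le : p.maxVar ≤ v
  run : ∀ (q : ℕ) (hq : 0 < q) (hg : 0 < g), q ≤ Q → ∀ F : ℕ → ℕ, ∃ t σ,
    Run W₀ p (alignmentInput (inst n q g hq hg F elem)) t σ ∧ t ≤ τ ∧ ∃ i j l : ℕ,
      σ.var 0 = i ∧ σ.var 1 = j ∧ (inst n q g hq hg F elem).IsOptimal i j l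

/-- The sizes of the numbers in the reduction. -/
structure Sizes (W B W₀ n g Q S U : ℕ) (elem : ℕ → ℕ) : Prop where
  roomy : Roomy W B
  two_mul_le : 2 * B ≤ W
  word_le : W₀ ≤ B
  two_le : 2 ≤ g
  table_le : (Q * (g * g)) * (Q * (g * g)) ≤ W₀
  string_le : n * g ≤ W₀
  stride : 2 * W₀ + 1 ≤ S
  elem_le : ∀ i, elem i ≤ U
  elem_pos : ∀ i, 0 < elem i ↔ i < n
  pow_lt : (g + 1) * (2 * U) < 2 ^ g

/-- Some sum of two of the numbers is the chosen number in its residue class. -/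
def HasMatch (n q : ℕ) (elem F : ℕ → ℕ) : Prop :=
  ∃ a < n, ∃ b < n, elem a + elem b = F ((elem a + elem b) % q)

def callSolver (p : Program) : Program :=
  .seq writeInstance (.seq p.shift readAnswer)

/-- The positivity tests replace range checks: array 0 is zero past the elements, so a positive
entry has an index below `n`. -/
theorem eval_checkExpr {s : State} {q x y : ℕ} {F : ℕ → ℕ} (hq : 0 < q) (h9 : s.var 9 = q)
    (hF : ∀ r : ℕ, r < q → s.arr 2 r = F r) (hx : s.var 18 = x) (hy : s.var 19 = y) :
    checkExpr.eval s ≠ 0 ↔ 0 < x ∧ 0 < y ∧ x + y = F ((x + y) % q) := by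
  have := hF ((x + y) % q) (Nat.mod_lt _ hq)
  simp only [checkExpr, Expr.eval, Op.eval, h9, hx, hy]
  rw [Int.natCast_mod, Nat.cast_add] at this
  rw [this, ← Nat.cast_add]
  simp only [Nat.cast_inj, Nat.cast_pos]
  split_ifs <;> simp <;> tauto

-- The equality is tested on the numbers that the answer points to, so a raised flag is right for
-- any answer. Optimality is used only to find a match when there is one.
open Classical in
theorem wp_callSolver {n g q Q K S W₀ v τ U : ℕ} {elem F : ℕ → ℕ} {p : Program}
    (hsz : Sizes W B W₀ n g Q S U elem) (hp : Answers W₀ v τ p n g Q elem) {s : State}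
    (hs : s.BoundedBy B) (hq : 0 < q) (hqQ : q ≤ Q) (hset : Setup n g Q K S elem s)
    (h9 : s.var 9 = q) (hfresh : Fresh W₀ s) (hF : ∀ r : ℕ, r < q → s.arr 2 r = F r)
    (hFU : ∀ r, F r ≤ U) (h7 : 0 ≤ s.var 7) (h7B : s.var 7 + S ≤ B) :
    Wp W B (callSolver p) ((n * g + (Q * (g * g)) * (Q * (g * g)) + 1) * 360 + 4 * τ)
      (fun s' => s'.var 7 = s.var 7 + S ∧ Fresh W₀ s' ∧
        s'.var 1 = if HasMatch n q elem F then 1 else s.var 1) s := by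
  have hg : 0 < g := by have := hsz.two_le; omega
  have hWB := hsz.roomy
  have hmm : (q * (g * g)) * (q * (g * g)) ≤ (Q * (g * g)) * (Q * (g * g)) := by gcongr
  have hv := hp.one_le
  have hvW := hp.le_word
  have hB2 := hWB.two_le
  refine Wp.seq (T₂ := 4 * τ + 60) (wp_writeInstance hWB hs hq hg hset h9 hfresh hF hp.le_word
    (hmm.trans hsz.table_le) hsz.string_le hsz.word_le).frame ?_ (by
      have := Nat.mul_le_mul_right 300 hmm
      nlinarith)
  rintro s₁ hs₁ ⟨⟨hrep, e7, hz⟩, hv₁, ha₁⟩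
  obtain ⟨t, σ, hrun, ht, i, j, l, hi, hj, hopt⟩ := hp.run q hq hg hqQ F
  obtain ⟨t', s₂, hrun', ht', hs₂, hv₂, hrep', habove⟩ :=
    hrun.shift hsz.word_le hp.le_word hsz.two_mul_le hp.maxVar_le s₁ hrep hs₁
  have hQ₁ : Wp W B p.shift (4 * τ) (fun s' => s₂ = s') s₁ := ⟨t', s₂, hrun', by omega, hs₂, rfl⟩
  refine Wp.seq (T₂ := 60) hQ₁ ?_ le_rfl
  rintro _ _ rfl
  have hlow : ∀ A, A < 7 → s₂.arr A = s.arr A := fun A hA => by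
    rw [hrun'.frame.2 A fun h => by have := h.seven_le_of_shift; omega]
    refine ha₁ A ?_
    simp [writeInstance, Program.WritesArr, forLoop]
    omega
  have hvar : ∀ x, x < 14 → s₂.var x = s.var x := fun x hx => by
    rw [hv₂]
    refine hv₁ x ?_
    simp [writeInstance, Program.AssignsVar, forLoop]
    omega
  have hset₂ : Setup n g Q K S elem s₂ := hset.congr (fun x hx => hvar x (by omega)) (hlow 0 (by decide))
  have r0 : s₂.arr 7 (s₂.var 7) = i := by
    have := hrep'.var 0 (by omega)
    simpa [hi] using this
  have r1 : s₂.arr 7 (s₂.var 7 + 1) = j := by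
    have := hrep'.var 1 (by omega)
    simpa [hj] using this
  have hxB : ∀ i, |(elem i : ℤ)| ≤ B := fun i => by rw [← hset₂.a0 i]; exact hs₂.2 0 _
  have hdiv : ∀ i : ℕ, s₂.arr 0 ((i : ℤ) / g) = elem (i / g) := fun i => by
    rw [← hset₂.a0, Int.natCast_div]
  unfold readAnswer
  refine Wp.assign_seq (T₂ := 48) hs₂ (hWB.fits hs₂ rfl) (elem (i / g)) ?_ (hxB _) (fun hs₃ => ?_)
    (by simp [Expr.cost])
  · simp [Expr.eval, Op.eval, r0, hset₂.v2, hdiv]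
  refine Wp.assign_seq (T₂ := 38) hs₃ (hWB.fits hs₃ rfl) (elem (j / g)) ?_ (hxB _) (fun hs₄ => ?_)
    (by simp [Expr.cost])
  · simp [Expr.eval, Op.eval, State.setVar_var, r1, hset₂.v2, hdiv]
  generalize hs₄e : (s₂.setVar 18 (elem (i / g))).setVar 19 (elem (j / g)) = s₄ at hs₄
  have a₄ : s₄.arr = s₂.arr := by rw [← hs₄e]; rfl
  have v₄ : ∀ x, x < 18 → s₄.var x = s₂.var x := fun x hx => by
    rw [← hs₄e, State.setVar_var, State.setVar_var, if_neg (by omega), if_neg (by omega)]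
  have hcheck := eval_checkExpr (s := s₄) (q := q) (x := elem (i / g)) (y := elem (j / g)) (F := F)
    hq (by rw [v₄ 9 (by decide), hvar 9 (by decide), h9])
    (fun r hr => by rw [a₄, hlow 2 (by decide), hF r hr])
    (by rw [← hs₄e]; simp [State.setVar_var]) (by rw [← hs₄e]; simp [State.setVar_var])
  have hiff : checkExpr.eval s₄ ≠ 0 ↔ HasMatch n q elem F := by
    rw [hcheck, hsz.elem_pos, hsz.elem_pos]
    refine ⟨fun ⟨h1, h2, h3⟩ => ⟨_, h1, _, h2, h3⟩, fun ⟨a, ha, b, hb, hab⟩ => ?_⟩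
    -- A sum is at most `2 * U` and a pick at most `U`, hence the factor 2 in `Sizes.pow_lt`.
    refine solution_of_isOptimal hsz.two_le hsz.pow_lt (fun x y => ?_) ha hb hab hopt
    have h1 := hsz.elem_le x
    have h2 := hsz.elem_le y
    have h3 := hFU ((elem x + elem y) % q)
    rw [abs_le]
    push_cast
    omega
  refine Wp.seq (T₁ := 25) (T₂ := 4) (Q₁ := fun s₅ => s₅.arr = s₂.arr ∧
    (∀ x, x ≠ 1 → s₅.var x = s₄.var x) ∧
    s₅.var 1 = if HasMatch n q elem F then 1 else s.var 1) ?_ ?_ (by omega)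
  · refine Wp.cond (T₁ := 2) (hWB.fits hs₄ rfl) (fun h => ?_) (fun h => ?_)
      (by simp [checkExpr, Expr.cost])
    · refine Wp.assign hs₄ (hWB.fits hs₄ rfl) (by simp [Expr.cost])
        (by simp [Expr.eval]; omega) ⟨a₄, fun x hx => by simp [State.setVar_var, hx], ?_⟩
      rw [if_pos (hiff.1 h)]
      simp [State.setVar_var, Expr.eval]
    · refine Wp.skip hs₄ (by omega) ⟨a₄, fun _ _ => rfl, ?_⟩
      rw [if_neg fun h' => hiff.2 h' h, v₄ 1 (by decide), hvar 1 (by decide)]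
  · rintro s₅ hs₅ ⟨a₅, v₅, h₅⟩
    have w7 : s₅.var 7 = s.var 7 := by
      rw [v₅ 7 (by decide), v₄ 7 (by decide), hvar 7 (by decide)]
    have w6 : s₅.var 6 = S := by rw [v₅ 6 (by decide), v₄ 6 (by decide), hset₂.v6]
    have hval : (Expr.var 7 +ₑ .var 6).eval s₅ = s.var 7 + S := by
      simp [Expr.eval, Op.eval, w7, w6]
    refine Wp.assign hs₅ (hWB.fits hs₅ rfl) (by simp [Expr.cost])
      (by rw [hval, abs_le]; omega) ?_
    rw [hval]
    refine ⟨by simp [State.setVar_var], fun A hA z hz' => ?_, ?_⟩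
    -- The stride exceeds `2 * W₀`, so the next zone begins above everything that this call could
    -- have touched.
    · have hst := hsz.stride
      simp only [State.setVar_var, if_true] at hz'
      rw [State.setVar_arr, a₅, habove A z (by rw [e7]; omega)]
      exact hz A hA z (by omega)
    · simpa [State.setVar_var] using h₅

end WordRAM

/-! ### Passes, rounds and the exhaustion of the candidate sums -/

namespace WordRAM

open Program (forLoop)

variable {W B : ℕ}

/-- A round of the reduction, which halves the list. -/
def round (p : Program) : Program :=
  .seq selectModulus (forLoop 13 4 (.seq passOnce (callSolver p)))

def rounds (p : Program) : Program :=
  forLoop 11 2 (round p)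

/-- Some sum of two of the numbers is one of the numbers. -/
def HasTriple (n : ℕ) (elem : ℕ → ℕ) : Prop :=
  ∃ a < n, ∃ b < n, ∃ c < n, elem a + elem b = elem c

/-- The state after some calls of the subroutine, when only the numbers in the list are left as
possible sums. -/
structure Progress (W₀ n g Q K S : ℕ) (elem : ℕ → ℕ) (l : List ℕ) (calls : ℕ) (s : State) :
    Prop where
  setup : Setup n g Q K S elem s
  holds : HoldsList l s
  nodup : l.Nodup
  mem : ∀ x ∈ l, ∃ c < n, elem c = x
  v7 : s.var 7 = (S * (1 + calls) : ℕ)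
  fresh : Fresh W₀ s
  v1 : s.var 1 = 0 ∨ s.var 1 = 1
  sound : s.var 1 = 1 → HasTriple n elem
  complete : s.var 1 = 0 → ∀ a < n, ∀ b < n, ∀ c < n, elem a + elem b = elem c → elem c ∈ l

theorem Progress.congr {W₀ n g Q K S : ℕ} {elem : ℕ → ℕ} {l : List ℕ} {calls : ℕ} {s s' : State}
    (h : Progress W₀ n g Q K S elem l calls s) (hv : ∀ x, x ≤ 8 → s'.var x = s.var x)
    (ha : ∀ A, A ≠ 2 → s'.arr A = s.arr A) : Progress W₀ n g Q K S elem l calls s' where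
  setup := h.setup.congr (fun x hx => hv x (by omega)) (ha 0 (by decide))
  holds := h.holds.congr (hv 8 le_rfl) (ha 1 (by decide))
  nodup := h.nodup
  mem := h.mem
  v7 := (hv 7 (by decide)).trans h.v7
  fresh A hA z hz := by
    rw [hv 7 (by decide)] at hz
    rw [ha A (by omega)]
    exact h.fresh A hA z hz
  v1 := by rw [hv 1 (by decide)]; exact h.v1
  sound := by rw [hv 1 (by decide)]; exact h.sound
  complete := by rw [hv 1 (by decide)]; exact h.complete

theorem Progress.setVar {W₀ n g Q K S : ℕ} {elem : ℕ → ℕ} {l : List ℕ} {calls : ℕ} {s : State}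
    (h : Progress W₀ n g Q K S elem l calls s) {x : ℕ} (hx : 8 < x) (v : ℤ) :
    Progress W₀ n g Q K S elem l calls (s.setVar x v) :=
  h.congr (fun y hy => by rw [State.setVar_var, if_neg (by omega)]) fun _ _ => rfl

theorem Progress.length_le {W₀ n g Q K S : ℕ} {elem : ℕ → ℕ} {l : List ℕ} {calls : ℕ} {s : State}
    (h : Progress W₀ n g Q K S elem l calls s) : l.length ≤ n := by
  classical
  rw [← List.toFinset_card_of_nodup h.nodup]
  calc l.toFinset.card ≤ ((Finset.range n).image elem).card := by
        refine Finset.card_le_card fun x hx => ?_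
        obtain ⟨c, hc, rfl⟩ := h.mem x (by simpa using hx)
        exact Finset.mem_image_of_mem _ (by simpa using hc)
    _ ≤ n := Finset.card_image_le.trans (by simp)

/-- Time bound for the treatment of one residue system. -/
def stepTime (n g Q τ : ℕ) : ℕ :=
  (Q + n + 2) * 40 + ((n * g + (Q * (g * g)) * (Q * (g * g)) + 1) * 360 + 4 * τ)

/-- A candidate leaves the list only when `F` picks it. If the flag is still 0 after the call, no
pick is a sum of two elements, so no valid sum has been lost. -/
theorem wp_step {n g q Q K S W₀ v τ U calls : ℕ} {elem : ℕ → ℕ} {p : Program}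
    (hsz : Sizes W B W₀ n g Q S U elem) (hp : Answers W₀ v τ p n g Q elem) {s : State}
    (hs : s.BoundedBy B) (hq : 0 < q) (hqQ : q ≤ Q) {l : List ℕ}
    (hpr : Progress W₀ n g Q K S elem l calls s) (h9 : s.var 9 = q)
    (hcB : S * (calls + 2) ≤ B) :
    Wp W B (.seq passOnce (callSolver p)) (stepTime n g Q τ) (fun s' => ∃ rest F,
      IsPass q l rest F ∧ Progress W₀ n g Q K S elem rest (calls + 1) s' ∧ s'.var 9 = q) s := by
  classical
  have hpos : ∀ x ∈ l, 0 < x := fun x hx => by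
    obtain ⟨c, hc, rfl⟩ := hpr.mem x hx
    exact (hsz.elem_pos c).2 hc
  refine Wp.seq (T₁ := (Q + n + 2) * 40)
    ((wp_passOnce hsz.roomy hs hq hpr.holds h9 hpos).weaken (by have := hpr.length_le; gcongr)
      fun _ _ h => h).frame ?_ le_rfl
  rintro s₁ hs₁ ⟨⟨rest, F, hpass, hrest, hF⟩, hv₁, ha₁⟩
  have hv₁' : ∀ x, x ≤ 7 ∨ x = 9 → s₁.var x = s.var x := fun x hx => by
    refine hv₁ x ?_
    simp [passOnce, Program.AssignsVar, forLoop]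
    omega
  have ha₁' : ∀ A, A ≠ 1 → A ≠ 2 → s₁.arr A = s.arr A := fun A h1 h2 => by
    refine ha₁ A ?_
    simp [passOnce, Program.WritesArr, forLoop]
    omega
  have hFU : ∀ r, F r ≤ U := fun r => by
    rcases hpass.eq_zero_or_mem r with h | h
    · omega
    · obtain ⟨c, _, hc⟩ := hpr.mem _ h
      rw [← hc]
      exact hsz.elem_le c
  have hset₁ : Setup n g Q K S elem s₁ :=
    hpr.setup.congr (fun x hx => hv₁' x (by omega)) (ha₁' 0 (by decide) (by decide))
  have hfresh₁ : Fresh W₀ s₁ := fun A hA z hz => by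
    rw [hv₁' 7 (by decide)] at hz
    rw [ha₁' A (by omega) (by omega)]
    exact hpr.fresh A hA z hz
  have h7 : s₁.var 7 = (S * (1 + calls) : ℕ) := (hv₁' 7 (by decide)).trans hpr.v7
  have h9' : s₁.var 9 = q := (hv₁' 9 (by decide)).trans h9
  refine (wp_callSolver hsz hp hs₁ hq hqQ hset₁ h9' hfresh₁ hF hFU (by rw [h7]; positivity)
    (by
      rw [h7]
      have : S * (calls + 2) = S * (1 + calls) + S := by ring
      rw [this] at hcB
      exact_mod_cast hcB)).frame.weaken le_rfl ?_
  rintro s₂ - ⟨⟨e7, hfr, e1⟩, hv₂, ha₂⟩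
  have hv₂' : ∀ x, x ≠ 1 → x ≠ 7 → x ≤ 13 → s₂.var x = s₁.var x := fun x h1 h7 h13 => by
    refine hv₂ x ?_
    simp [callSolver, writeInstance, readAnswer, Program.AssignsVar, forLoop,
      Program.not_assignsVar_shift]
    omega
  have ha₂' : ∀ A, A < 7 → s₂.arr A = s₁.arr A := fun A hA => by
    refine ha₂ A fun h => ?_
    simp only [callSolver, Program.WritesArr] at h
    rcases h with h | h | h
    · simp [writeInstance, Program.WritesArr, forLoop] at h; omega
    · have := h.seven_le_of_shift; omega
    · simp [readAnswer, Program.WritesArr] at h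
  have h1 : s₁.var 1 = s.var 1 := hv₁' 1 (by decide)
  rw [h1] at e1
  refine ⟨rest, F, hpass, ?_, (hv₂' 9 (by decide) (by decide) (by decide)).trans h9'⟩
  refine
    { setup := hset₁.congr (fun x hx => hv₂' x (by omega) (by omega) (by omega))
        (ha₂' 0 (by decide))
      holds := hrest.congr (hv₂' 8 (by decide) (by decide) (by decide)) (ha₂' 1 (by decide))
      nodup := hpr.nodup.sublist hpass.sublist
      mem := fun x hx => hpr.mem x (hpass.sublist.subset hx)
      v7 := by rw [e7, h7]; push_cast; ring
      fresh := hfr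
      v1 := ?_
      sound := ?_
      complete := ?_ }
  · rw [e1]; split_ifs
    · exact .inr rfl
    · exact hpr.v1
  · intro h
    by_cases hm : HasMatch n q elem F
    · obtain ⟨a, ha, b, hb, hab⟩ := hm
      -- The default value 0 of `F` cannot cause a false match, since elements are positive.
      rcases hpass.eq_zero_or_mem ((elem a + elem b) % q) with h0 | h0
      · have := (hsz.elem_pos a).2 ha
        omega
      · obtain ⟨c, hc, hcF⟩ := hpr.mem _ h0
        exact ⟨a, ha, b, hb, c, hc, hab.trans hcF.symm⟩
    · rw [e1, if_neg hm] at h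
      exact hpr.sound h
  · intro h a ha b hb c hc habc
    have hm : ¬ HasMatch n q elem F := fun hm => by rw [e1, if_pos hm] at h; omega
    rw [e1, if_neg hm] at h
    rcases hpass.cover _ (hpr.complete h a ha b hb c hc habc) with h' | h'
    · exact h'
    · exact absurd ⟨a, ha, b, hb, by rw [habc]; exact h'.symm⟩ hm

/-- The invariant equates overflow at capacity `j` after `k` passes with overflow of the old list at
`j + k`. For `j = 0` and `k = K` the left side is the remaining length, and the selected modulus is
at least as good as the one from `hhalf`. -/
theorem wp_round {n g Q K S W₀ v τ U calls : ℕ} {elem : ℕ → ℕ} {p : Program}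
    (hsz : Sizes W B W₀ n g Q S U elem) (hp : Answers W₀ v τ p n g Q elem) (hQ : 0 < Q) {s : State}
    (hs : s.BoundedBy B) {l : List ℕ} (hpr : Progress W₀ n g Q K S elem l calls s)
    (hcB : S * (calls + K + 1) ≤ B)
    (hhalf : ∃ q, 0 < q ∧ q ≤ Q ∧ 2 * overflow K q l ≤ l.length) :
    Wp W B (round p) ((Q + 1) * (Q + n + 2) * 60 + (K + 1) * (stepTime n g Q τ + 8))
      (fun s' => ∃ l', Progress W₀ n g Q K S elem l' (calls + K) s' ∧
        2 * l'.length ≤ l.length) s := by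
  refine Wp.seq (T₁ := (Q + 1) * (Q + n + 2) * 60) ((wp_selectModulus hsz.roomy hs hQ hpr.holds
    hpr.setup.v3 hpr.setup.v4).weaken (by have := hpr.length_le; gcongr)
      fun _ _ h => h).frame ?_ le_rfl
  rintro s₁ hs₁ ⟨⟨q, h9, hq, hqQ, hmin⟩, hv₁, ha₁⟩
  have hpr₁ : Progress W₀ n g Q K S elem l calls s₁ := by
    refine hpr.congr (fun x hx => hv₁ x ?_) (fun A hA => ha₁ A ?_)
    · simp [selectModulus, countLoads, Program.AssignsVar, forLoop]; omega
    · simp [selectModulus, countLoads, Program.WritesArr, forLoop]; omega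
  have hbody : ∀ x, x = 13 ∨ x = 4 → ¬ (Program.seq passOnce (callSolver p)).AssignsVar x := by
    intro x hx
    simp [callSolver, writeInstance, readAnswer, Program.AssignsVar, forLoop, passOnce,
      Program.not_assignsVar_shift]
    omega
  refine (Wp.forLoop (N := K) (T := stepTime n g Q τ) hsz.roomy hs₁
    (fun k s' => ∃ l', Progress W₀ n g Q K S elem l' (calls + k) s' ∧ s'.var 9 = q ∧
      ∀ j, overflow j q l' = overflow (j + k) q l) hpr₁.setup.v4 (by decide) (hbody 13 (by simp))
      (hbody 4 (by simp)) ?_ ?_).weaken le_rfl ?_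
  · exact ⟨l, hpr₁.setVar (by decide) _, by simpa [State.setVar_var] using h9, fun j => rfl⟩
  · rintro k hk s' hs' hi - - ⟨l', hpr', h9', hov⟩
    refine (wp_step hsz hp hs' hq hqQ hpr' h9' ((Nat.mul_le_mul_left S (by omega)).trans hcB)).weaken le_rfl ?_
    rintro s₂ - ⟨rest, F, hpass, hpr₂, h9₂⟩
    refine ⟨rest, hpr₂.setVar (by decide) _, by simpa [State.setVar_var] using h9₂, fun j => ?_⟩
    rw [hpass.overflow_eq, hov]
    congr 1; ring
  · rintro s' - ⟨⟨l', hpr', -, hov⟩, -⟩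
    refine ⟨l', hpr', ?_⟩
    obtain ⟨q', h1, h2, h3⟩ := hhalf
    have := hov 0
    rw [overflow_zero hq, zero_add] at this
    have := hmin q' h1 h2
    omega

/-- After `k` rounds the length times `2 ^ k` is at most `n`. For `k = g` the list is empty, and a
flag that is still 0 excludes every triple. -/
theorem wp_rounds {n g Q K S W₀ v τ U : ℕ} {elem : ℕ → ℕ} {p : Program}
    (hsz : Sizes W B W₀ n g Q S U elem) (hp : Answers W₀ v τ p n g Q elem) (hQ : 0 < Q) {s : State}
    (hs : s.BoundedBy B) {l : List ℕ} (hpr : Progress W₀ n g Q K S elem l 0 s)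
    (hcB : S * (g * K + 1) ≤ B) (hng : n < 2 ^ g)
    (hhalf : ∀ l : List ℕ, l.Nodup → (∀ x ∈ l, x ≤ U) → l.length ≤ n →
      ∃ q, 0 < q ∧ q ≤ Q ∧ 2 * overflow K q l ≤ l.length) :
    Wp W B (rounds p)
      ((g + 1) * ((Q + 1) * (Q + n + 2) * 60 + (K + 1) * (stepTime n g Q τ + 8) + 8))
      (fun s' => (s'.var 1 = 0 ∨ s'.var 1 = 1) ∧ (s'.var 1 = 1 ↔ HasTriple n elem)) s := by
  have hbody : ∀ x, x = 11 ∨ x = 2 → ¬ (round p).AssignsVar x := by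
    intro x hx
    simp [round, selectModulus, countLoads, callSolver, writeInstance, readAnswer,
      Program.AssignsVar, forLoop, passOnce, Program.not_assignsVar_shift]
    omega
  refine (Wp.forLoop (N := g) hsz.roomy hs
    (fun k s' => ∃ l', Progress W₀ n g Q K S elem l' (k * K) s' ∧ l'.length * 2 ^ k ≤ n)
    hpr.setup.v2 (by decide) (hbody 11 (by simp)) (hbody 2 (by simp)) ?_ ?_).weaken le_rfl ?_
  · refine ⟨l, ?_, by simpa using hpr.length_le⟩
    simpa using hpr.setVar (by decide) _
  · rintro k hk s' hs' hi - - ⟨l', hpr', hlen⟩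
    refine (wp_round hsz hp hQ hs' hpr' (le_trans ?_ hcB) (hhalf l' hpr'.nodup (fun x hx => ?_)
      hpr'.length_le)).weaken le_rfl ?_
    · have : (k + 1) * K ≤ g * K := Nat.mul_le_mul_right K hk
      gcongr
      linarith
    · obtain ⟨c, _, rfl⟩ := hpr'.mem x hx
      exact hsz.elem_le c
    · rintro s₂ - ⟨l₂, hpr₂, hlen₂⟩
      refine ⟨l₂, ?_, ?_⟩
      · have := hpr₂.setVar (x := 11) (by decide) ((k + 1 : ℕ) : ℤ)
        rwa [show k * K + K = (k + 1) * K by ring] at this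
      · calc l₂.length * 2 ^ (k + 1) = 2 * l₂.length * 2 ^ k := by ring
          _ ≤ l'.length * 2 ^ k := by gcongr
          _ ≤ n := hlen
  · rintro s' - ⟨⟨l', hpr', hlen⟩, -⟩
    refine ⟨hpr'.v1, hpr'.sound, fun ⟨a, ha, b, hb, c, hc, h⟩ => ?_⟩
    rcases hpr'.v1 with h1 | h1
    · exfalso
      have hmem := hpr'.complete h1 a ha b hb c hc h
      have := List.length_pos_of_mem hmem
      have : 1 * 2 ^ g ≤ l'.length * 2 ^ g := Nat.mul_le_mul_right _ this
      omega
    · exact h1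

end WordRAM

/-! ## The reduction: initialization, and small instances -/

namespace WordRAM

local infixl:65 " +ₑ " => Expr.bin Op.add
local infixl:70 " *ₑ " => Expr.bin Op.mul
local infixl:50 " <ₑ " => Expr.bin Op.lt
local infixl:50 " =ₑ " => Expr.bin Op.eq

open Program (forLoop)

variable {W B : ℕ}

theorem Expr.cost_pow (e : Expr) : ∀ k, (e.pow k).cost = k * (e.cost + 1) + 1
  | 0 => by simp [pow, cost]
  | k + 1 => by simp only [pow, cost, cost_pow e k]; ring

/-- Stores the integral part of the `b`-th root of variable `0` in variable `2`. -/
def computeRoot (b : ℕ) : Program :=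
  .seq (.assign 2 (.lit 0))
    (forLoop 14 0 (.cond (.var 0 <ₑ (Expr.var 14 +ₑ .lit 1).pow b) .skip
      (.assign 2 (.var 14 +ₑ .lit 1))))

/-- Linear search is affordable here. The degree of the comparison grows with `b`, so the fixed
degree 24 of `Roomy` is replaced by `D`. -/
theorem wp_computeRoot {b D g n : ℕ} (hWB : Roomy W B) (hW : B ^ D ≤ W) (hD : 2 * b + 2 ≤ D)
    (hb : 0 < b) (hg : g ^ b ≤ n) (hg' : n < (g + 1) ^ b) {s : State} (hs : s.BoundedBy B)
    (h0 : s.var 0 = n) :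
    Wp W B (computeRoot b) ((n + 1) * (4 * b + 20)) (fun s' => s'.var 2 = g) s := by
  have hB2 := hWB.two_le
  have hnB : (n : ℤ) ≤ B := by
    have := hs.1 0
    rwa [h0, Nat.abs_cast] at this
  refine Wp.assign_seq (T₂ := (n + 1) * (4 * b + 18)) hs (hWB.fits hs rfl) 0 rfl (by simp)
    (fun hs₁ => ?_) (by simp [Expr.cost]; nlinarith)
  refine (Wp.forLoop (N := n) (T := 4 * b + 10) hWB hs₁
    (fun k s' => s'.var 2 = (min k g : ℕ))
    (by simpa [State.setVar_var] using h0) (by decide) (by simp [Program.AssignsVar])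
    (by simp [Program.AssignsVar]) (by simp [State.setVar_var]) ?_).weaken le_rfl ?_
  · intro k hk s' hs' hi hv ha hInv
    have v0 : s'.var 0 = n := by
      rw [hv 0 (by decide) (by simp [Program.AssignsVar])]
      simpa [State.setVar_var] using h0
    have hcond : (Expr.var 0 <ₑ (Expr.var 14 +ₑ .lit 1).pow b).eval s' =
        if n < (k + 1) ^ b then 1 else 0 := by
      simp only [Expr.eval, Op.eval, Expr.eval_pow, v0, hi]
      exact if_congr (by exact_mod_cast Iff.rfl) rfl rfl
    refine Wp.cond (T₁ := 4) ?_ (fun h => ?_) (fun h => ?_)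
      (by simp only [Expr.cost, Expr.cost_pow]; omega)
    · refine Expr.fits_of_isPlain hB2 hs' _ ?_ ((Nat.pow_le_pow_right (by omega) ?_).trans hW)
      · simp [Expr.isPlain, Op.isArith, Expr.isPlain_pow]
      · simp only [Expr.deg, Expr.deg_pow, max_self]; omega
    · rw [hcond] at h
      have h' : n < (k + 1) ^ b := by by_contra h'; simp [h'] at h
      have : g < k + 1 := lt_of_pow_lt_pow_left₀ b (by omega) (hg.trans_lt h')
      refine Wp.skip hs' (by omega) ?_
      rw [State.setVar_var, if_neg (by decide), hInv]
      congr 1; omega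
    · rw [hcond] at h
      have h' : (k + 1) ^ b ≤ n := by by_contra h'; simp at h; omega
      have : k + 1 < g + 1 := lt_of_pow_lt_pow_left₀ b (by omega) (h'.trans_lt hg')
      have hval : (Expr.var 14 +ₑ .lit 1).eval s' = (k + 1 : ℕ) := by
        simp [Expr.eval, Op.eval, hi]
      refine Wp.assign hs' (hWB.fits hs' rfl) (by simp [Expr.cost])
        (by rw [hval, Nat.abs_cast]; omega) ?_
      rw [hval]
      simp only [State.setVar_var]
      rw [if_neg (by decide), if_true]
      congr 1; omega
  · rintro s' - ⟨h, -⟩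
    have : g ≤ n := (Nat.le_self_pow hb.ne' g).trans hg
    rw [h]
    congr 1; omega

/-- The initialization of the reduction. -/
def prepare (a b k e : ℕ) : Program :=
  .seq (computeRoot b)
    (.seq (.assign 3 ((Expr.var 2).pow a))
      (.seq (.assign 4 ((Expr.var 2).pow k))
        (.seq (.assign 5 (.var 0 *ₑ .var 2))
          (.seq (.assign 6 ((Expr.var 5 +ₑ .lit 2).pow e))
            (.seq (.assign 7 (.var 6))
              (.seq (forLoop 14 0 (.store 1 (.var 14) (.get 0 (.var 14))))
                (.seq (.assign 8 (.var 0)) (.assign 1 (.lit 0)))))))))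

theorem wp_prepare {a b k e D g n W₀ : ℕ} {elem : ℕ → ℕ} (hWB : Roomy W B) (hW : B ^ D ≤ W)
    (hD : 2 * b + a + k + 2 * e + 2 ≤ D) (hb : 0 < b) (hg : g ^ b ≤ n) (hg' : n < (g + 1) ^ b)
    {s : State} (hs : s.BoundedBy B) (h0 : s.var 0 = n) (ha : ∀ i : ℕ, s.arr 0 i = elem i)
    (harr : ∀ A, 7 ≤ A → ∀ z, s.arr A z = 0) (hinj : ∀ i < n, ∀ j < n, elem i = elem j → i = j)
    (hQB : g ^ a ≤ B) (hKB : g ^ k ≤ B) (hNB : n * g ≤ B) (hSB : (n * g + 2) ^ e ≤ B) :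
    Wp W B (prepare a b k e) ((n + 1) * (4 * b + 2 * a + 2 * k + 4 * e + 60))
      (fun s' => ∃ l, Progress W₀ n g (g ^ a) (g ^ k) ((n * g + 2) ^ e) elem l 0 s') s := by
  have hB2 := hWB.two_le
  have hnB : (n : ℤ) ≤ B := by
    have := hs.1 0
    rwa [h0, Nat.abs_cast] at this
  have hfits : ∀ {s : State} {e : Expr}, s.BoundedBy B → e.isPlain → e.deg ≤ D → e.Fits W s :=
    fun hs he hd => Expr.fits_of_isPlain hB2 hs _ he ((Nat.pow_le_pow_right (by omega) hd).trans hW)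
  refine Wp.seq (T₂ := 2 * a + 2 * k + 4 * e + (n + 1) * 12 + 25) (wp_computeRoot hWB hW (by omega)
    hb hg hg' hs h0).frame ?_ (by nlinarith)
  rintro s₁ hs₁ ⟨h2, hv₁, ha₁⟩
  have w0 : s₁.var 0 = n := (hv₁ 0 (by simp [computeRoot, Program.AssignsVar, forLoop])).trans h0
  have ha₁' : ∀ A, s₁.arr A = s.arr A :=
    fun A => ha₁ A (by simp [computeRoot, Program.WritesArr, forLoop])
  refine Wp.assign_seq (T₂ := 2 * k + 4 * e + (n + 1) * 12 + 22) hs₁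
    (hfits hs₁ (Expr.isPlain_pow rfl a) (by simp only [Expr.deg_pow, Expr.deg]; omega))
    (g ^ a : ℕ) (by rw [Expr.eval_pow]; simp [Expr.eval, h2]) (by rw [Nat.abs_cast]; omega)
    (fun hs₂ => ?_) (by simp only [Expr.cost_pow, Expr.cost]; omega)
  refine Wp.assign_seq (T₂ := 4 * e + (n + 1) * 12 + 19) hs₂
    (hfits hs₂ (Expr.isPlain_pow rfl k) (by simp only [Expr.deg_pow, Expr.deg]; omega))
    (g ^ k : ℕ) (by rw [Expr.eval_pow]; simp [Expr.eval, State.setVar_var, h2])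
    (by rw [Nat.abs_cast]; omega)
    (fun hs₃ => ?_) (by simp only [Expr.cost_pow, Expr.cost]; omega)
  refine Wp.assign_seq (T₂ := 4 * e + (n + 1) * 12 + 15) hs₃ (hWB.fits hs₃ rfl) (n * g : ℕ)
    (by simp [Expr.eval, Op.eval, State.setVar_var, h2, w0]) (by rw [Nat.abs_cast]; omega)
    (fun hs₄ => ?_) (by simp [Expr.cost]; omega)
  refine Wp.assign_seq (T₂ := (n + 1) * 12 + 12) hs₄
    (hfits hs₄ (Expr.isPlain_pow rfl e) (by simp only [Expr.deg_pow, Expr.deg, max_self]; omega))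
    ((n * g + 2) ^ e : ℕ) (by rw [Expr.eval_pow]; simp [Expr.eval, Op.eval, State.setVar_var])
    (by rw [Nat.abs_cast]; omega) (fun hs₅ => ?_) (by simp only [Expr.cost_pow, Expr.cost]; omega)
  refine Wp.assign_seq (T₂ := (n + 1) * 12 + 8) hs₅ (hWB.fits hs₅ rfl) ((n * g + 2) ^ e : ℕ)
    (by simp [Expr.eval, State.setVar_var]) (by rw [Nat.abs_cast]; omega) (fun hs₆ => ?_)
    (by simp [Expr.cost]; omega)
  generalize hse : (((((s₁.setVar 3 (g ^ a : ℕ)).setVar 4 (g ^ k : ℕ)).setVar 5 (n * g : ℕ)).setVar 6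
    ((n * g + 2) ^ e : ℕ)).setVar 7 ((n * g + 2) ^ e : ℕ)) = s₆ at hs₆
  have z0 : s₆.var 0 = n := by rw [← hse]; simp [State.setVar_var, w0]
  have z2 : s₆.var 2 = g := by rw [← hse]; simp [State.setVar_var, h2]
  have z3 : s₆.var 3 = (g ^ a : ℕ) := by rw [← hse]; simp [State.setVar_var]
  have z4 : s₆.var 4 = (g ^ k : ℕ) := by rw [← hse]; simp [State.setVar_var]
  have z5 : s₆.var 5 = (n * g : ℕ) := by rw [← hse]; simp [State.setVar_var]
  have z6 : s₆.var 6 = ((n * g + 2) ^ e : ℕ) := by rw [← hse]; simp [State.setVar_var]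
  have z7 : s₆.var 7 = ((n * g + 2) ^ e : ℕ) := by rw [← hse]; simp [State.setVar_var]
  have za : ∀ A, s₆.arr A = s.arr A := fun A => by rw [← hse]; exact ha₁' A
  refine Wp.seq (T₂ := 5) (Wp.fill hWB hs₆ 0 (fun z => elem z.toNat) z0 (by decide) (fun i _ => ?_)
    rfl rfl ?_) ?_ (by simp [Expr.cost])
  · have := hs.2 0 i
    rw [ha i] at this
    simpa using this
  · intro i _ s' hi hv' ha'
    have := ha i
    simp [Expr.eval, hi, ha' 0 (by decide), za, this]
  rintro s₇ hs₇ ⟨c1, hv₇, ha₇⟩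
  refine Wp.assign_seq (T₂ := 2) hs₇ (hWB.fits hs₇ rfl) n
    (by simp [Expr.eval, hv₇ 0 (by decide), z0]) (by rwa [Nat.abs_cast]) (fun hs₈ => ?_)
    (by simp [Expr.cost])
  refine Wp.assign hs₈ (hWB.fits hs₈ rfl) (by simp [Expr.cost]) (by simp [Expr.eval]) ?_
  refine ⟨(List.range n).map elem, ?_⟩
  refine
    { setup := ⟨?_, ?_, ?_, ?_, ?_, ?_, ?_⟩
      holds := ⟨?_, ?_⟩
      nodup := ?_
      mem := ?_
      v7 := ?_
      fresh := ?_
      v1 := ?_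
      sound := ?_
      complete := ?_ }
  · simp [State.setVar_var, hv₇ 0, z0]
  · simp [State.setVar_var, hv₇ 2, z2]
  · simp [State.setVar_var, hv₇ 3, z3]
  · simp [State.setVar_var, hv₇ 4, z4]
  · simp [State.setVar_var, hv₇ 5, z5]
  · simp [State.setVar_var, hv₇ 6, z6]
  · intro i
    rw [State.setVar_arr, State.setVar_arr, ha₇ 0 (by decide), za, ha]
  · simp [State.setVar_var]
  · intro j hj
    have hj' : j < n := by simpa using hj
    rw [State.setVar_arr, State.setVar_arr, c1, if_pos (by omega)]
    simp
  · refine List.Nodup.map_on (fun i hi j hj h => ?_) List.nodup_range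
    exact hinj i (List.mem_range.1 hi) j (List.mem_range.1 hj) h
  · intro x hx
    obtain ⟨i, hi, rfl⟩ := List.mem_map.1 hx
    exact ⟨i, List.mem_range.1 hi, rfl⟩
  · simp [State.setVar_var, hv₇ 7, z7]
  · intro A hA z _
    rw [State.setVar_arr, State.setVar_arr, ha₇ A (by omega), za, harr A hA]
  · left; simp [State.setVar_var, Expr.eval]
  · intro h; simp [State.setVar_var, Expr.eval] at h
  · intro _ _ _ _ _ c hc _
    exact List.mem_map.2 ⟨c, List.mem_range.2 hc, rfl⟩

/-- Variable `1` tells whether `P` holds. -/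
def Flag (P : Prop) (s : State) : Prop :=
  (s.var 1 = 0 ∨ s.var 1 = 1) ∧ (s.var 1 = 1 ↔ P)

/-- Accumulates a disjunction in the flag. The body must work for an arbitrary previous meaning
`P'`, so that the rule can be applied to nested loops. -/
theorem wp_anyLoop {i y N T : ℕ} {body : Program} {s : State} (hWB : Roomy W B)
    (hs : s.BoundedBy B) (hN : s.var y = N) (hiy : y ≠ i) (hi1 : i ≠ 1)
    (hi : ¬ body.AssignsVar i) (hy : ¬ body.AssignsVar y) {P : Prop} (R : ℕ → Prop) (h0 : Flag P s)
    (hstep : ∀ k < N, ∀ s', s'.BoundedBy B → s'.var i = (k : ℤ) →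
      (∀ x, x ≠ i → ¬ body.AssignsVar x → s'.var x = s.var x) →
      (∀ A, ¬ body.WritesArr A → s'.arr A = s.arr A) → ∀ P', Flag P' s' →
      Wp W B body T (Flag (P' ∨ R k)) s') :
    Wp W B (forLoop i y body) ((N + 1) * (T + 8)) (Flag (P ∨ ∃ k < N, R k)) s := by
  have hset : ∀ {P' : Prop} {s' : State} {v : ℤ}, Flag P' s' → Flag P' (s'.setVar i v) := by
    intro P' s' v h
    unfold Flag
    rwa [State.setVar_var, if_neg (Ne.symm hi1)]
  refine (Wp.forLoop hWB hs (fun k => Flag (P ∨ ∃ k' < k, R k')) hN hiy hi hy ?_ ?_).weaken le_rfl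
    fun _ _ h => h.1
  · exact hset (by simpa using h0)
  · intro k hk s' hs' hi' hv ha hf
    refine (hstep k hk s' hs' hi' hv ha _ hf).weaken le_rfl fun s₂ _ h => hset ?_
    have : (P ∨ ∃ k' < k + 1, R k') ↔ (P ∨ ∃ k' < k, R k') ∨ R k := by
      simp only [Nat.lt_succ_iff_lt_or_eq, or_and_right, exists_or, exists_eq_left, or_assoc]
    rwa [this]

/-- Tries all triples. -/
def bruteForce : Program :=
  .seq (.assign 1 (.lit 0)) (forLoop 11 0 (forLoop 12 0 (forLoop 13 0
    (.cond (.get 0 (.var 11) +ₑ .get 0 (.var 12) =ₑ .get 0 (.var 13)) (.assign 1 (.lit 1)) .skip))))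

theorem wp_bruteForce {n : ℕ} {elem : ℕ → ℕ} (hWB : Roomy W B) {s : State} (hs : s.BoundedBy B)
    (h0 : s.var 0 = n) (ha : ∀ i : ℕ, s.arr 0 i = elem i) :
    Wp W B bruteForce (2 + (n + 1) * ((n + 1) * ((n + 1) * 20 + 8) + 8))
      (Flag (HasTriple n elem)) s := by
  have hB2 := hWB.two_le
  refine Wp.assign_seq (T₂ := (n + 1) * ((n + 1) * ((n + 1) * 20 + 8) + 8)) hs (hWB.fits hs rfl) 0
    rfl (by simp) (fun hs₁ => ?_) (by simp [Expr.cost])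
  refine (wp_anyLoop hWB hs₁ (N := n) (by simpa [State.setVar_var] using h0) (by decide) (by decide)
    (by simp [Program.AssignsVar, forLoop]) (by simp [Program.AssignsVar, forLoop]) (P := False)
    (fun a => ∃ b < n, ∃ c < n, elem a + elem b = elem c) (by simp [Flag, State.setVar_var])
    (T := (n + 1) * ((n + 1) * 20 + 8)) ?_).weaken le_rfl fun _ _ h => by
      simpa [HasTriple] using h
  intro a ha' s₂ hs₂ hi₂ hv₂ ha₂ P₂ hP₂
  refine wp_anyLoop hWB hs₂ (N := n) ?_ (by decide) (by decide)
    (by simp [Program.AssignsVar, forLoop]) (by simp [Program.AssignsVar, forLoop])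
    (fun b => ∃ c < n, elem a + elem b = elem c) hP₂ (T := (n + 1) * 20) ?_
  · rw [hv₂ 0 (by decide) (by simp [Program.AssignsVar, forLoop])]
    simpa [State.setVar_var] using h0
  intro b hb s₃ hs₃ hi₃ hv₃ ha₃ P₃ hP₃
  refine wp_anyLoop hWB hs₃ (N := n) ?_ (by decide) (by decide)
    (by simp [Program.AssignsVar]) (by simp [Program.AssignsVar])
    (fun c => elem a + elem b = elem c) hP₃ (T := 12) ?_
  · rw [hv₃ 0 (by decide) (by simp [Program.AssignsVar, forLoop]),
      hv₂ 0 (by decide) (by simp [Program.AssignsVar, forLoop])]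
    simpa [State.setVar_var] using h0
  intro c hc s₄ hs₄ hi₄ hv₄ ha₄ P₄ hP₄
  have v11 : s₄.var 11 = a := by
    rw [hv₄ 11 (by decide) (by simp [Program.AssignsVar]),
      hv₃ 11 (by decide) (by simp [Program.AssignsVar, forLoop]), hi₂]
  have v12 : s₄.var 12 = b := by
    rw [hv₄ 12 (by decide) (by simp [Program.AssignsVar]), hi₃]
  have a0 : ∀ i : ℕ, s₄.arr 0 i = elem i := fun i => by
    rw [ha₄ 0 (by simp [Program.WritesArr]), ha₃ 0 (by simp [Program.WritesArr, forLoop]),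
      ha₂ 0 (by simp [Program.WritesArr, forLoop]), State.setVar_arr, ha]
  have hcond : (Expr.get 0 (.var 11) +ₑ .get 0 (.var 12) =ₑ .get 0 (.var 13)).eval s₄ =
      if elem a + elem b = elem c then 1 else 0 := by
    simp only [Expr.eval, Op.eval, v11, v12, hi₄, a0]
    exact if_congr (by exact_mod_cast Iff.rfl) rfl rfl
  refine Wp.cond (T₁ := 2) (hWB.fits hs₄ rfl) (fun h => ?_) (fun h => ?_) (by simp [Expr.cost])
  · rw [hcond] at h
    have h' : elem a + elem b = elem c := by by_contra h'; simp [h'] at h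
    refine Wp.assign hs₄ (hWB.fits hs₄ rfl) (by simp [Expr.cost]) (by simp [Expr.eval]; omega) ?_
    simp [Flag, State.setVar_var, Expr.eval, h']
  · rw [hcond] at h
    have h' : elem a + elem b ≠ elem c := fun h' => by simp [h'] at h
    refine Wp.skip hs₄ (by omega) ?_
    simpa [h'] using hP₄

end WordRAM

namespace WordRAM

local infixl:50 " <ₑ " => Expr.bin Op.lt

open Program (forLoop)

/-! ## The reduction: the whole program -/

variable {W B : ℕ}

/-- The algorithm for 3SUM that uses the algorithm `p` for Local Alignment. -/
def threeSumProgram (p : Program) (a b k e n₀ : ℕ) : Program :=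
  .cond (.var 0 <ₑ .lit n₀) (.seq bruteForce (.assign 0 (.var 1)))
    (.seq (prepare a b k e) (.seq (rounds p) (.assign 0 (.var 1))))

/-- Time bound for large instances. -/
def mainTime (a b k e g n τ : ℕ) : ℕ :=
  (n + 1) * (4 * b + 2 * a + 2 * k + 4 * e + 60) +
    (g + 1) * ((g ^ a + 1) * (g ^ a + n + 2) * 60 +
      (g ^ k + 1) * (stepTime n g (g ^ a) τ + 8) + 8) + 6

/-- Time bound for small instances. -/
def smallTime (n : ℕ) : ℕ :=
  8 + (n + 1) * ((n + 1) * ((n + 1) * 20 + 8) + 8)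

open Classical in
theorem wp_output (hWB : Roomy W B) {P : Prop} {s : State} (hs : s.BoundedBy B) (h : Flag P s) :
    Wp W B (.assign 0 (.var 1)) 2 (fun s' => s'.var 0 = if P then 1 else 0) s := by
  refine Wp.assign hs (hWB.fits hs rfl) (by simp [Expr.cost]) (hs.1 1) ?_
  simp only [State.setVar_var, Expr.eval, if_true]
  rcases h.1 with h1 | h1
  · rw [if_neg fun hP => by rw [h.2.2 hP] at h1; omega, h1]
  · rw [if_pos (h.2.1 h1), h1]

/-- The threshold `n₀` may exceed 2 and then is not a plain literal, so this comparison is checked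
by hand. -/
theorem fits_lt_lit {n₀ : ℕ} (hWB : Roomy W B) {s : State} (hs : s.BoundedBy B) (hn₀ : n₀ ≤ W) :
    (Expr.var 0 <ₑ .lit n₀).Fits W s := by
  have h1 : 1 ≤ W := (Nat.one_le_pow _ _ (by have := hWB.two_le; omega)).trans hWB.pow_le
  refine ⟨hWB.fits hs rfl, ?_, ?_⟩
  · change |(n₀ : ℤ)| ≤ W
    rw [Nat.abs_cast]; omega
  · simp only [Op.eval]
    split_ifs <;> simp; omega

open Classical in
theorem wp_small {a b k e n n₀ : ℕ} {elem : ℕ → ℕ} {p : Program} (hWB : Roomy W B) (hn₀ : n₀ ≤ W)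
    (hn : n < n₀) {s : State} (hs : s.BoundedBy B) (h0 : s.var 0 = n)
    (ha : ∀ i : ℕ, s.arr 0 i = elem i) :
    Wp W B (threeSumProgram p a b k e n₀) (smallTime n)
      (fun s' => s'.var 0 = if HasTriple n elem then 1 else 0) s := by
  refine Wp.cond (T₁ := smallTime n - 4) (fits_lt_lit hWB hs hn₀) (fun h => ?_) (fun h => ?_)
    (by simp [Expr.cost, smallTime]; omega)
  · exact Wp.seq (wp_bruteForce hWB hs h0 ha) (fun s' hs' h => wp_output hWB hs' h)
      (by simp [smallTime]; omega)
  · simp [Expr.eval, Op.eval, h0] at h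
    omega

open Classical in
theorem wp_large {a b k e n n₀ g W₀ v τ U D : ℕ} {elem : ℕ → ℕ} {p : Program} (hW : B ^ D ≤ W)
    (hD : 2 * b + a + k + 2 * e + 2 ≤ D) (hn₀ : n₀ ≤ W) (hn : n₀ ≤ n) (hb : 0 < b)
    (hsz : Sizes W B W₀ n g (g ^ a) ((n * g + 2) ^ e) U elem)
    (hp : Answers W₀ v τ p n g (g ^ a) elem) (hg : g ^ b ≤ n) (hg' : n < (g + 1) ^ b) {s : State}
    (hs : s.BoundedBy B) (h0 : s.var 0 = n) (ha : ∀ i : ℕ, s.arr 0 i = elem i)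
    (harr : ∀ A, 7 ≤ A → ∀ z, s.arr A z = 0) (hinj : ∀ i < n, ∀ j < n, elem i = elem j → i = j)
    (hQB : g ^ a ≤ B) (hcB : (n * g + 2) ^ e * (g * g ^ k + 1) ≤ B) (hng : n < 2 ^ g)
    (hhalf : ∀ l : List ℕ, l.Nodup → (∀ x ∈ l, x ≤ U) → l.length ≤ n →
      ∃ q, 0 < q ∧ q ≤ g ^ a ∧ 2 * overflow (g ^ k) q l ≤ l.length) :
    Wp W B (threeSumProgram p a b k e n₀) (mainTime a b k e g n τ)
      (fun s' => s'.var 0 = if HasTriple n elem then 1 else 0) s := by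
  have hg0 : 0 < g := by have := hsz.two_le; omega
  have hSB : (n * g + 2) ^ e ≤ B := le_trans (Nat.le_mul_of_pos_right _ (Nat.succ_pos _)) hcB
  have hKB : g ^ k ≤ B := by
    calc g ^ k ≤ 1 * (g * g ^ k + 1) := by nlinarith [Nat.zero_le (g ^ k)]
      _ ≤ (n * g + 2) ^ e * (g * g ^ k + 1) := by
        gcongr
        exact Nat.one_le_pow _ _ (by omega)
      _ ≤ B := hcB
  refine Wp.cond (T₁ := mainTime a b k e g n τ - 4) (fits_lt_lit hsz.roomy hs hn₀) (fun h => ?_)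
    (fun h => ?_) (by simp [Expr.cost, mainTime]; omega)
  · simp [Expr.eval, Op.eval, h0] at h
    omega
  · refine Wp.seq (wp_prepare (W₀ := W₀) hsz.roomy hW hD hb hg hg' hs h0 ha harr hinj hQB hKB
      (hsz.string_le.trans hsz.word_le) hSB) ?_
      (T₂ := mainTime a b k e g n τ - 4 - (n + 1) * (4 * b + 2 * a + 2 * k + 4 * e + 60))
      (by simp [mainTime]; omega)
    rintro s₁ hs₁ ⟨l, hl⟩
    exact Wp.seq (wp_rounds hsz hp (by positivity) hs₁ hl hcB hng hhalf)
      (fun s' hs' h => wp_output hsz.roomy hs' h) (by simp [mainTime]; omega)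

/-- Every term is a power of `g` with exponent at most `2 b - 1`. With `a + k = b + 3`, writing the
strings (`k + b + 2`) requires `6 ≤ a`, and writing the score tables (`k + 2 a + 5`) requires `a + 9
≤ b`. -/
theorem mainTime_le (a b k e P C : ℕ) (hP : 1 ≤ P) (hak : a + k = b + 3) (ha : 6 ≤ a)
    (hab : a + 9 ≤ b) : ∃ C', ∀ g n τ : ℕ, 1 ≤ g → n ≤ P * g ^ b →
      g * g ^ k * τ ≤ C * g ^ (2 * b - 1) →
      mainTime a b k e g n τ ≤ C' * g ^ (2 * b - 1) := by
  refine ⟨2 * P * (4 * b + 2 * a + 2 * k + 4 * e + 60) + 960 * P + 640 * P + 360 * (4 * P + 8) +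
    16 * C + 54, fun g n τ hg hn hτ => ?_⟩
  have pw : ∀ i, i ≤ 2 * b - 1 → g ^ i ≤ g ^ (2 * b - 1) := fun i hi => Nat.pow_le_pow_right hg hi
  have g1 : ∀ i, 1 ≤ g ^ i := fun i => Nat.one_le_pow _ _ hg
  have hab' : g ^ a ≤ g ^ b := Nat.pow_le_pow_right hg (by omega)
  have hPb : g ^ b ≤ P * g ^ b := Nat.le_mul_of_pos_left _ hP
  have h1 : n + 1 ≤ 2 * P * g ^ b := by have := g1 b; nlinarith
  have h2 : g ^ a + n + 2 ≤ 4 * P * g ^ b := by have := g1 b; nlinarith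
  have h3 : g + 1 ≤ 2 * g := by omega
  have h4 : g ^ a + 1 ≤ 2 * g ^ a := by have := g1 a; omega
  have h5 : g ^ k + 1 ≤ 2 * g ^ k := by have := g1 k; omega
  have t0 : n + 1 ≤ 2 * P * g ^ (2 * b - 1) := h1.trans (Nat.mul_le_mul_left _ (pw b (by omega)))
  have t1 : (g + 1) * (g ^ a + 1) * (g ^ a + n + 2) ≤ 16 * P * g ^ (2 * b - 1) := by
    calc (g + 1) * (g ^ a + 1) * (g ^ a + n + 2) ≤ (2 * g) * (2 * g ^ a) * (4 * P * g ^ b) := by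
          gcongr
      _ = 16 * P * g ^ (a + b + 1) := by ring
      _ ≤ _ := Nat.mul_le_mul_left _ (pw _ (by omega))
  have t2 : (g + 1) * (g ^ k + 1) * (g ^ a + n + 2) ≤ 16 * P * g ^ (2 * b - 1) := by
    calc (g + 1) * (g ^ k + 1) * (g ^ a + n + 2) ≤ (2 * g) * (2 * g ^ k) * (4 * P * g ^ b) := by
          gcongr
      _ = 16 * P * g ^ (k + b + 1) := by ring
      _ ≤ _ := Nat.mul_le_mul_left _ (pw _ (by omega))
  have t3 : (g + 1) * (g ^ k + 1) * (n * g) ≤ 4 * P * g ^ (2 * b - 1) := by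
    calc (g + 1) * (g ^ k + 1) * (n * g) ≤ (2 * g) * (2 * g ^ k) * (P * g ^ b * g) := by
          gcongr
      _ = 4 * P * g ^ (k + b + 2) := by ring
      _ ≤ _ := Nat.mul_le_mul_left _ (pw _ (by omega))
  have t4 : (g + 1) * (g ^ k + 1) * ((g ^ a * (g * g)) * (g ^ a * (g * g))) ≤
      4 * g ^ (2 * b - 1) := by
    calc (g + 1) * (g ^ k + 1) * ((g ^ a * (g * g)) * (g ^ a * (g * g))) ≤
          (2 * g) * (2 * g ^ k) * ((g ^ a * (g * g)) * (g ^ a * (g * g))) := by gcongr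
      _ = 4 * g ^ (k + 2 * a + 5) := by ring
      _ ≤ _ := Nat.mul_le_mul_left _ (pw _ (by omega))
  have t5 : (g + 1) * (g ^ k + 1) * τ ≤ 4 * C * g ^ (2 * b - 1) := by
    calc (g + 1) * (g ^ k + 1) * τ ≤ (2 * g) * (2 * g ^ k) * τ := by gcongr
      _ = 4 * (g * g ^ k * τ) := by ring
      _ ≤ 4 * (C * g ^ (2 * b - 1)) := by gcongr
      _ = _ := by ring
  have t6 : (g + 1) * (g ^ k + 1) ≤ 4 * g ^ (2 * b - 1) := by
    calc (g + 1) * (g ^ k + 1) ≤ (2 * g) * (2 * g ^ k) := by gcongr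
      _ = 4 * g ^ (k + 1) := by ring
      _ ≤ _ := Nat.mul_le_mul_left _ (pw _ (by omega))
  have t7 : g + 1 ≤ 2 * g ^ (2 * b - 1) := h3.trans (by
    have := pw 1 (by omega)
    rw [pow_one] at this
    omega)
  have t8 := g1 (2 * b - 1)
  generalize g ^ (2 * b - 1) = M at *
  generalize hcp : 4 * b + 2 * a + 2 * k + 4 * e + 60 = cp
  have e1 : mainTime a b k e g n τ = (n + 1) * cp + 60 * ((g + 1) * (g ^ a + 1) * (g ^ a + n + 2)) +
      (40 * ((g + 1) * (g ^ k + 1) * (g ^ a + n + 2)) +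
        360 * ((g + 1) * (g ^ k + 1) * (n * g) +
          (g + 1) * (g ^ k + 1) * ((g ^ a * (g * g)) * (g ^ a * (g * g))) +
          (g + 1) * (g ^ k + 1)) + 4 * ((g + 1) * (g ^ k + 1) * τ)) +
      8 * ((g + 1) * (g ^ k + 1)) + 8 * (g + 1) + 6 := by
    rw [mainTime, stepTime, hcp]; ring
  have t0' := Nat.mul_le_mul_right cp t0
  rw [e1]
  have e2 : (2 * P * cp + 960 * P + 640 * P + 360 * (4 * P + 8) + 16 * C + 54) * M =
      2 * P * M * cp + 60 * (16 * P * M) + (40 * (16 * P * M) + 360 * (4 * P * M + 4 * M + 4 * M) +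
        4 * (4 * C * M)) + 8 * (4 * M) + 8 * (2 * M) + 6 * M := by ring
  rw [e2]
  omega

end WordRAM

/-! ## Choice of the parameters -/

/-- By `log g ≤ g` there are at least `g ^ (a - 1) / (8 a)` primes up to `g ^ a`. Since `a + k = b +
3`, the right side is at least `g ^ (b + 2) / (8 a)`, against at most `2 ^ (b + 1) * g ^ (b + 1)` on
the left; the spare factor `g` pays for the constants. -/
theorem two_mul_mul_le_pow_mul_primeCounting {a b k g n : ℕ} (ha : 1 ≤ a) (hak : a + k = b + 3)
    (hg4 : 4 ≤ g) (hg : 8 * a * 2 ^ (b + 1) ≤ g) (hn : n ≤ 2 ^ b * g ^ b) :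
    2 * n * g ≤ g ^ k * Nat.primeCounting (g ^ a) := by
  have h4 : 4 ≤ g ^ a := hg4.trans (Nat.le_self_pow (by omega) g)
  have h1 := le_primeCounting_mul_log h4
  have hlog : Real.log ((g ^ a : ℕ) : ℝ) ≤ a * g := by
    rw [Nat.cast_pow, Real.log_pow]
    exact mul_le_mul_of_nonneg_left (Real.log_le_self (Nat.cast_nonneg g)) (Nat.cast_nonneg a)
  have h2 : g ^ a ≤ 8 * Nat.primeCounting (g ^ a) * (a * g) := by
    have := h1.trans (mul_le_mul_of_nonneg_left hlog (by positivity))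
    exact_mod_cast this
  have hpos : 0 < 8 * a * g := by positivity
  refine Nat.le_of_mul_le_mul_left ?_ hpos
  calc 8 * a * g * (2 * n * g) = (8 * a * 2) * n * g ^ 2 := by ring
    _ ≤ (8 * a * 2) * (2 ^ b * g ^ b) * g ^ 2 := by gcongr
    _ = (8 * a * 2 ^ (b + 1)) * (g ^ b * g ^ 2) := by ring
    _ ≤ g * (g ^ b * g ^ 2) := by gcongr
    _ = g ^ (b + 3) := by ring
    _ = g ^ k * g ^ a := by rw [← hak]; ring
    _ ≤ g ^ k * (8 * Nat.primeCounting (g ^ a) * (a * g)) := by gcongr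
    _ = _ := by ring

theorem eventually_mul_pow_lt_two_pow (d : ℕ) :
    ∀ᶠ g : ℕ in Filter.atTop, (g + 1) * (2 * (g + 1) ^ d) < 2 ^ g := by
  have h := ((tendsto_pow_const_div_const_pow_of_one_lt (d + 1) (r := (2 : ℝ))
    one_lt_two).comp (Filter.tendsto_add_atTop_nat 1)).eventually (gt_mem_nhds
      (by norm_num : (0 : ℝ) < 1 / 4))
  filter_upwards [h] with g hg
  simp only [Function.comp] at hg
  rw [div_lt_iff₀ (by positivity), pow_succ (2 : ℝ)] at hg
  have : ((g + 1 : ℕ) : ℝ) * (2 * ((g + 1 : ℕ) : ℝ) ^ d) < 2 ^ g := by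
    rw [pow_succ] at hg; linarith
  exact_mod_cast this

/-- Take `a + 2` to be the floor of `(b + 1) (1 - δ)`, the largest choice that the alphabet permits.
In the last inequality `δ` cancels up to rounding, and what remains is a bounded error against `(b +
1) ε₁`, so a large `b` suffices. Capping `ε` at `1 - δ` keeps `η` nonnegative. -/
theorem exists_exponents {δ ε : ℝ} (hδ0 : 0 < δ) (hδ1 : δ < 1) (hε : 0 < ε) :
    ∃ (a b k : ℕ) (η : ℝ), a + k = b + 3 ∧ 6 ≤ a ∧ a + 9 ≤ b ∧ 0 ≤ η ∧ 2 - δ - ε ≤ η ∧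
      (a + 2 : ℝ) ≤ (b + 1) * (1 - δ) ∧ 1 + k + (b + 1) * η ≤ 2 * b - 1 := by
  set ε₁ := min ε (1 - δ) with hε₁
  have h1 : ε₁ ≤ ε := min_le_left _ _
  have h2 : ε₁ ≤ 1 - δ := min_le_right _ _
  have h3 : 0 < ε₁ := lt_min hε (by linarith)
  have h4 : 0 < min ε₁ δ := lt_min h3 hδ0
  obtain ⟨b, hb⟩ := exists_nat_ge (12 / min ε₁ δ)
  rw [div_le_iff₀ h4] at hb
  have hb1 : 12 ≤ b * ε₁ := hb.trans (by gcongr; exact min_le_left _ _)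
  have hb2 : 12 ≤ b * δ := hb.trans (by gcongr; exact min_le_right _ _)
  have hb3 : 12 ≤ b * (1 - δ) := hb1.trans (by gcongr)
  set x : ℝ := (b + 1) * (1 - δ) with hx
  have hx12 : 12 ≤ x := by nlinarith
  have hx2 : x ≤ b + 1 - 12 := by nlinarith
  have hf1 := Nat.floor_le (show 0 ≤ x by linarith)
  have hf2 := Nat.lt_floor_add_one x
  have hf3 : 12 ≤ ⌊x⌋₊ := Nat.le_floor (by exact_mod_cast hx12)
  obtain ⟨a, ha⟩ : ∃ a, ⌊x⌋₊ = a + 2 := ⟨⌊x⌋₊ - 2, by omega⟩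
  rw [ha] at hf1 hf2 hf3
  push_cast at hf1 hf2
  have hab : a + 9 ≤ b := by
    have : (a + 9 : ℝ) ≤ b := by linarith
    exact_mod_cast this
  obtain ⟨k, hk⟩ : ∃ k, a + k = b + 3 := ⟨b + 3 - a, by omega⟩
  have hkR : (a + k : ℝ) = b + 3 := by exact_mod_cast hk
  refine ⟨a, b, k, 2 - δ - ε₁, hk, by omega, hab, by linarith, by linarith, hf1, ?_⟩
  nlinarith

/-- The true exponent `γ` may be negative. It is first raised to `η ≥ 0`, so that the power is
monotone in the string length. -/
theorem exists_mul_time_le {b k : ℕ} {η c₀ γ : ℝ} {τ : ℕ → ℕ} {N₁ : ℕ} (hη : 0 ≤ η)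
    (hγ : γ ≤ η) (hb : 1 ≤ b) (hk : 1 + k + (b + 1) * η ≤ 2 * b - 1) (hc₀ : 0 ≤ c₀) (P : ℕ)
    (hτ : ∀ N, N₁ ≤ N → (τ N : ℝ) ≤ c₀ * (N : ℝ) ^ γ) :
    ∃ C : ℕ, ∀ g n : ℕ, 1 ≤ g → 1 ≤ n → N₁ ≤ n * g → n ≤ P * g ^ b →
      g * g ^ k * τ (n * g) ≤ C * g ^ (2 * b - 1) := by
  refine ⟨⌈c₀ * (P : ℝ) ^ η⌉₊, fun g n hg hn hN hnP => ?_⟩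
  have hg1 : (1 : ℝ) ≤ g := by exact_mod_cast hg
  have hN1 : (1 : ℝ) ≤ ((n * g : ℕ) : ℝ) := by exact_mod_cast Nat.mul_pos hn hg
  have h1 : (τ (n * g) : ℝ) ≤ c₀ * (P : ℝ) ^ η * (g : ℝ) ^ ((b + 1) * η) := by
    calc (τ (n * g) : ℝ) ≤ c₀ * ((n * g : ℕ) : ℝ) ^ γ := hτ _ hN
      _ ≤ c₀ * ((n * g : ℕ) : ℝ) ^ η := by gcongr
      _ ≤ c₀ * ((P : ℝ) * (g : ℝ) ^ (b + 1)) ^ η := by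
        gcongr
        have : n * g ≤ P * g ^ (b + 1) := by
          rw [pow_succ, ← mul_assoc]; exact Nat.mul_le_mul_right _ hnP
        exact_mod_cast this
      _ = c₀ * (P : ℝ) ^ η * (g : ℝ) ^ ((b + 1) * η) := by
        rw [Real.mul_rpow (by positivity) (by positivity), ← Real.rpow_natCast (g : ℝ) (b + 1),
          ← Real.rpow_mul (by positivity)]
        push_cast; ring
  have h2 : ((g * g ^ k * τ (n * g) : ℕ) : ℝ) ≤
      (⌈c₀ * (P : ℝ) ^ η⌉₊ * g ^ (2 * b - 1) : ℕ) := by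
    push_cast
    calc (g : ℝ) * g ^ k * τ (n * g)
        ≤ g * g ^ k * (c₀ * (P : ℝ) ^ η * (g : ℝ) ^ ((b + 1) * η)) := by gcongr
      _ = c₀ * (P : ℝ) ^ η * (g : ℝ) ^ (1 + k + (b + 1) * η) := by
        rw [Real.rpow_add (by positivity), Real.rpow_add (by positivity), Real.rpow_one,
          Real.rpow_natCast]
        ring
      _ ≤ ⌈c₀ * (P : ℝ) ^ η⌉₊ * (g : ℝ) ^ ((2 * b - 1 : ℕ) : ℝ) := by
        gcongr
        · exact Nat.le_ceil _
        · rw [Nat.cast_sub (by omega)]; push_cast; exact hk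
      _ = _ := by rw [Real.rpow_natCast]
  exact_mod_cast h2

/-! ### Assembling the 3SUM algorithm and the contradiction -/

namespace WordRAM

open ThreeSumAlignment

theorem answers_of_solver {σ : ℕ → ℝ} {κ K₀ W₀ v n g Q : ℕ} {p : Program} {τ : ℕ → ℕ}
    {elem : ℕ → ℕ} (hκ : 1 ≤ κ)
    (hrun : ∀ I : (localAlignment σ κ).Instance, ∃ (t : ℕ) (s : State),
      Run (((localAlignment σ κ).size I + 2) ^ K₀) p ((localAlignment σ κ).input I) t s ∧
        t ≤ τ ((localAlignment σ κ).size I) ∧ (localAlignment σ κ).Correct I s)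
    (hv : 1 ≤ v) (hpv : p.maxVar ≤ v) (hvW : v ≤ W₀) (hW₀ : (n * g + 2) ^ K₀ ≤ W₀)
    (hN : 1 ≤ n * g) (hσ : ((Q * (g * g) : ℕ) : ℝ) ≤ σ (n * g)) :
    Answers W₀ v (τ (n * g)) p n g Q elem where
  one_le := hv
  le_word := hvW
  maxVar_le := hpv
  run q hq hg hqQ F := by
    have hm : (((inst n q g hq hg F elem).m : ℕ) : ℝ) ≤ σ (inst n q g hq hg F elem).n := by
      refine le_trans ?_ hσ
      have : q * (g * g) ≤ Q * (g * g) := Nat.mul_le_mul_right _ hqQ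
      exact_mod_cast this
    have hs : ∀ x y, |(inst n q g hq hg F elem).score x y| ≤
        ((inst n q g hq hg F elem).n : ℤ) ^ κ := by
      intro x y
      refine (abs_score_le (N := n * g) hN x y).trans ?_
      exact le_self_pow₀ (by exact_mod_cast hN) (by omega)
    obtain ⟨t, s, hr, ht, i, j, l, hi, hj, -, hopt⟩ := hrun ⟨inst n q g hq hg F elem, hm, hs⟩
    exact ⟨t, s, Run.mono hW₀ hr, ht, i, j, l, hi, hj, hopt⟩

/-- The numbers of an instance, continued by zeros. -/
def _root_.ThreeSumInstance.number {c : ℕ} (I : ThreeSumInstance c) (i : ℕ) : ℕ :=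
  if h : i < I.n then I.elem ⟨i, h⟩ else 0

theorem number_le {c : ℕ} (I : ThreeSumInstance c) (i : ℕ) : I.number i ≤ I.n ^ c := by
  unfold ThreeSumInstance.number
  split_ifs with h
  · exact (Finset.mem_Icc.1 (I.mem_universe _)).2
  · exact Nat.zero_le _

theorem number_pos {c : ℕ} (I : ThreeSumInstance c) (i : ℕ) : 0 < I.number i ↔ i < I.n := by
  unfold ThreeSumInstance.number
  split_ifs with h
  · exact ⟨fun _ => h, fun _ => (Finset.mem_Icc.1 (I.mem_universe _)).1⟩
  · simp [h]

theorem number_injOn {c : ℕ} (I : ThreeSumInstance c) :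
    ∀ i < I.n, ∀ j < I.n, I.number i = I.number j → i = j := by
  intro i hi j hj h
  unfold ThreeSumInstance.number at h
  rw [dif_pos hi, dif_pos hj] at h
  simpa using I.injective h

theorem hasTriple_number_iff {c : ℕ} (I : ThreeSumInstance c) :
    HasTriple I.n I.number ↔ I.HasSolution := by
  have key : ∀ {i} (h : i < I.n), I.number i = I.elem ⟨i, h⟩ := fun h => dif_pos h
  constructor
  · rintro ⟨a, ha, b, hb, c, hc, h⟩
    rw [key ha, key hb, key hc] at h
    exact ⟨_, ⟨_, rfl⟩, _, ⟨_, rfl⟩, _, ⟨_, rfl⟩, h⟩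
  · rintro ⟨_, ⟨⟨a, ha⟩, rfl⟩, _, ⟨⟨b, hb⟩, rfl⟩, _, ⟨⟨c, hc⟩, rfl⟩, h⟩
    rw [← key ha, ← key hb, ← key hc] at h
    exact ⟨a, ha, b, hb, c, hc, h⟩

theorem input_arr_zero {c : ℕ} (I : ThreeSumInstance c) (i : ℕ) :
    ((threeSum c).input I).arr 0 i = I.number i := by
  simp only [threeSum, if_true, arrayOf, ThreeSumInstance.number]
  by_cases h : i < I.n
  · simp [h]
  · simp [h]

theorem boundedBy_input {c B : ℕ} (I : ThreeSumInstance c) (hn : I.n ≤ B) (hc : I.n ^ c ≤ B) :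
    ((threeSum c).input I).BoundedBy B := by
  refine ⟨fun x => ?_, fun A i => ?_⟩
  · simp only [threeSum]
    split_ifs <;> simp [hn]
  · simp only [threeSum]
    split_ifs
    · unfold arrayOf
      split_ifs with h
      · rw [Nat.abs_cast]
        exact_mod_cast (Finset.mem_Icc.1 (I.mem_universe _)).2.trans hc
      · simp
    · simp

/-- The word sizes in the reduction, all of them polynomial in `n`. -/
theorem sizes_of_le {a b c e n g K₁ β D K' n₀ B W : ℕ} {I : ThreeSumInstance c} (hI : I.n = n)
    (hg2 : 2 ≤ g) (hgn : g ≤ n) (hK₁ : 4 ≤ K₁) (he : e = K₁ + 2) (hab : a + 2 ≤ b + 1)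
    (hgb : g ^ b ≤ n) (hβ : 2 * K₁ + 2 ≤ β) (hD : 24 ≤ D) (hB : B = (n + 2) ^ β)
    (hK' : K' = β * D + n₀) (hW : W = (n + 2) ^ K')
    (hlt : (g + 1) * (2 * n ^ c) < 2 ^ g) :
    Sizes W B ((n * g + 2) ^ K₁) n g (g ^ a) ((n * g + 2) ^ e) (n ^ c) I.number := by
  have hM : n * g + 2 ≤ (n + 2) ^ 2 := by nlinarith
  have hB2 : 2 ≤ B := by
    rw [hB]
    exact le_trans (by omega) (Nat.le_self_pow (by omega) (n + 2))
  have hBW : B ^ 24 ≤ W := by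
    rw [hB, hW, ← pow_mul]
    refine Nat.pow_le_pow_right (by omega) ?_
    rw [hK']
    exact le_trans (Nat.mul_le_mul_left _ hD) (Nat.le_add_right _ _)
  refine ⟨⟨hB2, hBW⟩, ?_, ?_, hg2, ?_, ?_, ?_, ?_, ?_, hlt⟩
  · calc 2 * B ≤ B * B := Nat.mul_le_mul_right _ hB2
      _ = B ^ 2 := by ring
      _ ≤ B ^ 24 := Nat.pow_le_pow_right (by omega) (by omega)
      _ ≤ W := hBW
  · calc (n * g + 2) ^ K₁ ≤ ((n + 2) ^ 2) ^ K₁ := Nat.pow_le_pow_left hM _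
      _ = (n + 2) ^ (2 * K₁) := by rw [← pow_mul]
      _ ≤ B := by rw [hB]; exact Nat.pow_le_pow_right (by omega) (by omega)
  · have h1 : g ^ a * (g * g) ≤ n * g + 2 := by
      calc g ^ a * (g * g) = g ^ (a + 2) := by ring
        _ ≤ g ^ (b + 1) := Nat.pow_le_pow_right (by omega) hab
        _ = g ^ b * g := pow_succ _ _
        _ ≤ n * g := Nat.mul_le_mul_right _ hgb
        _ ≤ _ := Nat.le_add_right _ _
    calc _ ≤ (n * g + 2) * (n * g + 2) := Nat.mul_le_mul h1 h1
      _ = (n * g + 2) ^ 2 := by ring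
      _ ≤ _ := Nat.pow_le_pow_right (by omega) (by omega)
  · exact (Nat.le_add_right _ 2).trans (Nat.le_self_pow (by omega) _)
  · have h1 : 1 ≤ (n * g + 2) ^ K₁ := Nat.one_le_pow _ _ (by omega)
    have h2 : 2 ^ 2 ≤ (n * g + 2) ^ 2 := Nat.pow_le_pow_left (by omega) 2
    rw [he, pow_add]
    nlinarith
  · exact fun i => hI ▸ number_le I i
  · exact fun i => hI ▸ number_pos I i

-- The order of quantifiers matters: `ε' = 1 / b` is fixed before `c`, because the hypothesis
-- returns a universe exponent that depends on `ε'`. Only the threshold and the word sizes depend on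
-- `c`.
open Classical in
theorem threeSum_solvable {δ ε : ℝ} {κ : ℕ} (hδ0 : 0 < δ) (hδ1 : δ < 1) (hε : 0 < ε) (hκ : 1 ≤ κ)
    (h : (localAlignment (fun n => 1 * (n : ℝ) ^ (1 - δ) * Real.log n ^ 0) κ).SolvableInTime
      (fun n => (n : ℝ) ^ (2 - δ - ε))) :
    ∃ ε' : ℝ, 0 < ε' ∧ ∀ c, (threeSum c).SolvableInTime (fun n => (n : ℝ) ^ (2 - ε')) := by
  obtain ⟨p, K₀, τ, hO, hrun⟩ := h
  obtain ⟨c₀, hc₀, hO⟩ := hO.exists_pos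
  rw [Asymptotics.IsBigOWith, Filter.eventually_atTop] at hO
  obtain ⟨N₁, hN₁⟩ := hO
  have hτ : ∀ N, N₁ ≤ N → (τ N : ℝ) ≤ c₀ * (N : ℝ) ^ (2 - δ - ε) := fun N hN => by
    have := hN₁ N hN
    rwa [Real.norm_of_nonneg (Nat.cast_nonneg _), Real.norm_of_nonneg (by positivity)] at this
  obtain ⟨a, b, k, η, hak, ha, hab, hη0, hη, haδ, hkη⟩ := exists_exponents hδ0 hδ1 hε
  have hb : 0 < b := by omega
  have hbR : (0 : ℝ) < b := by exact_mod_cast hb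
  refine ⟨1 / b, by positivity, fun c => ?_⟩
  obtain ⟨C₁, hC₁⟩ := exists_mul_time_le hη0 hη hb hkη hc₀.le (2 ^ b) hτ
  obtain ⟨v, hv⟩ : ∃ v, v = max p.maxVar 1 := ⟨_, rfl⟩
  -- The summand `v` makes the zone contain all variable slots, as `v ≤ 2 ^ v`.
  obtain ⟨K₁, hK₁⟩ : ∃ K₁, K₁ = K₀ + v + 4 := ⟨_, rfl⟩
  obtain ⟨e, he⟩ : ∃ e, e = K₁ + 2 := ⟨_, rfl⟩
  obtain ⟨C', hC'⟩ := mainTime_le a b k e (2 ^ b) C₁ Nat.one_le_two_pow hak ha hab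
  -- The exponent `b * c + b` covers both the universe bound `n ^ c` and `n` itself, as `n < (g + 1)
  -- ^ b`.
  obtain ⟨G₁, hG₁⟩ := Filter.eventually_atTop.1 (eventually_mul_pow_lt_two_pow (b * c + b))
  obtain ⟨G₀, hG₀⟩ : ∃ G₀, G₀ = G₁ + N₁ + 8 * a * 2 ^ (b + 1) + 4 := ⟨_, rfl⟩
  obtain ⟨n₀, hn₀⟩ : ∃ n₀, n₀ = G₀ ^ b := ⟨_, rfl⟩
  obtain ⟨D, hD⟩ : ∃ D, D = 24 + (2 * b + a + k + 2 * e + 2) := ⟨_, rfl⟩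
  obtain ⟨β, hβ⟩ : ∃ β, β = 2 * K₁ + a + 2 * e + k + 2 + c + 2 := ⟨_, rfl⟩
  have hroot : ∀ n, ∃ g, g ^ b ≤ n ∧ n < (g + 1) ^ b := fun n => by
    refine ⟨Nat.findGreatest (fun g => g ^ b ≤ n) n, ?_, ?_⟩
    · exact Nat.findGreatest_spec (P := fun g => g ^ b ≤ n) (Nat.zero_le n)
        (by rw [zero_pow hb.ne']; exact Nat.zero_le n)
    · by_contra! hcon
      have h1 := Nat.le_findGreatest (P := fun g => g ^ b ≤ n)
        ((Nat.le_self_pow hb.ne' _).trans hcon) hcon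
      omega
  choose G hGle hGlt using hroot
  have hGbig : ∀ n, n₀ ≤ n → G₀ ≤ G n := fun n hn => by
    have h1 : G₀ ^ b < (G n + 1) ^ b := (hn₀ ▸ hn).trans_lt (hGlt n)
    have := lt_of_pow_lt_pow_left₀ b (Nat.zero_le _) h1
    omega
  have hGself : ∀ n, G n ≤ n := fun n => (Nat.le_self_pow hb.ne' _).trans (hGle n)
  have hG2 : ∀ n, 1 ≤ G n → n ≤ 2 ^ b * G n ^ b := fun n h1 => by
    rw [← mul_pow]
    exact (hGlt n).le.trans (Nat.pow_le_pow_left (by omega) b)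
  have hfin : ∀ n, n₀ ≤ n → mainTime a b k e (G n) n (τ (n * G n)) ≤ C' * G n ^ (2 * b - 1) := by
    intro n hn
    have h1 := hGbig n hn
    have h2 := hGself n
    refine hC' _ _ _ (by omega) (hG2 n (by omega)) (hC₁ _ _ (by omega) (by omega) ?_
      (hG2 n (by omega)))
    exact le_trans (by omega) (Nat.le_mul_of_pos_left (G n) (by omega : 0 < n))
  -- The summand `n₀` lets the literal `n₀` fit into a word even for the smallest inputs, because
  -- `n₀ ≤ 2 ^ n₀`.
  refine ⟨threeSumProgram p a b k e n₀, β * D + n₀,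
    fun n => if n < n₀ then smallTime n else mainTime a b k e (G n) n (τ (n * G n)), ?_, ?_⟩
  · refine Asymptotics.IsBigO.of_bound C' ?_
    filter_upwards [Filter.eventually_ge_atTop n₀] with n hn
    rw [if_neg (by omega), Real.norm_of_nonneg (Nat.cast_nonneg _),
      Real.norm_of_nonneg (by positivity)]
    have h1 := hGbig n hn
    have h2 : ((G n : ℕ) : ℝ) ^ b ≤ n := by exact_mod_cast hGle n
    have h3 : ((G n : ℕ) : ℝ) ^ (2 * b - 1) ≤ (n : ℝ) ^ (2 - 1 / (b : ℝ)) := by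
      calc ((G n : ℕ) : ℝ) ^ (2 * b - 1) = (((G n : ℕ) : ℝ) ^ b) ^ (2 - 1 / (b : ℝ)) := by
            rw [← Real.rpow_natCast, ← Real.rpow_natCast, ← Real.rpow_mul (Nat.cast_nonneg _),
              Nat.cast_sub (by omega)]
            congr 1
            push_cast
            field_simp
        _ ≤ _ := by
            refine Real.rpow_le_rpow (by positivity) h2 ?_
            have : 1 / (b : ℝ) ≤ 1 := by
              rw [div_le_one hbR]; exact_mod_cast hb
            linarith
    calc ((mainTime a b k e (G n) n (τ (n * G n)) : ℕ) : ℝ) ≤ C' * (G n : ℝ) ^ (2 * b - 1) := by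
          exact_mod_cast hfin n hn
      _ ≤ _ := by gcongr
  · intro (I : ThreeSumInstance c)
    obtain ⟨n, hn⟩ : ∃ n, I.n = n := ⟨_, rfl⟩
    have hcorrect : ∀ s : State, (s.var 0 = if HasTriple n I.number then 1 else 0) →
        (threeSum c).Correct I s := fun s hs => by
      change s.var 0 = _
      rw [hs, ← hn]
      simp only [hasTriple_number_iff]
    have hsize : (threeSum c).size I = n := hn
    rw [hsize]
    have hMpos : 1 ≤ n + 2 := by omega
    have hnB : n ≤ (n + 2) ^ β :=
      le_trans (by omega) (Nat.le_self_pow (by omega) (n + 2))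
    have hcB : n ^ c ≤ (n + 2) ^ β :=
      (Nat.pow_le_pow_left (by omega) c).trans (Nat.pow_le_pow_right hMpos (by omega))
    have hs : ((threeSum c).input I).BoundedBy ((n + 2) ^ β) :=
      boundedBy_input I (hn.le.trans hnB) (by rw [hn]; exact hcB)
    have h0 : ((threeSum c).input I).var 0 = n := by simp [threeSum, hn]
    have hBD : ((n + 2) ^ β) ^ D ≤ (n + 2) ^ (β * D + n₀) := by
      rw [← pow_mul]; exact Nat.pow_le_pow_right hMpos (Nat.le_add_right _ _)
    have hB2 : 2 ≤ (n + 2) ^ β := le_trans (by omega) (Nat.le_self_pow (by omega) (n + 2))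
    have hroomy : Roomy ((n + 2) ^ (β * D + n₀)) ((n + 2) ^ β) :=
      ⟨hB2, (Nat.pow_le_pow_right (by omega) (by omega)).trans hBD⟩
    have hn₀W : n₀ ≤ (n + 2) ^ (β * D + n₀) := by
      calc n₀ ≤ 2 ^ n₀ := Nat.lt_two_pow_self.le
        _ ≤ (n + 2) ^ n₀ := Nat.pow_le_pow_left (by omega) _
        _ ≤ _ := Nat.pow_le_pow_right hMpos (Nat.le_add_left _ _)
    by_cases hlt : n < n₀
    · simp only
      rw [if_pos hlt]
      obtain ⟨t, s', hr, ht, -, hq⟩ := wp_small (p := p) (a := a) (b := b) (k := k) (e := e)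
        hroomy hn₀W hlt hs h0 (fun i => input_arr_zero I i)
      exact ⟨t, s', hr, ht, hcorrect s' hq⟩
    · simp only
      rw [if_neg hlt]
      push Not at hlt
      have hg := hGbig n hlt
      have hgn := hGself n
      have hgle := hGle n
      have hglt := hGlt n
      have hgP := hG2 n (by omega)
      generalize G n = g at *
      have hexp := hG₁ g (by omega)
      have hg1 : 1 ≤ g + 1 := by omega
      have hUlt : (g + 1) * (2 * n ^ c) < 2 ^ g := by
        refine lt_of_le_of_lt ?_ hexp
        refine Nat.mul_le_mul_left _ (Nat.mul_le_mul_left _ ?_)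
        calc n ^ c ≤ ((g + 1) ^ b) ^ c := Nat.pow_le_pow_left hglt.le c
          _ = (g + 1) ^ (b * c) := by rw [pow_mul]
          _ ≤ _ := Nat.pow_le_pow_right hg1 (Nat.le_add_right _ _)
      have hng : n < 2 ^ g := by
        refine lt_of_le_of_lt (hglt.le.trans
          (Nat.pow_le_pow_right hg1 (Nat.le_add_left b (b * c)))) (lt_of_le_of_lt ?_ hexp)
        exact (Nat.le_mul_of_pos_left _ two_pos).trans (Nat.le_mul_of_pos_left _ hg1)
      have hsz := sizes_of_le (a := a) (b := b) (c := c) (e := e) (n := n) (g := g) (K₁ := K₁)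
        (β := β) (D := D) (n₀ := n₀) hn (by omega) hgn (by omega) he (by omega) hgle (by omega)
        (by omega) rfl rfl rfl hUlt
      have hM : n * g + 2 ≤ (n + 2) ^ 2 := by nlinarith only [hgn]
      have hans : Answers ((n * g + 2) ^ K₁) v (τ (n * g)) p n g (g ^ a) I.number := by
        refine answers_of_solver hκ hrun (by omega) (by omega) ?_
          (Nat.pow_le_pow_right (by omega) (by omega)) (Nat.mul_pos (by omega) (by omega)) ?_
        · calc v ≤ 2 ^ v := Nat.lt_two_pow_self.le
            _ ≤ (n * g + 2) ^ v := Nat.pow_le_pow_left (by omega) _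
            _ ≤ _ := Nat.pow_le_pow_right (by omega) (by omega)
        · have hgR : (1 : ℝ) ≤ g := by
            have : 1 ≤ g := by omega
            exact_mod_cast this
          have h5 : (g : ℝ) ^ (b + 1) ≤ ((n * g : ℕ) : ℝ) := by
            have : g ^ (b + 1) ≤ n * g := by
              rw [pow_succ]; exact Nat.mul_le_mul_right _ hgle
            exact_mod_cast this
          calc ((g ^ a * (g * g) : ℕ) : ℝ) = (g : ℝ) ^ ((a : ℝ) + 2) := by
                rw [Real.rpow_add (by positivity), Real.rpow_natCast, Real.rpow_two]
                push_cast; ring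
            _ ≤ (g : ℝ) ^ (((b + 1 : ℕ) : ℝ) * (1 - δ)) := by
                refine Real.rpow_le_rpow_of_exponent_le hgR ?_
                push_cast; exact haδ
            _ = ((g : ℝ) ^ (b + 1)) ^ (1 - δ) := by
                rw [Real.rpow_mul (by positivity), Real.rpow_natCast]
            _ ≤ ((n * g : ℕ) : ℝ) ^ (1 - δ) :=
                Real.rpow_le_rpow (by positivity) h5 (by linarith)
            _ = _ := by rw [pow_zero, one_mul, mul_one]
      have hQB : g ^ a ≤ (n + 2) ^ β :=
        (Nat.pow_le_pow_left (by omega) a).trans (Nat.pow_le_pow_right hMpos (by omega))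
      have hSB : (n * g + 2) ^ e * (g * g ^ k + 1) ≤ (n + 2) ^ β := by
        have h6 : g * g ^ k + 1 ≤ (n + 2) ^ (k + 2) := by
          calc g * g ^ k + 1 = g ^ (k + 1) + 1 := by ring
            _ ≤ (n + 2) ^ (k + 1) + (n + 2) ^ (k + 1) :=
              Nat.add_le_add (Nat.pow_le_pow_left (by omega) _) (Nat.one_le_pow _ _ (by omega))
            _ = (n + 2) ^ (k + 1) * 2 := by ring
            _ ≤ (n + 2) ^ (k + 1) * (n + 2) := Nat.mul_le_mul_left _ (by omega)
            _ = _ := by ring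
        calc (n * g + 2) ^ e * (g * g ^ k + 1) ≤ ((n + 2) ^ 2) ^ e * (n + 2) ^ (k + 2) :=
              Nat.mul_le_mul (Nat.pow_le_pow_left hM _) h6
          _ = (n + 2) ^ (2 * e + (k + 2)) := by rw [← pow_mul, ← pow_add]
          _ ≤ _ := Nat.pow_le_pow_right hMpos (by omega)
      have hhalf : ∀ l : List ℕ, l.Nodup → (∀ x ∈ l, x ≤ n ^ c) → l.length ≤ n →
          ∃ q, 0 < q ∧ q ≤ g ^ a ∧ 2 * overflow (g ^ k) q l ≤ l.length := by
        intro l hl hlU hln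
        have hlog : Nat.log 2 (n ^ c) ≤ g := by
          refine (Nat.log_mono_right (b := 2) (show n ^ c ≤ 2 ^ g from ?_)).trans
            (Nat.log_pow one_lt_two g).le
          exact ((Nat.le_mul_of_pos_left _ two_pos).trans (Nat.le_mul_of_pos_left _ hg1)).trans
            hUlt.le
        refine exists_overflow_le hl hlU ?_ (Nat.pow_pos (by omega))
          (le_trans (by omega) (Nat.le_self_pow (by omega) g))
        calc 2 * l.length * Nat.log 2 (n ^ c) ≤ 2 * n * g := by gcongr
          _ ≤ _ := two_mul_mul_le_pow_mul_primeCounting (by omega) hak (by omega) (by omega) hgP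
      have harr : ∀ A, 7 ≤ A → ∀ z, ((threeSum c).input I).arr A z = 0 := fun A hA z => by
        have : A ≠ 0 := by omega
        simp [threeSum, this]
      obtain ⟨t, s', hr, ht, -, hq⟩ := wp_large (p := p) hBD (by omega) hn₀W hlt hb hsz hans hgle
        hglt hs h0 (fun i => input_arr_zero I i) harr (hn ▸ number_injOn I) hQB hSB hng hhalf
      exact ⟨t, s', hr, ht, hcorrect s' hq⟩

end WordRAM

theorem theoremB1 (h3SUM : DeterministicThreeSumHypothesis) (δ : ℝ) (hδ0 : 0 < δ) (hδ1 : δ < 1) :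
    ∃ (C : ℝ) (k : ℕ), ∀ (κ : ℕ), 1 ≤ κ → ∀ (ε : ℝ), 0 < ε →
      ¬ (localAlignment (fun n => C * (n : ℝ) ^ (1 - δ) * Real.log n ^ k) κ).SolvableInTime
        (fun n => (n : ℝ) ^ (2 - δ - ε)) := by
  -- No logarithmic factor is needed: the block length is a small power of `n`, and the slack in the
  -- exponents absorbs it.
  refine ⟨1, 0, fun κ hκ ε hε h => ?_⟩
  obtain ⟨ε', hε', h'⟩ := WordRAM.threeSum_solvable hδ0 hδ1 hε hκ h
  obtain ⟨c, hc⟩ := h3SUM ε' hε'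
  exact hc (h' c)
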